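/- **Theorem 1.2.** Let $n\ge 3$, let $\Omega\subset\mathbb{R}^n$ be a bounded domain with $C^1$ boundary and outward unit normal $\nu$, and put $\partial\Omega_\pm=\{(y,\theta)\in\partial\Omega\times S^{n-1}:\pm\nu(y)\cdot\theta>0\}$. Let $x\in\Omega$ and $\zeta,\eta\in S^{n-1}$ with $\eta\neq\pm\zeta$. Let $a,b,c,d$ be the first points of $\partial\Omega$ reached from $x$ in the directions $-\zeta,-\eta,\zeta,\eta$ respectively, and assume that none of these four rays is tangent to $\partial\Omega$ at the point where it first meets it. Then $(a,\zeta),(b,\eta)\in\partial\Omega_-$, $(c,\zeta),(d,\eta)\in\partial\Omega_+$, and the following holds. *Profiles.* Call $\psi\in C_0^\infty(\mathbb{R}^n)$ with $0\le\psi\le1$ and $\psi(0)=1$ a profile, and put $$N_\psi(a,\zeta,\eta)=\int_{\zeta^\perp}\int_{\mathbb{R}}\psi\big(P_{a,\zeta}(s\eta-|x-a|\,\omega)\big)\,\psi(\omega)\,ds\,d\omega ,\qquad P_{a,\zeta}v=v-\frac{\nu(a)\cdot v}{\nu(a)\cdot\zeta}\,\zeta ,$$ where $d\omega$ is Lebesgue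 measure on the hyperplane $\zeta^\perp$; define $N_\psi(b,\eta,\zeta)$ likewise, with $(a,\zeta,\eta)$ replaced by $(b,\eta,\zeta)$. The profile $\psi$ is called normalized if $N_\psi(a,\zeta,\eta)\,N_\psi(b,\eta,\zeta)=1$. Normalized profiles exist. *Equation.* Let $\sigma\in C(\overline\Omega)$ be positive, and let $k\in C(\Omega\times S^{n-1}\times S^{n-1})$ be positive and bounded, with $k(y,\theta,\theta')=k(y,\theta',\theta)$ and $\sigma(y)\ge\int_{S^{n-1}}k(y,\theta,\theta')\,d\theta$ for all $y\in\Omega$ and $\theta,\theta'\in S^{n-1}$. A solution with boundary data $f$ on $\partial\Omega_-$ is a bounded measurable $u$ on $\Omega\times S^{n-1}$, with values also on $\partial\Omega_\pm$, such that $u=f$ on $\partial\Omega_-$ and $$\theta\cdot\nabla_y u(y,\theta)=-\sigma(y)u(y,\theta)+\int_{S^{n-1}}k(y,\theta,\theta')u(y,\theta')\,d\theta'$$ holds in integrated form along every characteristic $t\mapsto(y+t\theta,\theta)$ in $\Omega$, up to its points of entry in $\partial\Omega_-$ and of exit in $\partial\Omega_+$. *Conclusion.* Let $\psi$ be a normalized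 profile. For $\varepsilon>0$ and $(p,\xi)\in\{(a,\zeta),(b,\eta)\}$ let $u^\varepsilon_{p,\xi}$ and $U^\varepsilon_{p,\xi}$ be solutions whose boundary data on $\partial\Omega_-$ are $$\psi\Big(\frac{y-p}{\varepsilon}\Big)\psi\Big(\frac{\theta-\xi}{\varepsilon}\Big)\qquad\text{and}\qquad \varepsilon^{-n}\,\psi\Big(\frac{y-p}{\varepsilon}\Big)\psi\Big(\frac{\theta-\xi}{\varepsilon}\Big)$$ respectively. Then $$\lim_{\varepsilon\to0^+}\frac{U^\varepsilon_{a,\zeta}(d,\eta)\,U^\varepsilon_{b,\eta}(c,\zeta)}{u^\varepsilon_{a,\zeta}(c,\zeta)\,u^\varepsilon_{b,\eta}(d,\eta)}=k(x,\zeta,\eta)^2 .$$ -/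

import Mathlib

open Set Filter Topology MeasureTheory
open scoped RealInnerProductSpace

noncomputable section

/-- The Euclidean space `ℝⁿ`. -/
abbrev Rn (n : ℕ) : Type := EuclideanSpace ℝ (Fin n)

/-- The unit sphere `S^{n-1}` of `ℝⁿ`. -/
abbrev Sph (n : ℕ) : Type := Metric.sphere (0 : Rn n) 1

/-- The surface measure on `S^{n-1}`. -/
def surfaceMeasure (n : ℕ) : Measure (Sph n) := (volume : Measure (Rn n)).toSphere

/-- `ν` is the outward unit normal of `Ω` at `p`: near `p` the set `Ω` is `{ρ < 0}` for a `C¹`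
function `ρ` whose gradient at `p` is a positive multiple of `ν`. -/
def IsOutwardNormal {n : ℕ} (Ω : Set (Rn n)) (p ν : Rn n) : Prop :=
  ‖ν‖ = 1 ∧ ∃ ρ : Rn n → ℝ, ContDiffAt ℝ 1 ρ p ∧
    (∃ c : ℝ, 0 < c ∧ HasGradientAt ρ (c • ν) p) ∧ ∀ᶠ y in 𝓝 p, (y ∈ Ω ↔ ρ y < 0)

/-- A bounded domain of `ℝⁿ` with `C¹` boundary. -/
structure IsBoundedC1Domain {n : ℕ} (Ω : Set (Rn n)) : Prop where
  isOpen : IsOpen Ω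
  isConnected : IsConnected Ω
  isBounded : Bornology.IsBounded Ω
  boundary : ∀ p ∈ frontier Ω, ∃ ν, IsOutwardNormal Ω p ν

open Classical in
/-- The outward unit normal `ν(p)` at a boundary point `p` (the value is `0` if there is none). -/
def outwardNormal {n : ℕ} (Ω : Set (Rn n)) (p : Rn n) : Rn n :=
  if h : ∃ ν, IsOutwardNormal Ω p ν then h.choose else 0

/-- The incoming boundary `∂Ω₋`. -/
def inflow {n : ℕ} (Ω : Set (Rn n)) : Set (Rn n × Sph n) :=
  {q | q.1 ∈ frontier Ω ∧ ⟪outwardNormal Ω q.1, (q.2 : Rn n)⟫ < 0}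

/-- The outgoing boundary `∂Ω₊`. -/
def outflow {n : ℕ} (Ω : Set (Rn n)) : Set (Rn n × Sph n) :=
  {q | q.1 ∈ frontier Ω ∧ 0 < ⟪outwardNormal Ω q.1, (q.2 : Rn n)⟫}

/-- `p` is the first point of `∂Ω` reached from `x` when travelling in direction `ω`. -/
def IsFirstBoundaryPoint {n : ℕ} (Ω : Set (Rn n)) (x : Rn n) (ω : Sph n) (p : Rn n) : Prop :=
  ∃ t : ℝ, 0 < t ∧ p = x + t • (ω : Rn n) ∧ p ∈ frontier Ω ∧
    ∀ s ∈ Ioo 0 t, x + s • (ω : Rn n) ∉ frontier Ω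

/-- The standing assumptions on the absorption coefficient `σ` and the scattering kernel `k`. -/
structure IsAdmissible {n : ℕ} (Ω : Set (Rn n)) (σ : Rn n → ℝ)
    (k : Rn n → Sph n → Sph n → ℝ) : Prop where
  sigma_cont : ContinuousOn σ (closure Ω)
  sigma_pos : ∀ y ∈ closure Ω, 0 < σ y
  k_cont : ContinuousOn (fun q : Rn n × Sph n × Sph n => k q.1 q.2.1 q.2.2) (Ω ×ˢ univ)
  k_pos : ∀ y ∈ Ω, ∀ θ θ', 0 < k y θ θ'
  k_bdd : ∃ M : ℝ, ∀ y ∈ Ω, ∀ θ θ', k y θ θ' ≤ M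
  k_symm : ∀ y ∈ Ω, ∀ θ θ', k y θ θ' = k y θ' θ
  nongeneration : ∀ y ∈ Ω, ∀ θ', ∫ θ, k y θ θ' ∂(surfaceMeasure n) ≤ σ y

/-- The right-hand side `-σ u + ∫ k(·, θ, θ') u(·, θ') dθ'` of the radiative transport equation. -/
def rteRHS {n : ℕ} (σ : Rn n → ℝ) (k : Rn n → Sph n → Sph n → ℝ)
    (u : Rn n → Sph n → ℝ) (y : Rn n) (θ : Sph n) : ℝ :=
  -σ y * u y θ + ∫ θ', k y θ θ' * u y θ' ∂(surfaceMeasure n)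

/-- `u` is a bounded solution of `θ · ∇u = -σ u + ∫ k u dθ'` in `Ω × S^{n-1}` with `u = f` on
`∂Ω₋`. The equation is understood in integrated form along every characteristic line, up to its
points of entry in `∂Ω₋` and of exit in `∂Ω₊`; this gives the values of `u` on `∂Ω₊`. -/
structure IsRTESolution {n : ℕ} (Ω : Set (Rn n)) (σ : Rn n → ℝ) (k : Rn n → Sph n → Sph n → ℝ)
    (f u : Rn n → Sph n → ℝ) : Prop where
  measurable : Measurable fun q : Ω × Sph n => u q.1 q.2
  bounded : ∃ C : ℝ, ∀ y ∈ Ω, ∀ θ, |u y θ| ≤ C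
  transport : ∀ (y : Rn n) (θ : Sph n) (t : ℝ), 0 < t →
    (∀ r ∈ Ioo 0 t, y + r • (θ : Rn n) ∈ Ω) →
    (y ∈ Ω ∨ (y, θ) ∈ inflow Ω) →
    (y + t • (θ : Rn n) ∈ Ω ∨ (y + t • (θ : Rn n), θ) ∈ outflow Ω) →
    u (y + t • (θ : Rn n)) θ - u y θ = ∫ r in (0 : ℝ)..t, rteRHS σ k u (y + r • (θ : Rn n)) θ
  boundary : ∀ (y : Rn n) (θ : Sph n), (y, θ) ∈ inflow Ω → u y θ = f y θ

/-- The profiles: `ψ ∈ C₀^∞(ℝⁿ)`, `0 ≤ ψ ≤ 1`, `ψ(0) = 1`. -/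
structure IsProfile {n : ℕ} (ψ : Rn n → ℝ) : Prop where
  smooth : ContDiff ℝ ((⊤ : ℕ∞) : WithTop ℕ∞) ψ
  compactSupport : HasCompactSupport ψ
  nonneg : ∀ v, 0 ≤ ψ v
  le_one : ∀ v, ψ v ≤ 1
  at_zero : ψ 0 = 1

/-- The boundary source `ψ((y - a)/ε) ψ((θ - ζ)/ε)` focused at `(a, ζ)`. -/
def source {n : ℕ} (ψ : Rn n → ℝ) (a : Rn n) (ζ : Sph n) (ε : ℝ) (y : Rn n) (θ : Sph n) : ℝ :=
  ψ (ε⁻¹ • (y - a)) * ψ (ε⁻¹ • ((θ : Rn n) - (ζ : Rn n)))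

/-- The projection of `v` along `ζ` onto the hyperplane orthogonal to `ν`. -/
def obliqueProj {n : ℕ} (ν ζ v : Rn n) : Rn n := v - (⟪ν, v⟫ / ⟪ν, ζ⟫) • ζ

/-- The mass, in the limit of small `ε`, with which the source focused at the boundary point
`(a, ζ)` weights the crossing point `x` of the rays `a + sζ` and `x + sη`:
`∫_{ζ^⊥} ∫_ℝ ψ(P(sη - |x - a| ω)) ψ(ω) ds dω`, where `P` is the projection along `ζ` onto the
tangent hyperplane of `∂Ω` at `a`. The measure on `ζ^⊥` is the Lebesgue measure of that
`(n-1)`-dimensional Euclidean space. -/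
def beamMass {n : ℕ} (Ω : Set (Rn n)) (ψ : Rn n → ℝ) (x a : Rn n) (ζ η : Sph n) : ℝ :=
  ∫ ω : (ℝ ∙ (ζ : Rn n))ᗮ,
    (∫ s : ℝ, ψ (obliqueProj (outwardNormal Ω a) ζ (s • (η : Rn n) - ‖x - a‖ • (ω : Rn n)))
      * ψ (ω : Rn n)) ∂(measureSpaceOfInnerProductSpace.volume)

end

/-! A solution splits into an unscattered part, a singly scattered part and a remainder. The
particles that scatter once at `x` travel from `a` through `x` to `d`, and from `b` through `x` to
`c`. Together they meet exactly the attenuation of the two full chords `ac` and `bd`, which is what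
the denominator measures. Hence `σ` drops out of the quotient and only `k` at `x` survives, twice.

Denominator: the source equals 1 at its centre, so its unscattered part at the far end of the chord
is the attenuation of the chord. The source lights a cap of directions of area `O(ε^(n-1))`, so
whatever is scattered tends to zero (`TransportSetting.tendsto_ballistic`).

Numerator: in the transversal direction the unscattered part vanishes for small `ε`. Single
scattering is an integral over a point `x + εsη` of the chord and over a direction that differs from
`ζ` by about `εω`; these variables give the Jacobian `ε · ε^(n-1)`, which cancels `ε⁻ⁿ`. To first
order the ray through this point and direction enters at `a + ε P(sη - |x-a|ω)`. The displacement
must be tangential up to `o(ε)`, and it is known modulo `ζ`, where the exit time only slides the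
point along the ray (`tendsto_entryPoint_displacement`). Dominated convergence then produces
`beamMass` (`TransportSetting.tendsto_beamMass`).

Remainder: the unscattered beam stays in a tube of radius `R ~ ε` and in the cap. The length of a
ray inside the tube is at most `2R / sin(angle to the axis)`, and the inverse sine is integrable
over the sphere when `n ≥ 3` (`lintegral_inv_norm_perp_lt_top`). One averaging over rays thus turns
the tube indicator into a function of size `O(R)`, and `O(R²)` away from the axis; a second
integration makes it `o(R)` (`exists_sphLineInt_sphLineInt_tubeInd_le`,
`exists_lineInt_sphLineInt_tubeInd_le`). With the factor `ε^(n-1)` of the cap, multiple scattering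
is `o(εⁿ)`. These bounds pass to an arbitrary bounded solution by comparison with an explicit
supersolution (`TransportSetting.IsSuper.abs_le`); the contraction comes from `∫ k ≤ σ`.

The equation gives no information on a ray that enters tangentially. For each point of `Ω` the
directions of such rays form a null set, by a Sard argument in equal dimensions, for which `C¹`
suffices (`ae_entryPoint_transversal`). So they do not influence the scattering integrals. -/

noncomputable section

/-! ### Exit times and entry points of rays. -/

/-- The time after which the ray from `y` in direction `-θ` leaves `Ω`. -/
def backExit {n : ℕ} (Ω : Set (Rn n)) (y θ : Rn n) : ℝ :=
  sSup {t : ℝ | 0 ≤ t ∧ ∀ s ∈ Icc 0 t, y - s • θ ∈ Ω}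

/-- The point at which the ray from `y` in direction `-θ` leaves `Ω`. -/
def entryPoint {n : ℕ} (Ω : Set (Rn n)) (y θ : Rn n) : Rn n :=
  y - backExit Ω y θ • θ

section BackExit

variable {n : ℕ} {Ω : Set (Rn n)} {y θ : Rn n} {D : ℝ}

lemma backExit_nonneg : 0 ≤ backExit Ω y θ :=
  Real.sSup_nonneg fun _ h => h.1

lemma backExit_set_bddAbove (hD : ∀ y ∈ Ω, ∀ z ∈ Ω, dist y z ≤ D) (hθ : ‖θ‖ = 1) :
    D ∈ upperBounds {t : ℝ | 0 ≤ t ∧ ∀ s ∈ Icc 0 t, y - s • θ ∈ Ω} := by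
  rintro t ⟨h0, ht⟩
  have h1 := hD _ (ht 0 ⟨le_rfl, h0⟩) _ (ht t ⟨h0, le_rfl⟩)
  simpa [dist_eq_norm, norm_smul, hθ, abs_of_nonneg h0] using h1

lemma backExit_le (hD : ∀ y ∈ Ω, ∀ z ∈ Ω, dist y z ≤ D) (hθ : ‖θ‖ = 1) (hD0 : 0 ≤ D) :
    backExit Ω y θ ≤ D :=
  Real.sSup_le (fun _ ht => backExit_set_bddAbove hD hθ ht) hD0

lemma mem_of_lt_backExit {s : ℝ} (h0 : 0 ≤ s) (hs : s < backExit Ω y θ) : y - s • θ ∈ Ω := by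
  have hne : {t : ℝ | 0 ≤ t ∧ ∀ s ∈ Icc 0 t, y - s • θ ∈ Ω}.Nonempty := by
    by_contra h
    rw [not_nonempty_iff_eq_empty] at h
    -- For `y ∉ Ω` the set is empty and the exit time takes the default value `0`, which leaves no
    -- room for `0 ≤ s < 0`.
    rw [backExit, h, Real.sSup_empty] at hs
    exact absurd hs (not_lt.2 h0)
  obtain ⟨t, ht, hst⟩ := exists_lt_of_lt_csSup hne hs
  exact ht.2 s ⟨h0, hst.le⟩

/-- The segment on the right is closed although the inequality on the left is strict: a closed
segment inside an open set can be prolonged a little. This turns superlevel sets of the exit time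
into open conditions. -/
lemma lt_backExit_iff (hΩ : IsOpen Ω) (hD : ∀ y ∈ Ω, ∀ z ∈ Ω, dist y z ≤ D) (hθ : ‖θ‖ = 1)
    {c : ℝ} (hc : 0 ≤ c) : c < backExit Ω y θ ↔ ∀ s ∈ Icc 0 c, y - s • θ ∈ Ω := by
  constructor
  · intro h s hs
    exact mem_of_lt_backExit hs.1 (hs.2.trans_lt h)
  · intro h
    have hcont : Continuous fun s : ℝ => y - s • θ := by fun_prop
    obtain ⟨δ, hδ, hball⟩ := Metric.isOpen_iff.1 (hΩ.preimage hcont) c (h c ⟨hc, le_rfl⟩)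
    refine lt_of_lt_of_le (show c < c + δ / 2 by linarith)
      (le_csSup ⟨D, backExit_set_bddAbove hD hθ⟩ ⟨by linarith, fun s hs => ?_⟩)
    rcases le_or_gt s c with h1 | h1
    · exact h s ⟨hs.1, h1⟩
    · exact hball (by rw [Metric.mem_ball, Real.dist_eq, abs_of_pos (by linarith)]; linarith [hs.2])

lemma backExit_pos (hΩ : IsOpen Ω) (hD : ∀ y ∈ Ω, ∀ z ∈ Ω, dist y z ≤ D) (hθ : ‖θ‖ = 1)
    (hy : y ∈ Ω) : 0 < backExit Ω y θ := by
  rw [lt_backExit_iff hΩ hD hθ le_rfl]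
  rintro s hs
  have : s = 0 := by simpa using hs
  simpa [this] using hy

lemma entryPoint_notMem (hΩ : IsOpen Ω) (hD : ∀ y ∈ Ω, ∀ z ∈ Ω, dist y z ≤ D) (hθ : ‖θ‖ = 1) :
    entryPoint Ω y θ ∉ Ω := by
  intro h
  refine lt_irrefl (backExit Ω y θ) ((lt_backExit_iff hΩ hD hθ backExit_nonneg).2 fun s hs => ?_)
  rcases hs.2.lt_or_eq with h1 | h1
  · exact mem_of_lt_backExit hs.1 h1
  · rw [h1]; exact h

lemma entryPoint_mem_closure (hpos : 0 < backExit Ω y θ) : entryPoint Ω y θ ∈ closure Ω := by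
  have hcont : Continuous fun s : ℝ => y - s • θ := by fun_prop
  refine hcont.closure_preimage_subset Ω ?_
  have h1 : Ico 0 (backExit Ω y θ) ⊆ (fun s : ℝ => y - s • θ) ⁻¹' Ω :=
    fun s hs => mem_of_lt_backExit hs.1 hs.2
  refine closure_mono h1 ?_
  rw [closure_Ico hpos.ne]
  exact ⟨hpos.le, le_rfl⟩

lemma entryPoint_mem_frontier (hΩ : IsOpen Ω) (hD : ∀ y ∈ Ω, ∀ z ∈ Ω, dist y z ≤ D)
    (hθ : ‖θ‖ = 1) (hy : y ∈ Ω) : entryPoint Ω y θ ∈ frontier Ω := by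
  rw [hΩ.frontier_eq]
  exact ⟨entryPoint_mem_closure (backExit_pos hΩ hD hθ hy), entryPoint_notMem hΩ hD hθ⟩

/-- Lower semicontinuity of the exit time, by compactness of the segment. It needs no regularity of
the boundary and already yields measurability; the upper half is where transversality enters. -/
lemma isOpen_lt_backExit (hΩ : IsOpen Ω) (hD : ∀ y ∈ Ω, ∀ z ∈ Ω, dist y z ≤ D) {c : ℝ}
    (hc : 0 ≤ c) : IsOpen {q : Rn n × Sph n | c < backExit Ω q.1 q.2} := by
  have h1 : {q : Rn n × Sph n | c < backExit Ω q.1 q.2} =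
      {q | ∀ s ∈ Icc 0 c, q.1 - s • (q.2 : Rn n) ∈ Ω} := by
    ext q
    exact lt_backExit_iff hΩ hD (norm_eq_of_mem_sphere q.2) hc
  rw [h1, isOpen_iff_mem_nhds]
  intro q hq
  have hcont : Continuous fun w : (Rn n × Sph n) × ℝ => w.1.1 - w.2 • (w.1.2 : Rn n) := by
    fun_prop
  refine (isCompact_Icc (a := (0 : ℝ)) (b := c)).eventually_forall_of_forall_eventually
    fun s hs => ?_
  exact (hcont.tendsto (q, s)).eventually (hΩ.mem_nhds (hq s hs))

lemma measurable_backExit (hΩ : IsOpen Ω) (hD : ∀ y ∈ Ω, ∀ z ∈ Ω, dist y z ≤ D) :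
    Measurable fun q : Rn n × Sph n => backExit Ω q.1 q.2 := by
  refine measurable_of_Ioi fun c => ?_
  rcases le_or_gt 0 c with hc | hc
  · exact (isOpen_lt_backExit hΩ hD hc).measurableSet
  · convert MeasurableSet.univ
    ext q
    simpa using hc.trans_le backExit_nonneg

lemma measurable_entryPoint (hΩ : IsOpen Ω) (hD : ∀ y ∈ Ω, ∀ z ∈ Ω, dist y z ≤ D) :
    Measurable fun q : Rn n × Sph n => entryPoint Ω q.1 q.2 := by
  have := measurable_backExit hΩ hD
  unfold entryPoint
  fun_prop

attribute [irreducible] backExit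

end BackExit

/-! ### Local defining functions and normals. -/

section Normal

variable {n : ℕ} {Ω : Set (Rn n)} {p ν : Rn n}

lemma outwardNormal_spec (hΩ : IsBoundedC1Domain Ω) (hp : p ∈ frontier Ω) :
    IsOutwardNormal Ω p (outwardNormal Ω p) := by
  have h := hΩ.boundary p hp
  rw [outwardNormal, dif_pos h]
  exact h.choose_spec

/-- A defining function may be normalized to have the outward normal as its gradient. -/
lemma IsOutwardNormal.exists_defining (h : IsOutwardNormal Ω p ν) :
    ∃ ρ : Rn n → ℝ, ContDiffAt ℝ 1 ρ p ∧ HasFDerivAt ρ (innerSL ℝ ν) p ∧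
      ∀ᶠ y in 𝓝 p, (y ∈ Ω ↔ ρ y < 0) := by
  obtain ⟨-, ρ, hρ, ⟨c, hc, hg⟩, hev⟩ := h
  refine ⟨fun y => c⁻¹ * ρ y, contDiffAt_const.mul hρ, ?_, ?_⟩
  · have hg' : HasFDerivAt ρ (innerSL ℝ (c • ν)) p := hg.hasFDerivAt
    convert! hg'.const_mul c⁻¹ using 1
    ext v
    simp [hc.ne']
  · filter_upwards [hev] with y hy
    rw [hy]
    constructor
    · intro h; exact mul_neg_of_pos_of_neg (inv_pos.2 hc) h
    · intro h; exact (pos_iff_neg_of_mul_neg h).1 (inv_pos.2 hc)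

/-- The sign of `ρ` decides membership in `Ω` in a neighbourhood of `q`: a positive value keeps `q`
out of the closure, a negative one puts it into the open set. A whole piece of the boundary is
covered, not only `p`, because nearby entry points and the Sard chart both move along it. -/
lemma eventually_frontier_eq_zero {ρ : Rn n → ℝ} (hΩ : IsOpen Ω) (hρ : ContDiffAt ℝ 1 ρ p)
    (hev : ∀ᶠ y in 𝓝 p, (y ∈ Ω ↔ ρ y < 0)) : ∀ᶠ q in 𝓝 p, q ∈ frontier Ω → ρ q = 0 := by
  have hc : ∀ᶠ q in 𝓝 p, ContinuousAt ρ q :=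
    (hρ.eventually (by simp)).mono fun q hq => hq.continuousAt
  filter_upwards [hc, hev.eventually_nhds] with q hq1 hq2 hqf
  rw [hΩ.frontier_eq] at hqf
  refine le_antisymm ?_ ?_
  · by_contra hlt
    have h1 : ∀ᶠ y in 𝓝 q, y ∉ Ω := by
      filter_upwards [hq2, hq1.eventually (lt_mem_nhds (not_le.1 hlt))] with y hy1 hy2
      rw [hy1]; exact not_lt.2 hy2.le
    obtain ⟨y, hy1, hy2⟩ := (mem_closure_iff_frequently.1 hqf.1).and_eventually h1 |>.exists
    exact hy2 hy1
  · by_contra hlt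
    exact hqf.2 (hq2.self_of_nhds.2 (not_le.1 hlt))

lemma hasDerivAt_line {ρ : Rn n → ℝ} (hg : HasFDerivAt ρ (innerSL ℝ ν) p) (v : Rn n) :
    HasDerivAt (fun s : ℝ => ρ (p + s • v)) ⟪ν, v⟫ 0 := by
  have h1 : HasDerivAt (fun s : ℝ => p + s • v) v 0 := by
    simpa using ((hasDerivAt_id (0 : ℝ)).smul_const v).const_add p
  have h2 : HasFDerivAt ρ (innerSL ℝ ν) (p + (0 : ℝ) • v) := by
    simpa using hg
  exact h2.comp_hasDerivAt (0 : ℝ) h1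

/-- If `ρ` vanishes at `p` and has a positive derivative there in direction `v`, then it is
positive at nearby points in this direction. -/
lemma eventually_pos_line {ρ : Rn n → ℝ} (hg : HasFDerivAt ρ (innerSL ℝ ν) p) (h0 : ρ p = 0) {v : Rn n}
    (hv : 0 < ⟪ν, v⟫) : ∀ᶠ s : ℝ in 𝓝[>] 0, 0 < ρ (p + s • v) := by
  have h1 := (hasDerivAt_iff_tendsto_slope.1 (hasDerivAt_line hg v)).mono_left
    (nhdsWithin_mono 0 (fun s (hs : 0 < s) => hs.ne' : Ioi (0 : ℝ) ⊆ {0}ᶜ))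
  filter_upwards [h1.eventually (lt_mem_nhds hv), self_mem_nhdsWithin] with s hs1 hs2
  rw [slope_def_field] at hs1
  have hs2' : (0 : ℝ) < s := hs2
  simp only [zero_smul, add_zero, h0, sub_zero] at hs1
  exact (div_pos_iff_of_pos_right hs2').1 hs1

lemma eventually_neg_line {ρ : Rn n → ℝ} (hg : HasFDerivAt ρ (innerSL ℝ ν) p) (h0 : ρ p = 0) {v : Rn n}
    (hv : ⟪ν, v⟫ < 0) : ∀ᶠ s : ℝ in 𝓝[>] 0, ρ (p + s • v) < 0 := by
  have hg' : HasFDerivAt (fun y => -ρ y) (innerSL ℝ (-ν)) p := by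
    convert! hg.neg using 1
    ext v
    simp
  filter_upwards [eventually_pos_line hg' (by simp [h0]) (v := v) (by simpa using hv)] with s hs
  linarith

/-- A ray issued from a boundary point into the domain makes an obtuse angle with the normal. -/
lemma IsOutwardNormal.inner_nonpos (hΩ : IsOpen Ω) (hp : p ∈ frontier Ω)
    (hν : IsOutwardNormal Ω p ν) {v : Rn n} {t : ℝ} (ht : 0 < t)
    (h : ∀ s ∈ Ioo 0 t, p + s • v ∈ Ω) : ⟪ν, v⟫ ≤ 0 := by
  obtain ⟨ρ, hρ, hg, hev⟩ := hν.exists_defining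
  by_contra hlt
  have h0 := (eventually_frontier_eq_zero hΩ hρ hev).self_of_nhds hp
  have hcont : Tendsto (fun s : ℝ => p + s • v) (𝓝[>] 0) (𝓝 p) := by
    have : Continuous fun s : ℝ => p + s • v := by fun_prop
    simpa using (this.tendsto 0).mono_left nhdsWithin_le_nhds
  obtain ⟨s, ⟨hs1, hs2⟩, hs3⟩ := ((eventually_pos_line hg h0 (not_le.1 hlt)).and
    (hcont.eventually hev)).and (Ioo_mem_nhdsGT ht) |>.exists
  linarith [hs2.1 (h s hs3)]

/-- Two normals at the same boundary point have the same tangent hyperplane. -/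
lemma inner_eq_zero_of_defining {ρ : Rn n → ℝ} {g : Rn n} (hΩ : IsOpen Ω) (hp : p ∈ frontier Ω)
    (hν : IsOutwardNormal Ω p ν) (hρ : ContDiffAt ℝ 1 ρ p) (hg : HasFDerivAt ρ (innerSL ℝ g) p)
    (hev : ∀ᶠ y in 𝓝 p, (y ∈ Ω ↔ ρ y < 0)) {v : Rn n} (hv : ⟪ν, v⟫ = 0) : ⟪g, v⟫ = 0 := by
  have h0 := (eventually_frontier_eq_zero hΩ hρ hev).self_of_nhds hp
  have key : ∀ w : Rn n, ⟪g, w⟫ < 0 → ⟪ν, w⟫ ≤ 0 := by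
    intro w hw
    have hcont : Tendsto (fun s : ℝ => p + s • w) (𝓝[>] 0) (𝓝 p) := by
      have : Continuous fun s : ℝ => p + s • w := by fun_prop
      simpa using (this.tendsto 0).mono_left nhdsWithin_le_nhds
    have h1 : ∀ᶠ s : ℝ in 𝓝[>] 0, p + s • w ∈ Ω := by
      filter_upwards [eventually_neg_line hg h0 hw, hcont.eventually hev] with s h1 h2
      exact h2.2 h1
    obtain ⟨t, ht, hsub⟩ := mem_nhdsGT_iff_exists_Ioo_subset.1 h1
    exact hν.inner_nonpos hΩ hp ht hsub
  -- If `⟪g, w⟫ < 0`, then `w + h • ν` with small `h > 0` still points into `Ω` according to `g`,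
  -- while its product with `ν` is `h > 0`, against `key`.
  have key2 : ∀ w : Rn n, ⟪ν, w⟫ = 0 → 0 ≤ ⟪g, w⟫ := by
    intro w hw
    by_contra hlt
    push Not at hlt
    have hcont : Continuous fun h : ℝ => ⟪g, w + h • ν⟫ := by fun_prop
    have h1 : ∀ᶠ h : ℝ in 𝓝 0, ⟪g, w + h • ν⟫ < 0 :=
      hcont.continuousAt.eventually (gt_mem_nhds (by simpa using hlt))
    obtain ⟨h, h2, h3⟩ := ((h1.filter_mono nhdsWithin_le_nhds).and
      (self_mem_nhdsWithin (s := Ioi (0 : ℝ)))).exists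
    have h4 := key _ h2
    rw [inner_add_right, hw, inner_smul_right, real_inner_self_eq_norm_sq, hν.1] at h4
    have h3' : 0 < h := h3
    linarith
  refine le_antisymm ?_ (key2 v hv)
  have := key2 (-v) (by simp [hv])
  simpa using this

end Normal

/-! ### First-order behaviour of the entry point of a transversal ray. -/

section Transversal

variable {n : ℕ} {Ω : Set (Rn n)} {D : ℝ}

lemma entryPoint_add_mem {y θ : Rn n} {s : ℝ} (hs : s ∈ Ioo 0 (backExit Ω y θ)) :
    entryPoint Ω y θ + s • θ ∈ Ω := by
  have := mem_of_lt_backExit (Ω := Ω) (y := y) (θ := θ) (s := backExit Ω y θ - s)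
    (by linarith [hs.2]) (by linarith [hs.1])
  convert this using 1
  rw [entryPoint, sub_smul]; abel

lemma inner_outwardNormal_entryPoint_nonpos (hΩ : IsBoundedC1Domain Ω)
    (hD : ∀ y ∈ Ω, ∀ z ∈ Ω, dist y z ≤ D) {y θ : Rn n} (hθ : ‖θ‖ = 1) (hy : y ∈ Ω) :
    ⟪outwardNormal Ω (entryPoint Ω y θ), θ⟫ ≤ 0 := by
  have hf := entryPoint_mem_frontier hΩ.isOpen hD hθ hy
  exact (outwardNormal_spec hΩ hf).inner_nonpos hΩ.isOpen hf
    (backExit_pos hΩ.isOpen hD hθ hy) fun s hs => entryPoint_add_mem hs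

lemma entryPoint_mem_inflow (hΩ : IsBoundedC1Domain Ω)
    (hD : ∀ y ∈ Ω, ∀ z ∈ Ω, dist y z ≤ D) {y : Rn n} {θ : Sph n} (hy : y ∈ Ω)
    (h : ⟪outwardNormal Ω (entryPoint Ω y θ), (θ : Rn n)⟫ ≠ 0) :
    (entryPoint Ω y θ, θ) ∈ inflow Ω :=
  ⟨entryPoint_mem_frontier hΩ.isOpen hD (norm_eq_of_mem_sphere θ) hy,
    (inner_outwardNormal_entryPoint_nonpos hΩ hD (norm_eq_of_mem_sphere θ) hy).lt_of_ne h⟩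

/-- Beyond a boundary point met transversally, the ray leaves the closure of the domain. -/
lemma eventually_notMem_closure (hΩ : IsBoundedC1Domain Ω) {p θ : Rn n} (hp : p ∈ frontier Ω)
    (h : ⟪outwardNormal Ω p, θ⟫ < 0) : ∀ᶠ s : ℝ in 𝓝[>] 0, p - s • θ ∉ closure Ω := by
  have hν := outwardNormal_spec hΩ hp
  obtain ⟨ρ, hρ, hg, hev⟩ := hν.exists_defining
  have h0 := (eventually_frontier_eq_zero hΩ.isOpen hρ hev).self_of_nhds hp
  have hc : ∀ᶠ q in 𝓝 p, ContinuousAt ρ q :=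
    (hρ.eventually (by simp)).mono fun q hq => hq.continuousAt
  have hcont : Tendsto (fun s : ℝ => p + s • (-θ)) (𝓝[>] 0) (𝓝 p) := by
    have : Continuous fun s : ℝ => p + s • (-θ) := by fun_prop
    simpa using (this.tendsto 0).mono_left nhdsWithin_le_nhds
  filter_upwards [eventually_pos_line hg h0 (v := -θ) (by simpa using h),
    hcont.eventually (hc.and hev.eventually_nhds)] with s h1 h2
  rw [sub_eq_add_neg, ← smul_neg]
  intro hcl
  have h3 : ∀ᶠ y in 𝓝 (p + s • (-θ)), y ∉ Ω := by
    filter_upwards [h2.2, h2.1.eventually (lt_mem_nhds h1)] with y hy1 hy2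
    rw [hy1]; exact not_lt.2 hy2.le
  obtain ⟨y, hy1, hy2⟩ := ((mem_closure_iff_frequently.1 hcl).and_eventually h3).exists
  exact hy2 hy1

/-- For the upper bound: just beyond a transversal entry point the ray is outside `closure Ω`. This
is an open condition on position and direction, so nearby rays have left `Ω` by the same time. -/
lemma continuousAt_backExit (hΩ : IsBoundedC1Domain Ω) (hD : ∀ y ∈ Ω, ∀ z ∈ Ω, dist y z ≤ D)
    {x : Rn n} {ζ : Sph n} (hx : x ∈ Ω)
    (h : ⟪outwardNormal Ω (entryPoint Ω x ζ), (ζ : Rn n)⟫ ≠ 0) :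
    ContinuousAt (fun q : Rn n × Sph n => backExit Ω q.1 q.2) (x, ζ) := by
  have hζ := norm_eq_of_mem_sphere ζ
  have hpos := backExit_pos hΩ.isOpen hD hζ hx
  have hin := entryPoint_mem_inflow hΩ hD hx h
  refine tendsto_order.2 ⟨fun c hc => ?_, fun c hc => ?_⟩
  · have h1 : max c 0 < backExit Ω x ζ := max_lt hc hpos
    filter_upwards [(isOpen_lt_backExit hΩ.isOpen hD (le_max_right c 0)).mem_nhds h1] with q hq
    exact (le_max_left c 0).trans_lt hq
  · obtain ⟨s, hs1, hs2⟩ := ((eventually_notMem_closure hΩ hin.1 hin.2).and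
      (Ioo_mem_nhdsGT (sub_pos.2 hc))).exists
    have hcont : Continuous fun q : Rn n × Sph n => q.1 - (backExit Ω x ζ + s) • (q.2 : Rn n) := by
      fun_prop
    have h2 : x - (backExit Ω x ζ + s) • (ζ : Rn n) ∉ closure Ω := by
      convert hs1 using 2
      simp only [entryPoint]
      module
    filter_upwards [(hcont.tendsto (x, ζ)).eventually (isClosed_closure.isOpen_compl.mem_nhds h2)]
      with q hq
    by_contra hlt
    have := mem_of_lt_backExit (Ω := Ω) (y := q.1) (θ := q.2) (s := backExit Ω x ζ + s)
      (by linarith [hs2.1]) (by simp only [not_lt] at hlt hc ⊢; linarith [hs2.2])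
    exact hq (subset_closure this)

/-- The projection forgets displacements along the ray, hence the variation of the exit time. -/
lemma obliqueProj_sub_smul {ν ζ : Rn n} (h : ⟪ν, ζ⟫ ≠ 0) (v : Rn n) (c : ℝ) :
    obliqueProj ν ζ (v - c • ζ) = obliqueProj ν ζ v := by
  simp only [obliqueProj, inner_sub_right, inner_smul_right, sub_div, mul_div_cancel_right₀ _ h]
  module

lemma continuous_obliqueProj (ν ζ : Rn n) : Continuous (obliqueProj ν ζ) := by
  unfold obliqueProj
  fun_prop

/-- When the normal component is negligible against the vector, the vector and its oblique
projection are asymptotically equivalent, so the limit of the projection is the limit of the vector.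
No bound on `q` is needed beforehand: the equivalence provides it. -/
lemma tendsto_of_obliqueProj {ι : Type*} {l : Filter ι} {q : ι → Rn n} {ν ζ w : Rn n}
    (hlit : (fun i => ⟪ν, q i⟫) =o[l] q) (hP : Tendsto (fun i => obliqueProj ν ζ (q i)) l (𝓝 w)) :
    Tendsto q l (𝓝 w) := by
  have hequiv : Asymptotics.IsEquivalent l q (fun i => obliqueProj ν ζ (q i)) := by
    symm
    have h2 : (fun i => ⟪ν, q i⟫ / ⟪ν, ζ⟫) =o[l] q := by
      simp only [div_eq_inv_mul]
      exact hlit.const_mul_left _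
    have h1 : (fun i => (⟪ν, q i⟫ / ⟪ν, ζ⟫) • ζ) =o[l] q := by
      refine Asymptotics.IsBigO.trans_isLittleO (Asymptotics.IsBigO.of_bound ‖ζ‖ ?_) h2
      exact Eventually.of_forall fun i => by rw [norm_smul, mul_comm]
    refine h1.neg_left.congr_left fun i => ?_
    simp [obliqueProj]
  have hO : (fun i => obliqueProj ν ζ (q i)) =O[l] (fun _ => (1 : ℝ)) := hP.isBigO_one ℝ
  have h0 : Tendsto (q - fun i => obliqueProj ν ζ (q i)) l (𝓝 0) :=
    (Asymptotics.isLittleO_one_iff ℝ).1 (hequiv.isLittleO.trans_isBigO hO)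
  have := h0.add hP
  rw [zero_add] at this
  exact this.congr fun i => by simp

/-- The displacement of the entry points is tangential to first order. -/
lemma isLittleO_inner_outwardNormal (hΩ : IsBoundedC1Domain Ω) {ι : Type*} {l : Filter ι}
    {a : Rn n} (ha : a ∈ frontier Ω) {p : ι → Rn n} (hp : ∀ᶠ i in l, p i ∈ frontier Ω)
    (hpa : Tendsto p l (𝓝 a)) :
    (fun i => ⟪outwardNormal Ω a, p i - a⟫) =o[l] fun i => p i - a := by
  obtain ⟨ρ, hρ, hg, hev⟩ := (outwardNormal_spec hΩ ha).exists_defining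
  have hz := eventually_frontier_eq_zero hΩ.isOpen hρ hev
  have h1 := (hasFDerivAt_iff_isLittleO.1 hg).comp_tendsto hpa
  refine (h1.neg_left).congr' ?_ (Eventually.of_forall fun _ => rfl)
  filter_upwards [hpa.eventually hz, hp] with i h3 h4
  simp [h3 h4, hz.self_of_nhds ha]

lemma tendsto_of_tendsto_inv_smul_sub {Z : ℝ → Rn n} {z u : Rn n}
    (hZ : Tendsto (fun ε : ℝ => ε⁻¹ • (Z ε - z)) (𝓝[>] 0) (𝓝 u)) :
    Tendsto Z (𝓝[>] 0) (𝓝 z) := by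
  have hε : Tendsto (fun ε : ℝ => ε) (𝓝[>] 0) (𝓝 0) := tendsto_nhdsWithin_of_tendsto_nhds tendsto_id
  have h1 := (hε.smul hZ).add_const z
  rw [zero_smul, zero_add] at h1
  refine h1.congr' ?_
  filter_upwards [self_mem_nhdsWithin] with ε h0
  rw [smul_smul, mul_inv_cancel₀ (ne_of_gt h0), one_smul, sub_add_cancel]

/-- First order displacement of the entry point of a ray, when the ray is perturbed by
`ε v` in position and `ε w` in direction. -/
lemma tendsto_entryPoint_displacement (hΩ : IsBoundedC1Domain Ω)
    (hD : ∀ y ∈ Ω, ∀ z ∈ Ω, dist y z ≤ D) {x : Rn n} {ζ : Sph n} (hx : x ∈ Ω)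
    (h : ⟪outwardNormal Ω (entryPoint Ω x ζ), (ζ : Rn n)⟫ ≠ 0)
    {Y : ℝ → Rn n} {Θ : ℝ → Sph n} {v w : Rn n}
    (hY : Tendsto (fun ε : ℝ => ε⁻¹ • (Y ε - x)) (𝓝[>] 0) (𝓝 v))
    (hΘ : Tendsto (fun ε : ℝ => ε⁻¹ • ((Θ ε : Rn n) - ζ)) (𝓝[>] 0) (𝓝 w)) :
    Tendsto (fun ε : ℝ => ε⁻¹ • (entryPoint Ω (Y ε) (Θ ε) - entryPoint Ω x ζ)) (𝓝[>] 0)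
      (𝓝 (obliqueProj (outwardNormal Ω (entryPoint Ω x ζ)) ζ (v - backExit Ω x ζ • w))) := by
  have hYx : Tendsto Y (𝓝[>] 0) (𝓝 x) := tendsto_of_tendsto_inv_smul_sub hY
  have hΘ1 : Tendsto (fun ε => (Θ ε : Rn n)) (𝓝[>] 0) (𝓝 ζ) := tendsto_of_tendsto_inv_smul_sub hΘ
  have hΘζ : Tendsto Θ (𝓝[>] 0) (𝓝 ζ) := tendsto_subtype_rng.2 hΘ1
  have hτ : Tendsto (fun ε => backExit Ω (Y ε) (Θ ε)) (𝓝[>] 0) (𝓝 (backExit Ω x ζ)) := by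
    have h1 := (continuousAt_backExit hΩ hD hx h).tendsto.comp (hYx.prodMk_nhds hΘζ)
    exact h1
  have hYΩ : ∀ᶠ ε in 𝓝[>] 0, Y ε ∈ Ω := hYx.eventually (hΩ.isOpen.mem_nhds hx)
  have hin := entryPoint_mem_inflow hΩ hD hx h
  have hpa : Tendsto (fun ε => entryPoint Ω (Y ε) (Θ ε)) (𝓝[>] 0) (𝓝 (entryPoint Ω x ζ)) :=
    hYx.sub (hτ.smul hΘ1)
  refine tendsto_of_obliqueProj (ν := outwardNormal Ω (entryPoint Ω x ζ)) (ζ := (ζ : Rn n)) ?_ ?_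
  · have h2 := isLittleO_inner_outwardNormal hΩ hin.1 (hYΩ.mono fun ε h4 =>
      entryPoint_mem_frontier hΩ.isOpen hD (norm_eq_of_mem_sphere (Θ ε)) h4) hpa
    refine ((Asymptotics.isBigO_refl (fun ε : ℝ => ε⁻¹) _).smul_isLittleO h2).congr_left ?_
    intro ε
    rw [inner_smul_right, smul_eq_mul]
  · refine (((continuous_obliqueProj _ _).tendsto _).comp (hY.sub (hτ.smul hΘ))).congr fun ε => ?_
    -- The exit time is only known to be continuous. Its difference quotient may fail to converge,
    -- but it multiplies `ζ` and is annihilated by the projection.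
    rw [← obliqueProj_sub_smul h (ε⁻¹ • (entryPoint Ω (Y ε) (Θ ε) - entryPoint Ω x ζ))
      (-(ε⁻¹ * (backExit Ω (Y ε) (Θ ε) - backExit Ω x ζ)))]
    simp only [Function.comp_apply]
    congr 1
    simp only [entryPoint]
    module

end Transversal

/-! ### Tangential rays through a point: a Sard argument. -/

section Sard

variable {n : ℕ} {Ω : Set (Rn n)} {D : ℝ}

/-- The part near a boundary point of the cone with vertex `y` over the set of boundary points at
which the ray from `y` is tangent to the boundary is a null set. -/
lemma exists_nhds_volume_tangential_cone_eq_zero (hΩ : IsBoundedC1Domain Ω) (y : Rn n) {p : Rn n}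
    (hp : p ∈ frontier Ω) : ∃ U ∈ 𝓝 p, volume {z : Rn n | ∃ q ∈ U, ∃ h ∈ Ioo (0 : ℝ) 1,
      q ∈ frontier Ω ∧ ⟪outwardNormal Ω q, q - y⟫ = 0 ∧ z = (1 + h) • (q - y)} = 0 := by
  have hN := outwardNormal_spec hΩ hp
  set ν := outwardNormal Ω p with hν
  obtain ⟨ρ, hρ, hg, hev⟩ := hN.exists_defining
  -- `L` straightens the boundary: it changes only the `ν` component, which becomes `ρ q`, and its
  -- derivative at `p` is the identity.
  set L : Rn n → Rn n := fun q => q + (ρ q - ⟪ν, q⟫) • ν with hL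
  have hLd : ContDiffAt ℝ 1 L p := by
    have : ContDiff ℝ 1 fun q : Rn n => ⟪ν, q⟫ := contDiff_const.inner ℝ contDiff_id
    exact contDiffAt_id.add ((hρ.sub this.contDiffAt).smul contDiffAt_const)
  have hLderiv : ∀ {q : Rn n} {ρ' : Rn n →L[ℝ] ℝ}, HasFDerivAt ρ ρ' q →
      HasFDerivAt L (ContinuousLinearMap.id ℝ (Rn n) +
        (ρ' - innerSL ℝ ν).smulRight ν) q := by
    intro q ρ' hq
    have h1 : HasFDerivAt (fun q : Rn n => ⟪ν, q⟫) (innerSL ℝ ν) q := (innerSL ℝ ν).hasFDerivAt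
    exact (hasFDerivAt_id q).add ((hq.sub h1).smul_const ν)
  have hL0 : HasFDerivAt L ((ContinuousLinearEquiv.refl ℝ (Rn n) : Rn n ≃L[ℝ] Rn n) :
      Rn n →L[ℝ] Rn n) p := by
    convert! hLderiv hg using 1
    ext v
    simp
  set e := hLd.toOpenPartialHomeomorph L hL0 one_ne_zero with he
  have hecoe : ∀ q, e q = L q := fun q => by
    rw [he, ContDiffAt.toOpenPartialHomeomorph_coe]
  have hpe : p ∈ e.source := hLd.mem_toOpenPartialHomeomorph_source hL0 one_ne_zero
  have hsymm : ContDiffAt ℝ 1 e.symm (L p) := hLd.to_localInverse hL0 one_ne_zero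
  have hsymmd : ∀ᶠ z in 𝓝 (L p), DifferentiableAt ℝ e.symm z :=
    (hsymm.eventually (by simp)).mono fun z hz => hz.differentiableAt one_ne_zero
  have hρd : ∀ᶠ q in 𝓝 p, ContDiffAt ℝ 1 ρ q := hρ.eventually (by simp)
  have hUev : ∀ᶠ q in 𝓝 p, q ∈ e.source ∧ DifferentiableAt ℝ e.symm (L q) ∧ ContDiffAt ℝ 1 ρ q ∧
      (q ∈ frontier Ω → ρ q = 0) ∧ ∀ᶠ z in 𝓝 q, (z ∈ Ω ↔ ρ z < 0) := by
    filter_upwards [e.open_source.mem_nhds hpe, hLd.continuousAt.eventually hsymmd, hρd,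
      eventually_frontier_eq_zero hΩ.isOpen hρ hev, hev.eventually_nhds] with q h1 h2 h3 h4 h5
    exact ⟨h1, h2, h3, h4, h5⟩
  refine ⟨_, hUev, ?_⟩
  set π : Rn n → Rn n := fun z => z - ⟪ν, z⟫ • ν with hπ
  set π' : Rn n →L[ℝ] Rn n := ContinuousLinearMap.id ℝ (Rn n) - (innerSL ℝ ν).smulRight ν with hπ'
  have hνν : ⟪ν, ν⟫ = 1 := by rw [real_inner_self_eq_norm_sq, hN.1]; norm_num
  -- The component of `z` orthogonal to `ν` parametrizes the boundary and the component along `ν` is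
  -- the dilation parameter `h`, so the cone is the image under `Ψ` of the set `s` of parameters.
  set Ψ : Rn n → Rn n := fun z => (1 + ⟪ν, z⟫) • (e.symm (π z) - y) with hΨ
  set s : Set (Rn n) := {z | ∃ q, (q ∈ e.source ∧ DifferentiableAt ℝ e.symm (L q) ∧
      ContDiffAt ℝ 1 ρ q ∧ (q ∈ frontier Ω → ρ q = 0) ∧ ∀ᶠ z in 𝓝 q, (z ∈ Ω ↔ ρ z < 0)) ∧
      ∃ h ∈ Ioo (0 : ℝ) 1, q ∈ frontier Ω ∧ ⟪outwardNormal Ω q, q - y⟫ = 0 ∧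
      z = L q + h • ν} with hs
  have hfacts : ∀ q, q ∈ e.source → ρ q = 0 → ∀ h : ℝ,
      ⟪ν, L q + h • ν⟫ = h ∧ π (L q + h • ν) = L q ∧ e.symm (L q) = q := by
    intro q hq h0 h
    have h1 : ⟪ν, L q + h • ν⟫ = h := by
      simp only [hL, h0, zero_sub, inner_add_right, inner_smul_right, hνν]
      ring
    refine ⟨h1, ?_, ?_⟩
    · simp only [hπ, h1, add_sub_cancel_right]
    · rw [← hecoe, e.left_inv hq]
  have hsub : {z : Rn n | ∃ q ∈ {q | q ∈ e.source ∧ DifferentiableAt ℝ e.symm (L q) ∧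
      ContDiffAt ℝ 1 ρ q ∧ (q ∈ frontier Ω → ρ q = 0) ∧ ∀ᶠ z in 𝓝 q, (z ∈ Ω ↔ ρ z < 0)},
      ∃ h ∈ Ioo (0 : ℝ) 1, q ∈ frontier Ω ∧ ⟪outwardNormal Ω q, q - y⟫ = 0 ∧
      z = (1 + h) • (q - y)} ⊆ Ψ '' s := by
    rintro z ⟨q, hq, h, hh, hqf, hqt, rfl⟩
    obtain ⟨f1, f2, f3⟩ := hfacts q hq.1 (hq.2.2.2.1 hqf) h
    refine ⟨L q + h • ν, ⟨q, hq, h, hh, hqf, hqt, rfl⟩, ?_⟩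
    simp only [hΨ, f1, f2, f3]
  refine measure_mono_null hsub ?_
  have hderiv : ∀ z ∈ s, ∃ Ψ' : Rn n →L[ℝ] Rn n, HasFDerivAt Ψ Ψ' z ∧ Ψ'.det = 0 := by
    rintro z ⟨q, ⟨hq1, hq2, hq3, hq4, hq5⟩, h, hh, hqf, hqt, rfl⟩
    have hρ0 := hq4 hqf
    obtain ⟨f1, f2, f3⟩ := hfacts q hq1 hρ0 h
    set z := L q + h • ν
    have hρq : HasFDerivAt ρ (fderiv ℝ ρ q) q := (hq3.differentiableAt one_ne_zero).hasFDerivAt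
    obtain ⟨g, hgq⟩ : ∃ g : Rn n, fderiv ℝ ρ q = innerSL ℝ g :=
      ⟨(InnerProductSpace.toDual ℝ (Rn n)).symm (fderiv ℝ ρ q), by ext v; simp⟩
    rw [hgq] at hρq
    -- The chosen normal at `q` comes from a defining function of its own; tangency has to be
    -- transferred to the gradient of the function `ρ` used in the chart.
    have hgt : ⟪g, q - y⟫ = 0 :=
      inner_eq_zero_of_defining hΩ.isOpen hqf (outwardNormal_spec hΩ hqf) hq3 hρq hq5 hqt
    set G := fderiv ℝ e.symm (L q) with hG
    have hGd : HasFDerivAt e.symm G (π z) := by rw [f2]; exact hq2.hasFDerivAt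
    have hπd : HasFDerivAt π π' z := by
      have h1 : HasFDerivAt (fun q : Rn n => ⟪ν, q⟫) (innerSL ℝ ν) z := (innerSL ℝ ν).hasFDerivAt
      exact (hasFDerivAt_id z).sub (h1.smul_const ν)
    have hΨd := (((innerSL ℝ ν).hasFDerivAt (x := z)).const_add 1).smul
      ((hGd.comp z hπd).sub_const y)
    refine ⟨_, hΨd, ?_⟩
    have hLq := hLderiv hρq
    -- `w` is the image of `q - y` under the derivative of `L`. Tangency makes it orthogonal to `ν`,
    -- so the boundary point can be moved in the direction `q - y` within the parametrization.
    obtain ⟨w, hw⟩ : ∃ w, w = (q - y) + (⟪g, q - y⟫ - ⟪ν, q - y⟫) • ν := ⟨_, rfl⟩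
    have hcomp : G w = q - y := by
      have h1 : HasFDerivAt (fun z => e.symm (L z)) _ q := hq2.hasFDerivAt.comp q hLq
      have h2 : HasFDerivAt (fun z => e.symm (L z)) (ContinuousLinearMap.id ℝ (Rn n)) q := by
        refine (hasFDerivAt_id q).congr_of_eventuallyEq ?_
        filter_upwards [e.open_source.mem_nhds hq1] with z hz
        rw [← hecoe, e.left_inv hz]; rfl
      have := DFunLike.congr_fun (h1.unique h2) (q - y)
      rw [hw]
      simpa using this
    have hνw : ⟪ν, w⟫ = 0 := by
      rw [hw, hgt]
      simp only [inner_smul_right, inner_add_right, hνν]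
      ring
    have h1h : (1 + h) ≠ 0 := by have := hh.1; positivity
    -- Increasing `h` moves the image by `q - y`, and moving the boundary point along `-(1 + h)⁻¹ •
    -- w` moves it by `-(q - y)`. The two cancel, so `v0` is in the kernel and the determinant
    -- vanishes.
    obtain ⟨v0, hv0⟩ : ∃ v0, v0 = ν - (1 + h)⁻¹ • w := ⟨_, rfl⟩
    have hv1 : ⟪ν, v0⟫ = 1 := by
      rw [hv0, inner_sub_right, inner_smul_right, hνw, hνν, mul_zero, sub_zero]
    have hπv : π' v0 = -((1 + h)⁻¹ • w) := by
      simp only [hπ', sub_apply, ContinuousLinearMap.id_apply,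
        ContinuousLinearMap.smulRight_apply, innerSL_apply_apply, hv1, one_smul]
      rw [hv0]; abel
    rw [ContinuousLinearMap.det, LinearMap.det_eq_zero_iff_ker_ne_bot]
    intro hbot
    have hmem : v0 ∈ (⊥ : Submodule ℝ (Rn n)) := by
      rw [← hbot, LinearMap.mem_ker]
      simp [f1, f2, f3, hv1, hπv, hcomp, h1h]
    have : v0 = 0 := by simpa using hmem
    rw [this, inner_zero_right] at hv1
    exact zero_ne_one hv1
  choose! Ψ' hΨ'1 hΨ'2 using hderiv
  exact addHaar_image_eq_zero_of_det_fderivWithin_eq_zero volume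
    (fun z hz => (hΨ'1 z hz).hasFDerivWithinAt) hΨ'2

lemma volume_tangential_cone_eq_zero (hΩ : IsBoundedC1Domain Ω) (y : Rn n) :
    volume {z : Rn n | ∃ q, ∃ h ∈ Ioo (0 : ℝ) 1,
      q ∈ frontier Ω ∧ ⟪outwardNormal Ω q, q - y⟫ = 0 ∧ z = (1 + h) • (q - y)} = 0 := by
  have hcomp : IsCompact (frontier Ω) :=
    Metric.isCompact_of_isClosed_isBounded isClosed_frontier
      (hΩ.isBounded.closure.subset frontier_subset_closure)
  choose! U hU hU0 using fun p (hp : p ∈ frontier Ω) =>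
    exists_nhds_volume_tangential_cone_eq_zero hΩ y hp
  obtain ⟨t, ht, hcov⟩ := hcomp.elim_nhds_subcover U hU
  refine measure_mono_null ?_
    ((measure_biUnion_null_iff t.countable_toSet).2 fun p hp => hU0 p (ht p hp))
  rintro z ⟨q, h, hh, hqf, hqt, rfl⟩
  obtain ⟨p, hp, hqp⟩ := mem_iUnion₂.1 (hcov hqf)
  exact mem_iUnion₂.2 ⟨p, hp, q, hqp, h, hh, hqf, hqt, rfl⟩

end Sard

/-! ### Surface measure and polar coordinates. -/

instance (n : ℕ) : IsFiniteMeasure (surfaceMeasure n) := by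
  unfold surfaceMeasure; infer_instance

/-- Lebesgue measure on the hyperplane orthogonal to `ζ`. -/
def perpVol {n : ℕ} (ζ : Rn n) : Measure (ℝ ∙ ζ)ᗮ := measureSpaceOfInnerProductSpace.volume

instance {n : ℕ} (ζ : Rn n) : (perpVol ζ).IsAddHaarMeasure := by
  unfold perpVol
  infer_instance

section Polar

variable {n : ℕ}

/-- Integration in polar coordinates. -/
lemma lintegral_polar (hn : 1 ≤ n) {F : Rn n → ENNReal} (hF : Measurable F) :
    ∫⁻ v, F v = ∫⁻ θ : Sph n, ∫⁻ r in Ioi (0 : ℝ),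
      ENNReal.ofReal (r ^ (n - 1)) * F (r • (θ : Rn n)) ∂volume ∂surfaceMeasure n := by
  have : Nonempty (Fin n) := ⟨⟨0, hn⟩⟩
  have hmp := (volume : Measure (Rn n)).measurePreserving_homeomorphUnitSphereProd
  have hdim : Module.finrank ℝ (Rn n) = n := by simp
  rw [hdim] at hmp
  have hmeas : Measurable fun w : Sph n × Ioi (0 : ℝ) => F ((w.2 : ℝ) • (w.1 : Rn n)) := by fun_prop
  calc ∫⁻ v, F v = ∫⁻ v in ({0}ᶜ : Set (Rn n)), F v := by
        rw [restrict_compl_singleton]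
    _ = ∫⁻ v : ({0}ᶜ : Set (Rn n)), F v ∂(Measure.comap (Subtype.val : ({0}ᶜ : Set (Rn n)) → Rn n) volume) := by
        rw [lintegral_subtype_comap (measurableSet_singleton _).compl]
    _ = ∫⁻ w : Sph n × Ioi (0 : ℝ), F ((w.2 : ℝ) • (w.1 : Rn n))
          ∂((volume : Measure (Rn n)).toSphere.prod (Measure.volumeIoiPow (n - 1))) := by
        rw [← hmp.lintegral_comp hmeas]
        refine lintegral_congr fun v => ?_
        congr 1
        have h0 : ‖(v : Rn n)‖ ≠ 0 := norm_ne_zero_iff.2 v.2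
        simp [smul_smul, h0]
    _ = _ := by
        rw [lintegral_prod _ hmeas.aemeasurable]
        refine lintegral_congr fun θ => ?_
        rw [Measure.volumeIoiPow, lintegral_withDensity_eq_lintegral_mul₀ (by fun_prop)
          (by fun_prop),
          ← lintegral_subtype_comap measurableSet_Ioi]
        rfl

/-- Fubini in polar coordinates; passing to a measurable hull of the exceptional set dispenses with
measurability of `P`. -/
lemma ae_ray_of_ae (hn : 1 ≤ n) {P : Rn n → Prop} (h : ∀ᵐ v, P v) :
    ∀ᵐ θ : Sph n ∂surfaceMeasure n, ∀ᵐ r : ℝ ∂volume.restrict (Ioi 0), P (r • (θ : Rn n)) := by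
  set N := toMeasurable volume {v | ¬ P v} with hN
  have hN0 : volume N = 0 := by rw [hN, measure_toMeasurable]; exact h
  have hNm : MeasurableSet N := measurableSet_toMeasurable _ _
  have h1 := lintegral_polar hn (F := N.indicator 1) (measurable_one.indicator hNm)
  rw [lintegral_indicator_one hNm, hN0] at h1
  have hm : Measurable fun w : Sph n × ℝ => ENNReal.ofReal (w.2 ^ (n - 1)) *
      N.indicator (1 : Rn n → ENNReal) (w.2 • (w.1 : Rn n)) := by
    have h2 : Measurable fun w : Sph n × ℝ => w.2 • (w.1 : Rn n) := by fun_prop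
    have := (measurable_one.indicator hNm : Measurable (N.indicator (1 : Rn n → ENNReal))).comp h2
    exact Measurable.mul (by fun_prop) this
  have h2 := (lintegral_eq_zero_iff hm.lintegral_prod_right').1 h1.symm
  filter_upwards [h2] with θ hθ
  have h3 := (lintegral_eq_zero_iff (hm.comp measurable_prodMk_left)).1 hθ
  filter_upwards [h3, ae_restrict_mem measurableSet_Ioi] with r hr hr0
  by_contra hP
  have hmem : r • (θ : Rn n) ∈ N := subset_toMeasurable _ _ hP
  have hpos : (0 : ℝ) < r ^ (n - 1) := pow_pos hr0 _
  simp only [Function.comp_apply, indicator_of_mem hmem, Pi.one_apply, mul_one, Pi.zero_apply,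
    ENNReal.ofReal_eq_zero] at hr
  linarith

end Polar

/-! ### Almost every ray enters transversally. -/

section Tangential

variable {n : ℕ} {Ω : Set (Rn n)} {D : ℝ}

/-- The directions in which the backward ray from `y` meets the boundary tangentially form a null
set. -/
lemma ae_entryPoint_transversal (hn : 1 ≤ n) (hΩ : IsBoundedC1Domain Ω)
    (hD : ∀ y ∈ Ω, ∀ z ∈ Ω, dist y z ≤ D) {y : Rn n} (hy : y ∈ Ω) :
    ∀ᵐ θ : Sph n ∂surfaceMeasure n, ⟪outwardNormal Ω (entryPoint Ω y θ), (θ : Rn n)⟫ ≠ 0 := by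
  set N : Set (Rn n) := {z : Rn n | ∃ q, ∃ h ∈ Ioo (0 : ℝ) 1,
      q ∈ frontier Ω ∧ ⟪outwardNormal Ω q, q - y⟫ = 0 ∧ z = (1 + h) • (q - y)} with hN
  have h0 : volume N = 0 := volume_tangential_cone_eq_zero hΩ y
  -- For a tangential direction `θ` the null cone contains only the segment of points `-tθ` with `τ
  -- < t < 2τ`. Rational dilates spread it over the whole ray, so that any single good `r > 0` is
  -- contradicted, and countably many dilates remain null.
  have h1 : ∀ᵐ v : Rn n, ∀ c : ℚ, ((-(c : ℝ)) • v) ∉ N ∨ c = 0 := by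
    rw [ae_all_iff]
    intro c
    by_cases hc : c = 0
    · simp [hc]
    have hc' : -(c : ℝ) ≠ 0 := by simpa using hc
    have h2 : volume ((fun v : Rn n => (-(c : ℝ)) • v) ⁻¹' N) = 0 := by
      rw [Measure.addHaar_preimage_smul _ hc', h0, mul_zero]
    have h3 : ∀ᵐ v : Rn n, v ∉ ((fun v : Rn n => (-(c : ℝ)) • v) ⁻¹' N) :=
      measure_eq_zero_iff_ae_notMem.1 h2
    filter_upwards [h3] with v hv
    exact Or.inl hv
  filter_upwards [ae_ray_of_ae hn h1] with θ hθ hbad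
  have hθ1 := norm_eq_of_mem_sphere θ
  have hτ := backExit_pos hΩ.isOpen hD hθ1 hy
  have : NeBot (ae (volume.restrict (Ioi (0 : ℝ)))) := by
    rw [ae_neBot, Measure.restrict_eq_zero.ne]; simp
  obtain ⟨r, hr, hr0⟩ := (hθ.and (ae_restrict_mem measurableSet_Ioi)).exists
  have hr0' : (0 : ℝ) < r := hr0
  set τ := backExit Ω y θ with hτdef
  obtain ⟨c, hc1, hc2⟩ := exists_rat_btwn (show τ / r < 2 * τ / r by gcongr; linarith)
  rw [div_lt_iff₀ hr0'] at hc1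
  rw [lt_div_iff₀ hr0'] at hc2
  have hc0 : c ≠ 0 := by
    rintro rfl
    simp at hc1; linarith
  refine (hr c).elim (fun hnot => hnot ?_) hc0
  refine ⟨entryPoint Ω y θ, c * r / τ - 1, ⟨?_, ?_⟩,
    entryPoint_mem_frontier hΩ.isOpen hD hθ1 hy, ?_, ?_⟩
  · rw [sub_pos, lt_div_iff₀ hτ]; linarith
  · rw [sub_lt_iff_lt_add, div_lt_iff₀ hτ]; linarith
  · have : entryPoint Ω y θ - y = (-τ) • (θ : Rn n) := by rw [entryPoint]; module
    rw [this, inner_smul_right, hbad, mul_zero]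
  · have : entryPoint Ω y θ - y = (-τ) • (θ : Rn n) := by rw [entryPoint]; module
    rw [this, smul_smul, smul_smul]
    congr 1
    field_simp
    ring

end Tangential

/-! ### Orthogonal splitting along a direction. -/

section Decomposition

variable {n : ℕ}

lemma measurePreserving_perp_prod {ζ : Rn n} (hζ : ‖ζ‖ = 1) :
    MeasurePreserving (fun w : (ℝ ∙ ζ)ᗮ × ℝ => (w.1 : Rn n) + w.2 • ζ)
      ((perpVol ζ).prod volume) volume := by
  set K : Submodule ℝ (Rn n) := ℝ ∙ ζ with hK
  have h1 : MeasurePreserving K.orthogonalDecomposition.symm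
      (@volume _ measureSpaceOfInnerProductSpace) volume :=
    LinearIsometryEquiv.measurePreserving _
  have h2 := WithLp.volume_preserving_toLp K Kᗮ
  have h3 : MeasurePreserving (LinearIsometryEquiv.toSpanUnitSingleton (𝕜 := ℝ) ζ hζ) volume
    (@volume _ measureSpaceOfInnerProductSpace) := LinearIsometryEquiv.measurePreserving _
  have h4 : MeasurePreserving (fun w : Kᗮ × ℝ =>
      (LinearIsometryEquiv.toSpanUnitSingleton (𝕜 := ℝ) ζ hζ w.2, w.1))
      ((perpVol ζ).prod volume)
      ((@volume _ measureSpaceOfInnerProductSpace).prod (perpVol ζ)) :=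
    (h3.prod (MeasurePreserving.id (perpVol ζ))).comp Measure.measurePreserving_swap
  have h5 := h1.comp (h2.comp h4)
  convert h5 using 1
  ext1 w
  simp [add_comm]

end Decomposition

/-- The component of `v` orthogonal to the unit vector `ζ`. -/
def perp {n : ℕ} (ζ v : Rn n) : Rn n := v - ⟪ζ, v⟫ • ζ

section Perp

variable {n : ℕ} {ζ : Rn n}

@[fun_prop]
lemma continuous_perp : Continuous (perp ζ) := by unfold perp; fun_prop

lemma perp_add (v w : Rn n) : perp ζ (v + w) = perp ζ v + perp ζ w := by
  simp only [perp, inner_add_right]; module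

lemma perp_sub (v w : Rn n) : perp ζ (v - w) = perp ζ v - perp ζ w := by
  simp only [perp, inner_sub_right]; module

lemma perp_smul (c : ℝ) (v : Rn n) : perp ζ (c • v) = c • perp ζ v := by
  simp only [perp, inner_smul_right]; module

lemma perp_self (hζ : ‖ζ‖ = 1) : perp ζ ζ = 0 := by
  simp [perp, hζ]

lemma norm_perp_le (hζ : ‖ζ‖ = 1) (v : Rn n) : ‖perp ζ v‖ ≤ ‖v‖ := by
  have h1 : ‖perp ζ v‖ ^ 2 = ‖v‖ ^ 2 - ⟪ζ, v⟫ ^ 2 := by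
    rw [perp, norm_sub_sq_real, norm_smul, inner_smul_right, hζ, real_inner_comm, mul_one,
      Real.norm_eq_abs, sq_abs]
    ring
  exact le_of_sq_le_sq (by nlinarith [sq_nonneg ⟪ζ, v⟫]) (norm_nonneg _) 

lemma inner_perpSpace (ω : (ℝ ∙ ζ)ᗮ) : ⟪ζ, (ω : Rn n)⟫ = 0 :=
  (Submodule.mem_orthogonal_singleton_iff_inner_right).1 ω.2

lemma inner_perp_add_smul (hζ : ‖ζ‖ = 1) (ω : (ℝ ∙ ζ)ᗮ) (s : ℝ) :
    ⟪ζ, (ω : Rn n) + s • ζ⟫ = s := by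
  rw [inner_add_right, inner_perpSpace, inner_smul_right, real_inner_self_eq_norm_sq, hζ]
  ring

lemma perp_perp_add_smul (hζ : ‖ζ‖ = 1) (ω : (ℝ ∙ ζ)ᗮ) (s : ℝ) :
    perp ζ ((ω : Rn n) + s • ζ) = ω := by
  rw [perp, inner_perp_add_smul hζ, add_sub_cancel_right]

lemma finrank_perpSpace (hn : 1 ≤ n) (hζ : ‖ζ‖ = 1) : Module.finrank ℝ (ℝ ∙ ζ)ᗮ = n - 1 := by
  have : Fact (Module.finrank ℝ (Rn n) = (n - 1) + 1) := ⟨by simp; omega⟩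
  exact Submodule.finrank_orthogonal_span_singleton (by rintro rfl; simp at hζ)

lemma lintegral_perp_prod (hζ : ‖ζ‖ = 1) {F : Rn n → ENNReal} (hF : Measurable F) :
    ∫⁻ v, F v = ∫⁻ s : ℝ, ∫⁻ ω, F ((ω : Rn n) + s • ζ) ∂perpVol ζ := by
  rw [← (measurePreserving_perp_prod hζ).lintegral_comp hF]
  refine lintegral_prod_symm' _ ?_
  fun_prop

lemma lintegral_perp_smul (hn : 1 ≤ n) (hζ : ‖ζ‖ = 1) {g : (ℝ ∙ ζ)ᗮ → ENNReal}
    (hg : Measurable g) {s : ℝ} (hs : 0 < s) :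
    ∫⁻ ω, g ω ∂perpVol ζ = ENNReal.ofReal (s ^ (n - 1)) * ∫⁻ ω, g (s • ω) ∂perpVol ζ := by
  have h1 := Measure.map_addHaar_smul (perpVol ζ) hs.ne'
  rw [finrank_perpSpace hn hζ] at h1
  have h2 : ∫⁻ ω, g (s • ω) ∂perpVol ζ = ∫⁻ ω, g ω ∂(Measure.map (s • ·) (perpVol ζ)) :=
    (lintegral_map hg (measurable_const_smul s)).symm
  have h3 : 0 < s ^ (n - 1) := by positivity
  rw [h2, h1, lintegral_smul_measure, smul_eq_mul, ← mul_assoc, ← ENNReal.ofReal_mul h3.le,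
    abs_of_pos (inv_pos.2 h3), mul_inv_cancel₀ h3.ne', ENNReal.ofReal_one, one_mul]

lemma lintegral_Ioo_pow (hn : 1 ≤ n) {a b : ℝ} (ha : 0 ≤ a) (hab : a ≤ b) :
    ∫⁻ r in Ioo a b, ENNReal.ofReal (r ^ (n - 1)) = ENNReal.ofReal ((b ^ n - a ^ n) / n) := by
  rw [← ofReal_integral_eq_lintegral_ofReal, ← integral_Ioc_eq_integral_Ioo,
    ← intervalIntegral.integral_of_le hab, integral_pow, Nat.sub_add_cancel hn]
  · congr 2
    rw [Nat.cast_sub hn]; simp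
  · exact ((continuous_pow _).integrableOn_Icc (a := a) (b := b)).mono_set Ioo_subset_Icc_self
  · filter_upwards [ae_restrict_mem measurableSet_Ioo] with r hr
    exact pow_nonneg (ha.trans hr.1.le) _

end Perp

/-! ### Gnomonic coordinates on a half sphere. -/

section Gnomonic

variable {n : ℕ}

/-- The direction of a vector; by convention, that of `0` is `ζ`. -/
def sphDir (ζ : Sph n) (v : Rn n) : Sph n :=
  ⟨open Classical in if v = 0 then (ζ : Rn n) else ‖v‖⁻¹ • v, by
    split_ifs with h
    · exact ζ.2
    · simp [norm_smul, h]⟩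

lemma coe_sphDir (ζ : Sph n) {v : Rn n} (hv : v ≠ 0) : (sphDir ζ v : Rn n) = ‖v‖⁻¹ • v := by
  simp [sphDir, hv]

@[fun_prop]
lemma measurable_sphDir (ζ : Sph n) : Measurable (sphDir ζ) := by
  refine Measurable.subtype_mk ?_
  refine Measurable.ite (measurableSet_singleton _) measurable_const ?_
  fun_prop

attribute [irreducible] sphDir

lemma sphDir_smul (ζ : Sph n) {r : ℝ} (hr : 0 < r) (v : Rn n) :
    sphDir ζ (r • v) = sphDir ζ v := by
  by_cases hv : v = 0
  · simp [hv]
  · have hrv : r • v ≠ 0 := smul_ne_zero hr.ne' hv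
    ext1
    rw [coe_sphDir ζ hv, coe_sphDir ζ hrv, norm_smul, smul_smul, Real.norm_eq_abs, abs_of_pos hr]
    congr 1
    field_simp

lemma sphDir_coe (ζ θ : Sph n) : sphDir ζ (θ : Rn n) = θ := by
  ext1
  rw [coe_sphDir ζ (by rintro h; have := norm_eq_of_mem_sphere θ; simp [h] at this)]
  simp

/-- The integral of `h` of the direction over the slab `1 < ⟪ζ, v⟫ < 2` is computed twice. In polar
coordinates the ray with `c = ⟪ζ, θ⟫ > 0` crosses the slab for `r` between `1/c` and `2/c`, which
gives `c⁻ⁿ` times `K`. By slices orthogonal to `ζ`, rescaling the slice at height `s` to height 1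
costs `s^(n-1)`, and integrating in `s` gives the same constant `K`. -/
lemma lintegral_gnomonic (hn : 1 ≤ n) (ζ : Sph n) {h : Sph n → ENNReal} (hh : Measurable h) :
    ∫⁻ θ in {θ : Sph n | 0 < ⟪(ζ : Rn n), (θ : Rn n)⟫},
      ENNReal.ofReal (⟪(ζ : Rn n), (θ : Rn n)⟫⁻¹ ^ n) * h θ ∂surfaceMeasure n =
    ∫⁻ ω, h (sphDir ζ ((ω : Rn n) + ζ)) ∂perpVol (ζ : Rn n) := by
  have hζ := norm_eq_of_mem_sphere ζ
  set K : ENNReal := ENNReal.ofReal ((2 ^ n - 1 ^ n) / n) with hK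
  have hnR : (0 : ℝ) < n := by exact_mod_cast hn
  have hpow : (1 : ℝ) < 2 ^ n := one_lt_pow₀ (by norm_num) (by omega)
  have hK0 : K ≠ 0 := by
    rw [hK, ne_eq, ENNReal.ofReal_eq_zero, not_le]
    exact div_pos (by simpa using hpow) hnR
  have hKt : K ≠ ⊤ := ENNReal.ofReal_ne_top
  set S : Set (Rn n) := {v | ⟪(ζ : Rn n), v⟫ ∈ Ioo (1 : ℝ) 2} with hS
  have hSm : MeasurableSet S := measurableSet_Ioo.preimage (by fun_prop)
  set F : Rn n → ENNReal := S.indicator fun v => h (sphDir ζ v) with hF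
  have hFm : Measurable F := Measurable.indicator (by fun_prop) hSm
  have e1 : ∫⁻ v, F v = K * ∫⁻ θ in {θ : Sph n | 0 < ⟪(ζ : Rn n), (θ : Rn n)⟫},
      ENNReal.ofReal (⟪(ζ : Rn n), (θ : Rn n)⟫⁻¹ ^ n) * h θ ∂surfaceMeasure n := by
    rw [lintegral_polar hn hFm, ← lintegral_const_mul' _ _ hKt,
      ← lintegral_indicator (measurableSet_lt measurable_const (by fun_prop))]
    refine lintegral_congr fun θ => ?_
    set c := ⟪(ζ : Rn n), (θ : Rn n)⟫ with hc
    have hin : ∀ r : ℝ, 0 < r → (ENNReal.ofReal (r ^ (n - 1)) * F (r • (θ : Rn n)) =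
        h θ * ({r : ℝ | r * c ∈ Ioo (1 : ℝ) 2}.indicator
          (fun r => ENNReal.ofReal (r ^ (n - 1))) r)) := by
      intro r hr
      by_cases hrc : r * c ∈ Ioo (1 : ℝ) 2
      · have hmem : r • (θ : Rn n) ∈ S := by
          simp only [hS, mem_ofPred_eq, inner_smul_right]; exact hrc
        rw [hF, indicator_of_mem hmem, indicator_of_mem (by exact hrc), sphDir_smul ζ hr,
          sphDir_coe, mul_comm]
      · have hmem : r • (θ : Rn n) ∉ S := by
          simp only [hS, mem_ofPred_eq, inner_smul_right]; exact hrc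
        rw [hF, indicator_of_notMem hmem, indicator_of_notMem (by exact hrc), mul_zero, mul_zero]
    have hmi : Measurable ({r : ℝ | r * c ∈ Ioo (1 : ℝ) 2}.indicator
        (fun r => ENNReal.ofReal (r ^ (n - 1)))) :=
      Measurable.indicator (by fun_prop)
        (measurableSet_Ioo.preimage (by fun_prop : Measurable fun r : ℝ => r * c))
    rw [setLIntegral_congr_fun measurableSet_Ioi fun r hr => hin r hr,
      lintegral_const_mul _ hmi]
    by_cases hc0 : 0 < c
    · rw [indicator_of_mem (by exact hc0)]
      have hset : {r : ℝ | r * c ∈ Ioo (1 : ℝ) 2} = Ioo (1 / c) (2 / c) := by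
        ext r
        simp only [mem_ofPred_eq, mem_Ioo, div_lt_iff₀ hc0, lt_div_iff₀ hc0]
      rw [hset, ← lintegral_indicator measurableSet_Ioi, indicator_indicator,
        lintegral_indicator (measurableSet_Ioi.inter measurableSet_Ioo),
        inter_eq_self_of_subset_right (show Ioo (1 / c) (2 / c) ⊆ Ioi 0 from
          fun r hr => (div_pos one_pos hc0).trans hr.1),
        lintegral_Ioo_pow hn (by positivity) (by gcongr; norm_num), mul_comm, ← mul_assoc, hK,
        ← ENNReal.ofReal_mul (div_nonneg (by simpa using hpow.le) hnR.le)]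
      congr 2
      rw [div_pow, div_pow, inv_pow]
      ring
    · rw [indicator_of_notMem (by exact hc0)]
      have : ∀ r ∈ Ioi (0 : ℝ), ({r : ℝ | r * c ∈ Ioo (1 : ℝ) 2}.indicator
          (fun r => ENNReal.ofReal (r ^ (n - 1))) r) = (fun _ => 0) r := by
        intro r hr
        refine indicator_of_notMem ?_ _
        intro hmem
        have : r * c ≤ 0 := mul_nonpos_of_nonneg_of_nonpos (le_of_lt hr) (not_lt.1 hc0)
        linarith [hmem.1]
      rw [setLIntegral_congr_fun measurableSet_Ioi this]
      simp
  have e2 : ∫⁻ v, F v = K * ∫⁻ ω, h (sphDir ζ ((ω : Rn n) + ζ)) ∂perpVol (ζ : Rn n) := by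
    rw [lintegral_perp_prod hζ hFm, hK, ← lintegral_Ioo_pow hn zero_le_one one_le_two,
      ← lintegral_mul_const _ (by fun_prop), ← lintegral_indicator measurableSet_Ioo]
    refine lintegral_congr fun s => ?_
    by_cases hs : s ∈ Ioo (1 : ℝ) 2
    · have hs0 : 0 < s := one_pos.trans hs.1
      rw [indicator_of_mem hs, lintegral_perp_smul hn hζ (by fun_prop) hs0]
      congr 1
      refine lintegral_congr fun ω => ?_
      have hmem : ((s • ω : (ℝ ∙ (ζ : Rn n))ᗮ) : Rn n) + s • (ζ : Rn n) ∈ S := by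
        rw [hS, mem_ofPred_eq, inner_perp_add_smul hζ]; exact hs
      rw [hF, indicator_of_mem hmem, Submodule.coe_smul, ← smul_add, sphDir_smul ζ hs0]
    · rw [indicator_of_notMem hs]
      refine (lintegral_congr fun ω => ?_).trans lintegral_zero
      refine indicator_of_notMem ?_ _
      rw [hS, mem_ofPred_eq, inner_perp_add_smul hζ]; exact hs
  exact (ENNReal.mul_right_inj hK0 hKt).1 (e1.symm.trans e2)

/-- The surface measure on a half sphere in gnomonic coordinates. -/
lemma surfaceMeasure_restrict_eq_map (hn : 1 ≤ n) (ζ : Sph n) :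
    (surfaceMeasure n).restrict {θ : Sph n | 0 < ⟪(ζ : Rn n), (θ : Rn n)⟫} =
      ((perpVol (ζ : Rn n)).withDensity fun ω =>
        ENNReal.ofReal (⟪(ζ : Rn n), (sphDir ζ ((ω : Rn n) + ζ) : Rn n)⟫ ^ n)).map
      fun ω : (ℝ ∙ (ζ : Rn n))ᗮ => sphDir ζ ((ω : Rn n) + ζ) := by
  refine Measure.ext_of_lintegral _ fun f hf => ?_
  rw [lintegral_map hf (by fun_prop), lintegral_withDensity_eq_lintegral_mul _ (by fun_prop)
    (by fun_prop)]
  have hm : Measurable fun θ : Sph n => ENNReal.ofReal (⟪(ζ : Rn n), (θ : Rn n)⟫ ^ n) * f θ := by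
    fun_prop
  simp only [Pi.mul_apply]
  rw [← lintegral_gnomonic hn ζ hm]
  refine setLIntegral_congr_fun (measurableSet_lt measurable_const (by fun_prop)) fun θ hθ => ?_
  have hθ' : 0 < ⟪(ζ : Rn n), (θ : Rn n)⟫ := hθ
  rw [← mul_assoc, ← ENNReal.ofReal_mul (by positivity), ← mul_pow, inv_mul_cancel₀ hθ'.ne',
    one_pow, ENNReal.ofReal_one, one_mul]

end Gnomonic

/-! ### Caps, tubes and the length of rays inside tubes. -/

section Tubes

variable {n : ℕ} {ζ : Rn n}

lemma measurableSet_le_and_Icc {f g : Rn n → ℝ} (hf : Measurable f) (hg : Measurable g) (R d : ℝ) :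
    MeasurableSet {v | f v ≤ R ∧ g v ∈ Icc (-d) d} :=
  (measurableSet_le hf measurable_const).inter (measurableSet_Icc.preimage hg)

lemma measurableSet_lt_and_Icc {f g : Rn n → ℝ} (hf : Measurable f) (hg : Measurable g) (R d : ℝ) :
    MeasurableSet {v | f v < R ∧ g v ∈ Icc (-d) d} :=
  (measurableSet_lt hf measurable_const).inter (measurableSet_Icc.preimage hg)

lemma volume_tube (hn : 1 ≤ n) (hζ : ‖ζ‖ = 1) {R : ℝ} (hR : 0 ≤ R) (d : ℝ) :
    volume {v : Rn n | ‖perp ζ v‖ ≤ R ∧ ⟪ζ, v⟫ ∈ Icc (-d) d} =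
      ENNReal.ofReal (R ^ (n - 1)) * perpVol ζ (Metric.ball 0 1) * ENNReal.ofReal (2 * d) := by
  have hm : MeasurableSet {v : Rn n | ‖perp ζ v‖ ≤ R ∧ ⟪ζ, v⟫ ∈ Icc (-d) d} :=
    measurableSet_le_and_Icc (by fun_prop) (by fun_prop) _ _
  rw [← (measurePreserving_perp_prod hζ).measure_preimage hm.nullMeasurableSet]
  have : (fun w : (ℝ ∙ ζ)ᗮ × ℝ => (w.1 : Rn n) + w.2 • ζ) ⁻¹'
      {v : Rn n | ‖perp ζ v‖ ≤ R ∧ ⟪ζ, v⟫ ∈ Icc (-d) d} =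
      Metric.closedBall 0 R ×ˢ Icc (-d) d := by
    ext w
    simp only [mem_preimage, mem_ofPred_eq, perp_perp_add_smul hζ, inner_perp_add_smul hζ, mem_prod,
      mem_closedBall_zero_iff, Submodule.coe_norm]
  rw [this, Measure.prod_prod, Measure.addHaar_closedBall _ _ hR, finrank_perpSpace hn hζ,
    Real.volume_Icc]
  congr 2
  ring

lemma volume_tube_translate (hn : 1 ≤ n) (hζ : ‖ζ‖ = 1) {R : ℝ} (hR : 0 ≤ R) (d : ℝ) (z : Rn n) :
    volume {v : Rn n | ‖perp ζ (z - v)‖ ≤ R ∧ ⟪ζ, v⟫ ∈ Icc (-d) d} =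
      ENNReal.ofReal (R ^ (n - 1)) * perpVol ζ (Metric.ball 0 1) * ENNReal.ofReal (2 * d) := by
  rw [← volume_tube hn hζ hR d, ← measure_preimage_add volume (perp ζ z)]
  congr 1
  ext v
  simp only [mem_preimage, mem_ofPred_eq]
  have h1 : perp ζ (z - (perp ζ z + v)) = - perp ζ v := by
    have h2 : perp ζ (perp ζ z) = perp ζ z := by
      nth_rw 2 [perp]
      rw [perp_sub, perp_smul, perp_self hζ, smul_zero, sub_zero]
    rw [perp_sub, perp_add, h2]; abel
  have h2 : ⟪ζ, perp ζ z + v⟫ = ⟪ζ, v⟫ := by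
    rw [perp, inner_add_right, inner_sub_right, inner_smul_right, real_inner_self_eq_norm_sq, hζ]
    ring
  rw [h1, h2, norm_neg]

/-- A spherical cap of radius `r` has area at most `C r^(n-1)`. -/
lemma exists_surfaceMeasure_cap_le (hn : 1 ≤ n) (ζ : Sph n) : ∃ C : ℝ, 0 ≤ C ∧ ∀ r : ℝ, 0 ≤ r →
    (surfaceMeasure n).real {θ : Sph n | ‖(θ : Rn n) - ζ‖ ≤ r} ≤ C * r ^ (n - 1) := by
  have hζ := norm_eq_of_mem_sphere ζ
  -- A lower bound for the radial integral of `r^(n-1)` over `(1/2, 1)`. The part of the cone over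
  -- the cap with these radii lies in a cylinder, so `c0` times the area of the cap is at most the
  -- volume of the cylinder.
  set c0 : ENNReal := ENNReal.ofReal ((1 / 2) ^ (n - 1)) * ENNReal.ofReal (1 / 2) with hc0
  have hc0' : c0 ≠ 0 := by simp [hc0]
  have hc0t : c0 ≠ ⊤ := ENNReal.mul_ne_top ENNReal.ofReal_ne_top ENNReal.ofReal_ne_top
  set V := perpVol (ζ : Rn n) (Metric.ball 0 1)
  have hV : V ≠ ⊤ := Metric.isBounded_ball.measure_lt_top.ne
  have key : ∀ r : ℝ, 0 ≤ r → c0 * surfaceMeasure n {θ : Sph n | ‖(θ : Rn n) - ζ‖ ≤ r} ≤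
      ENNReal.ofReal (r ^ (n - 1)) * V * ENNReal.ofReal (2 * 1) := by
    intro r hr
    rw [← volume_tube hn hζ hr 1]
    set S : Set (Rn n) := {v : Rn n | ‖perp (ζ : Rn n) v‖ ≤ r ∧ ⟪(ζ : Rn n), v⟫ ∈ Icc (-1) 1}
    have hS : MeasurableSet S :=
    measurableSet_le_and_Icc (by fun_prop) (by fun_prop) _ _
    rw [← lintegral_indicator_one hS, lintegral_polar hn (measurable_one.indicator hS),
      ← setLIntegral_const]
    refine (setLIntegral_mono' (measurableSet_le (by fun_prop) measurable_const)
      fun θ hθ => ?_).trans (setLIntegral_le_lintegral _ _)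
    have h1 : c0 = ∫⁻ _ in Ioo (1 / 2 : ℝ) 1, ENNReal.ofReal ((1 / 2) ^ (n - 1)) := by
      rw [setLIntegral_const, Real.volume_Ioo, hc0]
      norm_num
    rw [h1]
    refine (setLIntegral_mono' measurableSet_Ioo fun s hs => ?_).trans
      (lintegral_mono_set (s := Ioo (1 / 2 : ℝ) 1) (t := Ioi 0)
        fun s hs => lt_trans (by norm_num) hs.1)
    have hs0 : 0 < s := lt_trans (by norm_num) hs.1
    have hmem : s • (θ : Rn n) ∈ S := by
      constructor
      · rw [perp_smul, norm_smul, Real.norm_eq_abs, abs_of_pos hs0]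
        have h2 : perp (ζ : Rn n) θ = perp (ζ : Rn n) ((θ : Rn n) - ζ) := by
          rw [perp_sub, perp_self hζ, sub_zero]
        have h3 : ‖perp (ζ : Rn n) θ‖ ≤ r := by
          rw [h2]; exact (norm_perp_le hζ _).trans hθ
        nlinarith [norm_nonneg (perp (ζ : Rn n) θ), hs.2]
      · rw [mem_Icc, ← abs_le, inner_smul_right, abs_mul, abs_of_pos hs0]
        have := abs_real_inner_le_norm (ζ : Rn n) θ
        rw [hζ, norm_eq_of_mem_sphere, mul_one] at this
        nlinarith [hs.2, abs_nonneg ⟪(ζ : Rn n), (θ : Rn n)⟫]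
    rw [indicator_of_mem hmem, Pi.one_apply, mul_one]
    exact ENNReal.ofReal_le_ofReal (by gcongr; exact hs.1.le)
  refine ⟨(c0⁻¹ * V * ENNReal.ofReal (2 * 1)).toReal, ENNReal.toReal_nonneg, fun r hr => ?_⟩
  have h1 : surfaceMeasure n {θ : Sph n | ‖(θ : Rn n) - ζ‖ ≤ r} ≤
      (c0⁻¹ * V * ENNReal.ofReal (2 * 1)) * ENNReal.ofReal (r ^ (n - 1)) := by
    have := mul_le_mul_right (key r hr) c0⁻¹
    rw [← mul_assoc, ENNReal.inv_mul_cancel hc0' hc0t, one_mul] at this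
    refine this.trans (le_of_eq ?_)
    ring
  have ht : (c0⁻¹ * V * ENNReal.ofReal (2 * 1)) * ENNReal.ofReal (r ^ (n - 1)) ≠ ⊤ :=
    ENNReal.mul_ne_top (ENNReal.mul_ne_top (ENNReal.mul_ne_top (ENNReal.inv_ne_top.2 hc0') hV)
      ENNReal.ofReal_ne_top) ENNReal.ofReal_ne_top
  have h2 := ENNReal.toReal_mono ht h1
  rwa [ENNReal.toReal_mul, ENNReal.toReal_ofReal (by positivity)] at h2

/-- In dimension at least three, the inverse sine of the angle to a fixed direction is integrable
on the sphere. -/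
lemma lintegral_inv_norm_perp_lt_top (hn : 3 ≤ n) (hζ : ‖ζ‖ = 1) :
    ∫⁻ θ : Sph n, (ENNReal.ofReal ‖perp ζ θ‖)⁻¹ ∂surfaceMeasure n < ⊤ := by
  have hn1 : 1 ≤ n := by omega
  have hfin := finrank_perpSpace hn1 hζ
  have : Nontrivial (ℝ ∙ ζ)ᗮ := Module.nontrivial_of_finrank_pos (R := ℝ) (by omega)
  have hball : ∫⁻ ω in Metric.ball (0 : (ℝ ∙ ζ)ᗮ) 1, (ENNReal.ofReal ‖(ω : Rn n)‖)⁻¹ ∂perpVol ζ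
      < ⊤ := by
    have h1 : IntegrableOn (fun ω : (ℝ ∙ ζ)ᗮ => ‖ω‖⁻¹) (Metric.ball 0 1) (perpVol ζ) := by
      rw [integrableOn_fun_norm_addHaar (perpVol ζ) (f := fun y => y⁻¹), hfin]
      -- In the `(n-1)`-dimensional hyperplane the radial density is `y^(n-2)`, and the singularity
      -- `y⁻¹` leaves `y^(n-3)`. In dimension two the integral would diverge.
      have h2 : IntegrableOn (fun y : ℝ => y ^ (n - 3)) (Ioo 0 1) :=
        ((continuous_pow _).integrableOn_Icc (a := 0) (b := 1)).mono_set Ioo_subset_Icc_self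
      refine h2.congr_fun (fun y hy => ?_) measurableSet_Ioo
      have hy0 : y ≠ 0 := hy.1.ne'
      simp only [smul_eq_mul]
      rw [← div_eq_mul_inv, eq_div_iff hy0, ← pow_succ]
      congr 1
      omega
    refine lt_of_eq_of_lt (lintegral_congr_ae ?_) h1.hasFiniteIntegral
    have h0 : ∀ᵐ ω ∂(perpVol ζ), ω ≠ 0 := by
      simp [ae_iff]
    filter_upwards [ae_restrict_of_ae h0] with ω hω
    have : 0 < ‖ω‖ := norm_pos_iff.2 hω
    rw [Real.enorm_eq_ofReal (inv_nonneg.2 this.le), ENNReal.ofReal_inv_of_pos this,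
      Submodule.coe_norm]
  set S : Set (Rn n) := {v : Rn n | ‖perp ζ v‖ < 1 ∧ ⟪ζ, v⟫ ∈ Icc (-1) 1} with hSdef
  have hS : MeasurableSet S :=
    measurableSet_lt_and_Icc (by fun_prop) (by fun_prop) _ _
  set F : Rn n → ENNReal := S.indicator fun v => (ENNReal.ofReal ‖perp ζ v‖)⁻¹ with hF
  have hFm : Measurable F := Measurable.indicator (by fun_prop) hS
  have h1 : ∫⁻ v, F v < ⊤ := by
    rw [lintegral_perp_prod hζ hFm]
    have h2 : ∀ s : ℝ, ∫⁻ ω, F ((ω : Rn n) + s • ζ) ∂perpVol ζ = (Icc (-1 : ℝ) 1).indicator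
        (fun _ => ∫⁻ ω in Metric.ball (0 : (ℝ ∙ ζ)ᗮ) 1,
          (ENNReal.ofReal ‖(ω : Rn n)‖)⁻¹ ∂perpVol ζ) s := by
      intro s
      by_cases hs : s ∈ Icc (-1 : ℝ) 1
      · rw [indicator_of_mem hs, ← lintegral_indicator Metric.isOpen_ball.measurableSet]
        refine lintegral_congr fun ω => ?_
        by_cases hω : ω ∈ Metric.ball (0 : (ℝ ∙ ζ)ᗮ) 1
        · rw [indicator_of_mem hω, hF, indicator_of_mem, perp_perp_add_smul hζ]
          rw [hSdef, mem_ofPred_eq, perp_perp_add_smul hζ, inner_perp_add_smul hζ]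
          exact ⟨by simpa using hω, hs⟩
        · rw [indicator_of_notMem hω, hF, indicator_of_notMem]
          rw [hSdef, mem_ofPred_eq, perp_perp_add_smul hζ]
          exact fun h => hω (by simpa using h.1)
      · rw [indicator_of_notMem hs]
        refine (lintegral_congr fun ω => ?_).trans lintegral_zero
        refine indicator_of_notMem ?_ _
        rw [hSdef, mem_ofPred_eq, inner_perp_add_smul hζ]
        exact fun h => hs h.2
    simp only [h2]
    rw [lintegral_indicator measurableSet_Icc, setLIntegral_const]
    exact ENNReal.mul_lt_top hball (by simp)
  rw [lintegral_polar hn1 hFm] at h1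
  set c0 : ENNReal := ENNReal.ofReal ((1 / 2) ^ (n - 1)) * ENNReal.ofReal (1 / 2) with hc0
  have hc0' : c0 ≠ 0 := by simp [hc0]
  have hc0t : c0 ≠ ⊤ := ENNReal.mul_ne_top ENNReal.ofReal_ne_top ENNReal.ofReal_ne_top
  have h3 : c0 * ∫⁻ θ : Sph n, (ENNReal.ofReal ‖perp ζ θ‖)⁻¹ ∂surfaceMeasure n < ⊤ := by
    rw [← lintegral_const_mul' _ _ hc0t]
    refine (lintegral_mono fun θ => ?_).trans_lt h1
    have h4 : c0 * (ENNReal.ofReal ‖perp ζ θ‖)⁻¹ = ∫⁻ _ in Ioo (1 / 2 : ℝ) 1,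
        ENNReal.ofReal ((1 / 2) ^ (n - 1)) * (ENNReal.ofReal ‖perp ζ θ‖)⁻¹ := by
      rw [setLIntegral_const, Real.volume_Ioo, hc0, mul_right_comm]
      norm_num
    rw [h4]
    refine (setLIntegral_mono' measurableSet_Ioo fun s hs => ?_).trans
      (lintegral_mono_set (s := Ioo (1 / 2 : ℝ) 1) (t := Ioi 0)
        fun s hs => lt_trans (by norm_num) hs.1)
    have hs0 : 0 < s := lt_trans (by norm_num) hs.1
    have h5 : ‖perp ζ θ‖ ≤ 1 := by
      simpa using norm_perp_le hζ (θ : Rn n)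
    have h6 : ‖perp ζ (s • (θ : Rn n))‖ = s * ‖perp ζ θ‖ := by
      rw [perp_smul, norm_smul, Real.norm_eq_abs, abs_of_pos hs0]
    have hmem : s • (θ : Rn n) ∈ S := by
      constructor
      · rw [h6]
        nlinarith [norm_nonneg (perp ζ θ), hs.2]
      · rw [mem_Icc, ← abs_le, inner_smul_right, abs_mul, abs_of_pos hs0]
        have := abs_real_inner_le_norm ζ θ
        rw [hζ, norm_eq_of_mem_sphere, mul_one] at this
        nlinarith [hs.2, abs_nonneg ⟪ζ, (θ : Rn n)⟫]
    rw [hF, indicator_of_mem hmem, h6]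
    gcongr
    · exact hs.1.le
    · nlinarith [norm_nonneg (perp ζ θ), hs.2]
  by_contra htop
  rw [not_lt, top_le_iff] at htop
  rw [htop, ENNReal.mul_top hc0'] at h3
  exact lt_irrefl _ h3

/-- The length of the part of the ray from `y` in direction `-θ`, up to time `d`, contained in the
tube of radius `R` around the line through `x` in direction `ζ`. -/
lemma volume_line_inter_tube_le {R : ℝ} (hR : 0 < R) (d : ℝ) (x y θ : Rn n) :
    volume {s ∈ Ioc 0 d | ‖perp ζ (y - s • θ - x)‖ ≤ R} ≤
      ENNReal.ofReal (2 * R) * (ENNReal.ofReal ‖perp ζ θ‖)⁻¹ := by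
  rcases eq_or_ne (perp ζ θ) 0 with h0 | h0
  · rw [h0, norm_zero, ENNReal.ofReal_zero, ENNReal.inv_zero, ENNReal.mul_top]
    · exact le_top
    · simpa using hR
  have hpos : 0 < ‖perp ζ θ‖ := norm_pos_iff.2 h0
  rw [← ENNReal.ofReal_inv_of_pos hpos, ← ENNReal.ofReal_mul (by positivity)]
  refine (Real.volume_le_diam _).trans (Metric.ediam_le fun s hs t ht => ?_)
  rw [edist_dist]
  refine ENNReal.ofReal_le_ofReal ?_
  rw [← div_eq_mul_inv, le_div_iff₀ hpos, Real.dist_eq, ← Real.norm_eq_abs, ← norm_smul,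
    ← perp_smul]
  have : (s - t) • θ = (y - t • θ - x) - (y - s • θ - x) := by module
  rw [this, perp_sub]
  linarith [norm_sub_le (perp ζ (y - t • θ - x)) (perp ζ (y - s • θ - x)), hs.2, ht.2]

lemma lintegral_volume_line_inter_tube_le {R : ℝ} (hR : 0 < R) (d : ℝ) (x y : Rn n) :
    ∫⁻ θ : Sph n, volume {s ∈ Ioc 0 d | ‖perp ζ (y - s • (θ : Rn n) - x)‖ ≤ R} ∂surfaceMeasure n ≤
      ENNReal.ofReal (2 * R) * ∫⁻ θ : Sph n, (ENNReal.ofReal ‖perp ζ θ‖)⁻¹ ∂surfaceMeasure n := by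
  rw [← lintegral_const_mul' _ _ ENNReal.ofReal_ne_top]
  exact lintegral_mono fun θ => volume_line_inter_tube_le hR d x y θ

/-- A ray issued at distance more than `2δ` from the axis needs time at least `δ` to reach the tube.
There the polar weight is at least `δ^(n-1)`, so the angular average of lengths is controlled by the
volume of a piece of the tube, of order `R^(n-1)`. -/
lemma lintegral_volume_line_inter_tube_far_le (hn : 1 ≤ n) (hζ : ‖ζ‖ = 1) {R δ d : ℝ} (hR : 0 ≤ R)
    (hRδ : R ≤ δ) (hδ : 0 < δ) {x y : Rn n} (hy : 2 * δ < ‖perp ζ (y - x)‖) :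
    ∫⁻ θ : Sph n, volume {s ∈ Ioc 0 d | ‖perp ζ (y - s • (θ : Rn n) - x)‖ ≤ R} ∂surfaceMeasure n ≤
      (ENNReal.ofReal (δ ^ (n - 1)))⁻¹ *
        (ENNReal.ofReal (R ^ (n - 1)) * perpVol ζ (Metric.ball 0 1) * ENNReal.ofReal (2 * d)) := by
  have hc : ENNReal.ofReal (δ ^ (n - 1)) ≠ 0 := by
    rw [ne_eq, ENNReal.ofReal_eq_zero, not_le]; positivity
  set S : Set (Rn n) := {v : Rn n | ‖perp ζ (y - x - v)‖ ≤ R ∧ ⟪ζ, v⟫ ∈ Icc (-d) d} with hSdef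
  have hS : MeasurableSet S :=
    measurableSet_le_and_Icc (by fun_prop) (by fun_prop) _ _
  rw [← volume_tube_translate hn hζ hR d (y - x), ← lintegral_indicator_one hS,
    lintegral_polar hn (measurable_one.indicator hS), mul_comm, ← div_eq_mul_inv,
    ENNReal.le_div_iff_mul_le (Or.inl hc) (Or.inl ENNReal.ofReal_ne_top),
    ← lintegral_mul_const' _ _ ENNReal.ofReal_ne_top]
  refine lintegral_mono fun θ => ?_
  have hms : MeasurableSet {s ∈ Ioc 0 d | ‖perp ζ (y - s • (θ : Rn n) - x)‖ ≤ R} :=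
    measurableSet_Ioc.inter (measurableSet_le (Continuous.measurable (by fun_prop))
      measurable_const : MeasurableSet {s : ℝ | ‖perp ζ (y - s • (θ : Rn n) - x)‖ ≤ R})
  rw [mul_comm, ← setLIntegral_const]
  refine (setLIntegral_mono' hms fun s hs => ?_).trans (lintegral_mono_set
    (s := {s ∈ Ioc 0 d | ‖perp ζ (y - s • (θ : Rn n) - x)‖ ≤ R}) (t := Ioi 0) fun s hs => hs.1.1)
  obtain ⟨⟨hs0, hsd⟩, hsR⟩ := hs
  have e1 : y - x - s • (θ : Rn n) = y - s • (θ : Rn n) - x := by abel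
  have hmem : s • (θ : Rn n) ∈ S := by
    refine ⟨by rw [e1]; exact hsR, ?_⟩
    rw [mem_Icc, ← abs_le, inner_smul_right, abs_mul, abs_of_pos hs0]
    have := abs_real_inner_le_norm ζ θ
    rw [hζ, norm_eq_of_mem_sphere, mul_one] at this
    nlinarith [abs_nonneg ⟪ζ, (θ : Rn n)⟫]
  have hδs : δ ≤ s := by
    have e2 : y - x = (y - s • (θ : Rn n) - x) + s • (θ : Rn n) := by abel
    rw [e2, perp_add, perp_smul] at hy
    have h1 := norm_add_le (perp ζ (y - s • (θ : Rn n) - x)) (s • perp ζ θ)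
    rw [norm_smul, Real.norm_eq_abs, abs_of_pos hs0] at h1
    have h5 : ‖perp ζ θ‖ ≤ 1 := by
      simpa using norm_perp_le hζ (θ : Rn n)
    nlinarith
  rw [indicator_of_mem hmem, Pi.one_apply, mul_one]
  exact ENNReal.ofReal_le_ofReal (by gcongr)

end Tubes

/-! ### Bounded measurable functions and their integrals along rays. -/

/-- Bounded measurable functions. -/
def BddMeas {α : Type*} [MeasurableSpace α] (g : α → ℝ) : Prop :=
  Measurable g ∧ ∃ B : ℝ, ∀ z, |g z| ≤ B

section BddMeas

variable {α β : Type*} [MeasurableSpace α] [MeasurableSpace β] {g h : α → ℝ}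

lemma BddMeas.integrable (hg : BddMeas g) (μ : Measure α) [IsFiniteMeasure μ] :
    Integrable g μ := by
  obtain ⟨B, hB⟩ := hg.2
  exact Integrable.of_bound hg.1.aestronglyMeasurable B (Eventually.of_forall hB)

lemma BddMeas.comp (hg : BddMeas g) {f : β → α} (hf : Measurable f) :
    BddMeas fun b => g (f b) :=
  ⟨hg.1.comp hf, hg.2.imp fun _ hB b => hB (f b)⟩

lemma BddMeas.const (c : ℝ) : BddMeas fun _ : α => c :=
  ⟨measurable_const, |c|, fun _ => le_rfl⟩

lemma BddMeas.add (hg : BddMeas g) (hh : BddMeas h) : BddMeas fun z => g z + h z := by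
  obtain ⟨B, hB⟩ := hg.2
  obtain ⟨C, hC⟩ := hh.2
  exact ⟨hg.1.add hh.1, B + C, fun z => (abs_add_le _ _).trans (add_le_add (hB z) (hC z))⟩

lemma BddMeas.const_mul (hg : BddMeas g) (c : ℝ) : BddMeas fun z => c * g z := by
  obtain ⟨B, hB⟩ := hg.2
  refine ⟨hg.1.const_mul c, |c| * B, fun z => ?_⟩
  rw [abs_mul]
  exact mul_le_mul_of_nonneg_left (hB z) (abs_nonneg c)

lemma BddMeas.mul (hg : BddMeas g) (hh : BddMeas h) : BddMeas fun z => g z * h z := by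
  obtain ⟨B, hB⟩ := hg.2
  obtain ⟨C, hC⟩ := hh.2
  refine ⟨hg.1.mul hh.1, B * C, fun z => ?_⟩
  rw [abs_mul]
  exact mul_le_mul (hB z) (hC z) (abs_nonneg _) ((abs_nonneg _).trans (hB z))

lemma BddMeas.indicator_one {s : Set α} (hs : MeasurableSet s) :
    BddMeas (s.indicator fun _ => (1 : ℝ)) := by
  refine ⟨measurable_const.indicator hs, 1, fun z => ?_⟩
  by_cases hz : z ∈ s <;> simp [hz]

lemma BddMeas.integral {f : α × β → ℝ} (hf : BddMeas f) (μ : Measure β) [IsFiniteMeasure μ] :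
    BddMeas fun a => ∫ b, f (a, b) ∂μ := by
  obtain ⟨B, hB⟩ := hf.2
  refine ⟨(hf.1.stronglyMeasurable.integral_prod_right' (ν := μ)).measurable, B * μ.real univ,
    fun a => ?_⟩
  have := norm_integral_le_of_norm_le_const (μ := μ) (f := fun b => f (a, b)) (C := B)
    (Eventually.of_forall fun b => hB (a, b))
  exact this

end BddMeas

section LineIntegral

variable {n : ℕ} {D : ℝ} {g h : Rn n → ℝ}

/-- The integral of `g` along the ray from `z` in direction `-θ`, up to time `D`. -/
def lineInt (D : ℝ) (g : Rn n → ℝ) (z θ : Rn n) : ℝ := ∫ s in Ioc 0 D, g (z - s • θ)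

/-- The integral of `g` along all rays of length `D` from `z`. -/
def sphLineInt (D : ℝ) (g : Rn n → ℝ) (z : Rn n) : ℝ :=
  ∫ θ : Sph n, lineInt D g z θ ∂surfaceMeasure n

lemma bddMeas_lineInt (D : ℝ) (hg : BddMeas g) :
    BddMeas fun q : Rn n × Rn n => lineInt D g q.1 q.2 :=
  BddMeas.integral (f := fun w : (Rn n × Rn n) × ℝ => g (w.1.1 - w.2 • w.1.2))
    (hg.comp (by fun_prop)) (volume.restrict (Ioc 0 D))

lemma bddMeas_lineInt_sphere (D : ℝ) (hg : BddMeas g) :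
    BddMeas fun q : Rn n × Sph n => lineInt D g q.1 q.2 :=
  (bddMeas_lineInt D hg).comp (f := fun q : Rn n × Sph n => (q.1, (q.2 : Rn n))) (by fun_prop)

lemma bddMeas_lineInt_left (D : ℝ) (hg : BddMeas g) (z : Rn n) :
    BddMeas fun θ : Sph n => lineInt D g z θ :=
  (bddMeas_lineInt D hg).comp (f := fun θ : Sph n => (z, (θ : Rn n))) (by fun_prop)

lemma bddMeas_sphLineInt (D : ℝ) (hg : BddMeas g) : BddMeas (sphLineInt D g) :=
  (bddMeas_lineInt_sphere D hg).integral _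

lemma integrable_line (D : ℝ) (hg : BddMeas g) (z θ : Rn n) :
    Integrable (fun s : ℝ => g (z - s • θ)) (volume.restrict (Ioc 0 D)) :=
  (hg.comp (by fun_prop)).integrable _

lemma lineInt_mono (hg : BddMeas g) (hh : BddMeas h) (hgh : ∀ z, g z ≤ h z) (z θ : Rn n) :
    lineInt D g z θ ≤ lineInt D h z θ :=
  integral_mono (integrable_line D hg z θ) (integrable_line D hh z θ) fun _ => hgh _

lemma lineInt_nonneg (hg : ∀ z, 0 ≤ g z) (z θ : Rn n) : 0 ≤ lineInt D g z θ :=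
  integral_nonneg fun _ => hg _

lemma lineInt_add (hg : BddMeas g) (hh : BddMeas h) (z θ : Rn n) :
    lineInt D (fun z => g z + h z) z θ = lineInt D g z θ + lineInt D h z θ :=
  integral_add (integrable_line D hg z θ) (integrable_line D hh z θ)

lemma lineInt_const_mul (c : ℝ) (z θ : Rn n) :
    lineInt D (fun z => c * g z) z θ = c * lineInt D g z θ :=
  integral_const_mul _ _

lemma lineInt_const (hD : 0 ≤ D) (c : ℝ) (z θ : Rn n) : lineInt D (fun _ => c) z θ = D * c := by
  simp [lineInt, hD]

lemma sphLineInt_nonneg (hg : ∀ z, 0 ≤ g z) (z : Rn n) : 0 ≤ sphLineInt D g z :=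
  integral_nonneg fun _ => lineInt_nonneg hg _ _

lemma sphLineInt_mono (hg : BddMeas g) (hh : BddMeas h) (hgh : ∀ z, g z ≤ h z) (z : Rn n) :
    sphLineInt D g z ≤ sphLineInt D h z :=
  integral_mono ((bddMeas_lineInt_left D hg z).integrable _)
    ((bddMeas_lineInt_left D hh z).integrable _) fun _ => lineInt_mono hg hh hgh _ _

lemma sphLineInt_add (hg : BddMeas g) (hh : BddMeas h) (z : Rn n) :
    sphLineInt D (fun z => g z + h z) z = sphLineInt D g z + sphLineInt D h z := by
  simp only [sphLineInt, lineInt_add hg hh]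
  exact integral_add ((bddMeas_lineInt_left D hg z).integrable _)
    ((bddMeas_lineInt_left D hh z).integrable _)

lemma sphLineInt_const_mul (c : ℝ) (z : Rn n) :
    sphLineInt D (fun z => c * g z) z = c * sphLineInt D g z := by
  simp only [sphLineInt, lineInt_const_mul]
  exact integral_const_mul _ _

lemma sphLineInt_const (hD : 0 ≤ D) (c : ℝ) (z : Rn n) :
    sphLineInt D (fun _ => c) z = (surfaceMeasure n).real univ * (D * c) := by
  simp [sphLineInt, lineInt_const hD]

end LineIntegral

/-! ### Iterated ray integrals of the indicator of a thin tube. -/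

section TubeIntegrals

variable {n : ℕ} {ζ : Rn n} {D : ℝ} {x : Rn n}

/-- The indicator function of the tube of radius `R` around the line through `x` in
direction `ζ`. -/
def tubeInd (ζ x : Rn n) (R : ℝ) : Rn n → ℝ :=
  {z | ‖perp ζ (z - x)‖ ≤ R}.indicator fun _ => 1

lemma measurableSet_tube (ζ x : Rn n) (R : ℝ) : MeasurableSet {z | ‖perp ζ (z - x)‖ ≤ R} :=
  measurableSet_le (Continuous.measurable (by fun_prop)) measurable_const

lemma bddMeas_tubeInd (ζ x : Rn n) (R : ℝ) : BddMeas (tubeInd ζ x R) :=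
  BddMeas.indicator_one (measurableSet_tube ζ x R)

lemma tubeInd_of_le {R : ℝ} {z : Rn n} (hz : ‖perp ζ (z - x)‖ ≤ R) : tubeInd ζ x R z = 1 :=
  indicator_of_mem (s := {z | ‖perp ζ (z - x)‖ ≤ R}) hz _

lemma tubeInd_of_lt {R : ℝ} {z : Rn n} (hz : R < ‖perp ζ (z - x)‖) : tubeInd ζ x R z = 0 :=
  indicator_of_notMem (s := {z | ‖perp ζ (z - x)‖ ≤ R}) (not_le.2 hz) _

lemma tubeInd_nonneg (R : ℝ) (z : Rn n) : 0 ≤ tubeInd ζ x R z :=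
  indicator_nonneg (fun _ _ => zero_le_one) _

lemma lineInt_tubeInd (R : ℝ) (z θ : Rn n) : lineInt D (tubeInd ζ x R) z θ =
    (volume {s ∈ Ioc 0 D | ‖perp ζ (z - s • θ - x)‖ ≤ R}).toReal := by
  have hm : MeasurableSet {s : ℝ | ‖perp ζ (z - s • θ - x)‖ ≤ R} :=
    measurableSet_le (Continuous.measurable (by fun_prop)) measurable_const
  have : (fun s : ℝ => tubeInd ζ x R (z - s • θ)) =
      {s : ℝ | ‖perp ζ (z - s • θ - x)‖ ≤ R}.indicator 1 := by
    ext s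
    rfl
  rw [lineInt, this, integral_indicator_one hm, measureReal_def, Measure.restrict_apply hm,
    inter_comm]
  rfl

lemma lineInt_tubeInd_le {R : ℝ} (hR : 0 < R) (z : Rn n) {η : Rn n} (hη : perp ζ η ≠ 0) :
    lineInt D (tubeInd ζ x R) z η ≤ 2 * R * ‖perp ζ η‖⁻¹ := by
  have hpos : 0 < ‖perp ζ η‖ := norm_pos_iff.2 hη
  have h1 := volume_line_inter_tube_le (ζ := ζ) hR D x z η
  rw [← ENNReal.ofReal_inv_of_pos hpos, ← ENNReal.ofReal_mul (by positivity)] at h1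
  rw [lineInt_tubeInd]
  exact ENNReal.toReal_le_of_le_ofReal (by positivity) h1

lemma sphLineInt_tubeInd_eq (R : ℝ) (z : Rn n) : sphLineInt D (tubeInd ζ x R) z =
    (∫⁻ θ : Sph n, volume {s ∈ Ioc 0 D | ‖perp ζ (z - s • (θ : Rn n) - x)‖ ≤ R}
      ∂surfaceMeasure n).toReal := by
  rw [sphLineInt, integral_eq_lintegral_of_nonneg_ae
    (Eventually.of_forall fun θ => lineInt_nonneg (tubeInd_nonneg R) _ _)
    (bddMeas_lineInt_left D (bddMeas_tubeInd ζ x R) z).1.aestronglyMeasurable]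
  congr 1
  refine lintegral_congr fun θ => ?_
  rw [lineInt_tubeInd, ENNReal.ofReal_toReal]
  exact ((measure_mono (sep_subset _ _)).trans_lt measure_Ioc_lt_top).ne

lemma exists_sphLineInt_tubeInd_le (hn : 3 ≤ n) (hζ : ‖ζ‖ = 1) (D : ℝ) (x : Rn n) :
    ∃ C : ℝ, 0 ≤ C ∧ ∀ R : ℝ, 0 < R → ∀ z, sphLineInt D (tubeInd ζ x R) z ≤ C * R := by
  have hlt := lintegral_inv_norm_perp_lt_top hn hζ
  set K := ∫⁻ θ : Sph n, (ENNReal.ofReal ‖perp ζ θ‖)⁻¹ ∂surfaceMeasure n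
  refine ⟨2 * K.toReal, by positivity, fun R hR z => ?_⟩
  rw [sphLineInt_tubeInd_eq]
  refine (ENNReal.toReal_mono (ENNReal.mul_ne_top ENNReal.ofReal_ne_top hlt.ne)
    (lintegral_volume_line_inter_tube_le hR D x z)).trans (le_of_eq ?_)
  rw [ENNReal.toReal_mul, ENNReal.toReal_ofReal (by positivity)]
  ring

lemma exists_sphLineInt_tubeInd_far_le (hn : 1 ≤ n) (hζ : ‖ζ‖ = 1) (hD : 0 ≤ D) (x : Rn n) {δ : ℝ}
    (hδ : 0 < δ) : ∃ C : ℝ, 0 ≤ C ∧ ∀ R : ℝ, 0 ≤ R → R ≤ δ → ∀ z, 2 * δ < ‖perp ζ (z - x)‖ →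
      sphLineInt D (tubeInd ζ x R) z ≤ C * R ^ (n - 1) := by
  refine ⟨(δ ^ (n - 1))⁻¹ * (perpVol ζ (Metric.ball 0 1)).toReal * (2 * D), by positivity,
    fun R hR hRδ z hz => ?_⟩
  rw [sphLineInt_tubeInd_eq]
  have hV : perpVol ζ (Metric.ball 0 1) ≠ ⊤ := Metric.isBounded_ball.measure_lt_top.ne
  have hδ' : 0 < δ ^ (n - 1) := by positivity
  have hc : ENNReal.ofReal (δ ^ (n - 1)) ≠ 0 := by
    rw [ne_eq, ENNReal.ofReal_eq_zero, not_le]; positivity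
  refine (ENNReal.toReal_mono (ENNReal.mul_ne_top (ENNReal.inv_ne_top.2 hc) (ENNReal.mul_ne_top
    (ENNReal.mul_ne_top ENNReal.ofReal_ne_top hV) ENNReal.ofReal_ne_top))
    (lintegral_volume_line_inter_tube_far_le hn hζ hR hRδ hδ hz)).trans (le_of_eq ?_)
  rw [ENNReal.toReal_mul, ENNReal.toReal_mul, ENNReal.toReal_mul, ENNReal.toReal_inv,
    ENNReal.toReal_ofReal hδ'.le, ENNReal.toReal_ofReal (by positivity),
    ENNReal.toReal_ofReal (by positivity)]
  ring

/-- The linear bound is kept only in the tube of radius `2δ`; outside, `R^(n-1) ≤ R²` as `n ≥ 3`.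
The constant `C` does not depend on `δ`, so a further integration of the first term gains a factor
proportional to `δ`. -/
lemma exists_sphLineInt_tubeInd_majorant (hn : 3 ≤ n) (hζ : ‖ζ‖ = 1) (hD : 0 ≤ D) (x : Rn n) :
    ∃ C : ℝ, 0 ≤ C ∧ ∀ δ : ℝ, 0 < δ → ∃ C' : ℝ, 0 ≤ C' ∧ ∀ R : ℝ, 0 < R → R ≤ δ → R ≤ 1 → ∀ z,
      sphLineInt D (tubeInd ζ x R) z ≤ C * R * tubeInd ζ x (2 * δ) z + C' * R ^ 2 := by
  obtain ⟨C, hC, h1⟩ := exists_sphLineInt_tubeInd_le hn hζ D x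
  refine ⟨C, hC, fun δ hδ => ?_⟩
  obtain ⟨C', hC', h2⟩ := exists_sphLineInt_tubeInd_far_le (by omega) hζ hD x hδ
  refine ⟨C', hC', fun R hR hRδ hR1 z => ?_⟩
  by_cases hz : ‖perp ζ (z - x)‖ ≤ 2 * δ
  · rw [tubeInd_of_le hz, mul_one]
    have := h1 R hR z
    have : 0 ≤ C' * R ^ 2 := by positivity
    linarith
  · rw [tubeInd_of_lt (not_le.1 hz), mul_zero, zero_add]
    refine (h2 R hR.le hRδ z (not_le.1 hz)).trans ?_
    gcongr C' * ?_
    exact pow_le_pow_of_le_one hR.le hR1 (by omega)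

/-- Repeated integration of the indicator function of a thin tube along rays is negligible
compared with the radius of the tube. -/
lemma exists_sphLineInt_sphLineInt_tubeInd_le (hn : 3 ≤ n) (hζ : ‖ζ‖ = 1) (hD : 0 ≤ D) (x : Rn n)
    {κ : ℝ} (hκ : 0 < κ) : ∃ R₀ : ℝ, 0 < R₀ ∧ ∀ R : ℝ, 0 < R → R ≤ R₀ → ∀ z,
      sphLineInt D (sphLineInt D (tubeInd ζ x R)) z ≤ κ * R := by
  obtain ⟨C, hC, h1⟩ := exists_sphLineInt_tubeInd_majorant hn hζ hD x
  obtain ⟨C2, hC2, h2⟩ := exists_sphLineInt_tubeInd_le hn hζ D x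
  -- `δ` makes the contribution from near the axis at most `κR/2`. The constant `C'` depends on `δ`,
  -- so the threshold for `R`, which handles the quadratic term, is chosen afterwards.
  obtain ⟨δ, hδ, hδκ⟩ : ∃ δ : ℝ, 0 < δ ∧ C * C2 * (2 * δ) ≤ κ / 2 := by
    refine ⟨κ / (4 * (C * C2 + 1)), by positivity, ?_⟩
    rw [show C * C2 * (2 * (κ / (4 * (C * C2 + 1)))) = κ / 2 * (C * C2 / (C * C2 + 1)) by
      field_simp; ring]
    refine mul_le_of_le_one_right (by positivity) ?_
    rw [div_le_one (by positivity)]; linarith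
  obtain ⟨C', hC', h3⟩ := h1 δ hδ
  set A := (surfaceMeasure n).real univ * (D * C') with hA
  have hA0 : 0 ≤ A := by positivity
  refine ⟨min (min δ 1) (κ / (2 * (A + 1))), by positivity, fun R hR hR0 z => ?_⟩
  have hRδ : R ≤ δ := hR0.trans ((min_le_left _ _).trans (min_le_left _ _))
  have hR1 : R ≤ 1 := hR0.trans ((min_le_left _ _).trans (min_le_right _ _))
  have hRA : R ≤ κ / (2 * (A + 1)) := hR0.trans (min_le_right _ _)
  have hb1 := (bddMeas_tubeInd ζ x (2 * δ)).const_mul (C * R)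
  have hb2 : BddMeas fun _ : Rn n => C' * R ^ 2 := BddMeas.const _
  have h4 := sphLineInt_mono (D := D) (bddMeas_sphLineInt D (bddMeas_tubeInd ζ x R))
    (hb1.add hb2) (h3 R hR hRδ hR1) z
  rw [sphLineInt_add hb1 hb2, sphLineInt_const_mul, sphLineInt_const hD] at h4
  have h5 : C * R * sphLineInt D (tubeInd ζ x (2 * δ)) z ≤ C * R * (C2 * (2 * δ)) :=
    mul_le_mul_of_nonneg_left (h2 _ (by positivity) z) (by positivity)
  have h6 : (surfaceMeasure n).real univ * (D * (C' * R ^ 2)) = A * R * R := by rw [hA]; ring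
  have h7 : A * R ≤ κ / 2 := by
    rw [le_div_iff₀ (by positivity)] at hRA
    nlinarith
  nlinarith

/-- Along one fixed line there is no averaging over directions; transversality of `η` to the axis
plays its role, since the line spends only a time `O(δ)` in the tube of radius `2δ`. -/
lemma exists_lineInt_sphLineInt_tubeInd_le (hn : 3 ≤ n) (hζ : ‖ζ‖ = 1) (hD : 0 ≤ D) (x : Rn n)
    {η : Rn n} (hη : perp ζ η ≠ 0) {κ : ℝ} (hκ : 0 < κ) : ∃ R₀ : ℝ, 0 < R₀ ∧
      ∀ R : ℝ, 0 < R → R ≤ R₀ → ∀ z, lineInt D (sphLineInt D (tubeInd ζ x R)) z η ≤ κ * R := by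
  obtain ⟨C, hC, h1⟩ := exists_sphLineInt_tubeInd_majorant hn hζ hD x
  have hpos : 0 < ‖perp ζ η‖ := norm_pos_iff.2 hη
  set C2 := 2 * ‖perp ζ η‖⁻¹ with hC2def
  have hC2 : 0 ≤ C2 := by positivity
  obtain ⟨δ, hδ, hδκ⟩ : ∃ δ : ℝ, 0 < δ ∧ C * C2 * (2 * δ) ≤ κ / 2 := by
    refine ⟨κ / (4 * (C * C2 + 1)), by positivity, ?_⟩
    rw [show C * C2 * (2 * (κ / (4 * (C * C2 + 1)))) = κ / 2 * (C * C2 / (C * C2 + 1)) by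
      field_simp; ring]
    refine mul_le_of_le_one_right (by positivity) ?_
    rw [div_le_one (by positivity)]; linarith
  obtain ⟨C', hC', h3⟩ := h1 δ hδ
  set A := D * C' with hA
  have hA0 : 0 ≤ A := by positivity
  refine ⟨min (min δ 1) (κ / (2 * (A + 1))), by positivity, fun R hR hR0 z => ?_⟩
  have hRδ : R ≤ δ := hR0.trans ((min_le_left _ _).trans (min_le_left _ _))
  have hR1 : R ≤ 1 := hR0.trans ((min_le_left _ _).trans (min_le_right _ _))
  have hRA : R ≤ κ / (2 * (A + 1)) := hR0.trans (min_le_right _ _)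
  have hb1 := (bddMeas_tubeInd ζ x (2 * δ)).const_mul (C * R)
  have hb2 : BddMeas fun _ : Rn n => C' * R ^ 2 := BddMeas.const _
  have h4 := lineInt_mono (D := D) (bddMeas_sphLineInt D (bddMeas_tubeInd ζ x R))
    (hb1.add hb2) (h3 R hR hRδ hR1) z η
  rw [lineInt_add hb1 hb2, lineInt_const_mul, lineInt_const hD] at h4
  have h5 : C * R * lineInt D (tubeInd ζ x (2 * δ)) z η ≤ C * R * (C2 * (2 * δ)) :=
    mul_le_mul_of_nonneg_left ((lineInt_tubeInd_le (by positivity) z hη).trans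
      (le_of_eq (by rw [hC2def]; ring))) (by positivity)
  have h6 : D * (C' * R ^ 2) = A * R * R := by rw [hA]; ring
  have h7 : A * R ≤ κ / 2 := by
    rw [le_div_iff₀ (by positivity)] at hRA
    nlinarith
  nlinarith

end TubeIntegrals

/-! ### Duhamel's formula along characteristics. -/

/-- Variation of constants for an integral equation with measurable data. -/
lemma variation_of_constants {T : ℝ} {σ g w : ℝ → ℝ} (hσ : Continuous σ)
    (hint : IntervalIntegrable (fun s => σ s * w s - g s) volume 0 T) (hT : 0 ≤ T)
    (hw : ∀ t ∈ Icc 0 T, w t = w 0 + ∫ s in (0 : ℝ)..t, (σ s * w s - g s)) :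
    w 0 = Real.exp (-∫ s in (0 : ℝ)..T, σ s) * w T +
      ∫ s in (0 : ℝ)..T, Real.exp (-∫ r in (0 : ℝ)..s, σ r) * g s := by
  set E : ℝ → ℝ := fun t => Real.exp (-∫ s in (0 : ℝ)..t, σ s) with hE
  -- `W` equals `w` on the interval and is absolutely continuous, so its product with the
  -- integrating factor `E` can be integrated by parts even though the derivative exists only almost
  -- everywhere.
  set W : ℝ → ℝ := fun t => w 0 + ∫ s in (0 : ℝ)..t, (σ s * w s - g s) with hW
  have hEd : ∀ t, HasDerivAt E (E t * (-σ t)) t := fun t =>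
    (hσ.integral_hasStrictDerivAt 0 t).hasDerivAt.fun_neg.exp
  have hEc : Continuous E := continuous_iff_continuousAt.2 fun t => (hEd t).continuousAt
  have hE1 : ContDiff ℝ 1 E := by
    rw [contDiff_one_iff_deriv]
    refine ⟨fun t => (hEd t).differentiableAt, ?_⟩
    have : deriv E = fun t => E t * (-σ t) := funext fun t => (hEd t).deriv
    rw [this]
    exact hEc.mul hσ.neg
  have hEac : AbsolutelyContinuousOnInterval E 0 T := hE1.contDiffOn.absolutelyContinuousOnInterval
  have hWac : AbsolutelyContinuousOnInterval W 0 T := by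
    have h1 := hint.absolutelyContinuousOnInterval_intervalIntegral (c := 0) (by simp)
    have h2 : AbsolutelyContinuousOnInterval (fun _ : ℝ => w 0) 0 T :=
      (contDiff_const (n := 1)).contDiffOn.absolutelyContinuousOnInterval
    exact h2.add h1
  have key := hEac.integral_deriv_mul_eq_sub hWac
  have h3 : ∫ s in (0 : ℝ)..T, (deriv E s * W s + E s * deriv W s) =
      ∫ s in (0 : ℝ)..T, -(E s * g s) := by
    refine intervalIntegral.integral_congr_ae ?_
    filter_upwards [hint.ae_hasDerivAt_integral] with s hs hsT
    have hsI : s ∈ uIcc 0 T := uIoc_subset_uIcc hsT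
    have h4 : HasDerivAt W (σ s * w s - g s) s := (hs hsI 0 (by simp)).const_add _
    have h5 : W s = w s := (hw s (by rwa [uIcc_of_le hT] at hsI)).symm
    rw [h4.deriv, (hEd s).deriv, h5]
    ring
  rw [h3, intervalIntegral.integral_neg] at key
  have hWT : W T = w T := (hw T ⟨hT, le_rfl⟩).symm
  have hW0 : W 0 = w 0 := by simp [hW]
  have hE0 : E 0 = 1 := by simp [hE]
  rw [hWT, hW0, hE0] at key
  linarith

section Solutions

variable {n : ℕ} {Ω : Set (Rn n)} {σ : Rn n → ℝ} {k : Rn n → Sph n → Sph n → ℝ}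
  {f u : Rn n → Sph n → ℝ} {D M B : ℝ}

/-- The attenuation along the ray from `y` in direction `-θ`, up to time `s`. -/
def atten (σ : Rn n → ℝ) (y θ : Rn n) (s : ℝ) : ℝ :=
  Real.exp (-∫ r in (0 : ℝ)..s, σ (y - r • θ))

/-- The scattering operator. -/
def scatter (k : Rn n → Sph n → Sph n → ℝ) (u : Rn n → Sph n → ℝ) (y : Rn n) (θ : Sph n) : ℝ :=
  ∫ θ', k y θ θ' * u y θ' ∂(surfaceMeasure n)

lemma rteRHS_eq (y : Rn n) (θ : Sph n) : rteRHS σ k u y θ = -σ y * u y θ + scatter k u y θ := rfl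

/-- A solution is measurable and bounded only over `Ω`; extension by zero makes integrals over whole
lines and product spaces available. The same is done below for `k` and `σ`. -/
lemma IsRTESolution.exists_bddMeas (hΩ : IsOpen Ω) (hu : IsRTESolution Ω σ k f u) :
    ∃ v : Rn n × Sph n → ℝ, BddMeas v ∧ ∀ y ∈ Ω, ∀ θ, v (y, θ) = u y θ := by
  obtain ⟨C, hC⟩ := hu.bounded
  have hemb : MeasurableEmbedding (Prod.map Subtype.val id : Ω × Sph n → Rn n × Sph n) :=
    (MeasurableEmbedding.subtype_coe hΩ.measurableSet).prodMap MeasurableEmbedding.id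
  refine ⟨Function.extend (Prod.map Subtype.val id : Ω × Sph n → Rn n × Sph n)
    (fun q => u q.1 q.2) 0, ⟨hemb.measurable_extend hu.measurable measurable_const, |C|, ?_⟩, ?_⟩
  · intro q
    by_cases hq : ∃ p, (Prod.map Subtype.val id : Ω × Sph n → Rn n × Sph n) p = q
    · obtain ⟨p, rfl⟩ := hq
      rw [hemb.injective.extend_apply]
      exact (hC _ p.1.2 _).trans (le_abs_self _)
    · rw [Function.extend_apply' _ _ _ hq]
      simp
  · intro y hy θ
    exact hemb.injective.extend_apply (fun q : Ω × Sph n => u q.1 q.2) 0 (⟨y, hy⟩, θ)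

lemma IsAdmissible.exists_bddMeas_kernel (hΩ : IsOpen Ω) (h : IsAdmissible Ω σ k) :
    ∃ K : Rn n × Sph n × Sph n → ℝ, BddMeas K ∧ ∀ y ∈ Ω, ∀ θ θ', K (y, θ, θ') = k y θ θ' := by
  obtain ⟨M, hM⟩ := h.k_bdd
  classical
  have hm : MeasurableSet (Ω ×ˢ (univ : Set (Sph n × Sph n))) :=
    hΩ.measurableSet.prod MeasurableSet.univ
  refine ⟨(Ω ×ˢ (univ : Set (Sph n × Sph n))).piecewise (fun q => k q.1 q.2.1 q.2.2) 0,
    ⟨h.k_cont.measurable_piecewise continuousOn_const hm, |M|, ?_⟩, ?_⟩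
  · intro q
    by_cases hq : q ∈ Ω ×ˢ (univ : Set (Sph n × Sph n))
    · rw [piecewise_eq_of_mem _ _ _ hq, abs_of_pos (h.k_pos _ hq.1 _ _)]
      exact (hM _ hq.1 _ _).trans (le_abs_self _)
    · rw [piecewise_eq_of_notMem _ _ _ hq]
      simp
  · intro y hy θ θ'
    have hq : (y, θ, θ') ∈ Ω ×ˢ (univ : Set (Sph n × Sph n)) := ⟨hy, mem_univ _⟩
    exact piecewise_eq_of_mem _ _ _ hq

lemma IsAdmissible.exists_bddMeas_sigma (hΩ : Bornology.IsBounded Ω) (h : IsAdmissible Ω σ k) :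
    ∃ s : Rn n → ℝ, BddMeas s ∧ (∀ y, 0 ≤ s y) ∧ ∀ y ∈ closure Ω, s y = σ y := by
  have hcomp : IsCompact (closure Ω) := hΩ.isCompact_closure
  obtain ⟨C, hC⟩ := hcomp.exists_bound_of_continuousOn h.sigma_cont
  classical
  refine ⟨(closure Ω).piecewise σ 0,
    ⟨h.sigma_cont.measurable_piecewise continuousOn_const isClosed_closure.measurableSet, |C|, ?_⟩,
    ?_, ?_⟩
  · intro q
    by_cases hq : q ∈ closure Ω
    · rw [piecewise_eq_of_mem _ _ _ hq]
      exact (hC q hq).trans (le_abs_self _)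
    · rw [piecewise_eq_of_notMem _ _ _ hq]
      simp
  · intro q
    by_cases hq : q ∈ closure Ω
    · rw [piecewise_eq_of_mem _ _ _ hq]
      exact (h.sigma_pos q hq).le
    · rw [piecewise_eq_of_notMem _ _ _ hq]
      simp
  · intro q hq
    exact piecewise_eq_of_mem _ _ _ hq

/-- The scattering term of a solution agrees in `Ω` with a bounded measurable function. -/
lemma IsRTESolution.exists_bddMeas_scatter (hΩ : IsOpen Ω) (hadm : IsAdmissible Ω σ k)
    {v : Rn n × Sph n → ℝ} (hv : BddMeas v) (hvu : ∀ y ∈ Ω, ∀ θ, v (y, θ) = u y θ) :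
    ∃ g : Rn n × Sph n → ℝ, BddMeas g ∧ ∀ y ∈ Ω, ∀ θ, g (y, θ) = scatter k u y θ := by
  obtain ⟨K, hK, hKk⟩ := hadm.exists_bddMeas_kernel hΩ
  refine ⟨fun q => ∫ θ', K (q.1, q.2, θ') * v (q.1, θ') ∂(surfaceMeasure n), ?_, ?_⟩
  · exact BddMeas.integral (f := fun w : (Rn n × Sph n) × Sph n => K (w.1.1, w.1.2, w.2) *
      v (w.1.1, w.2)) ((hK.comp (by fun_prop)).mul (hv.comp (by fun_prop))) _
  · intro y hy θ
    simp only [scatter, hKk y hy, hvu y hy]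

lemma mem_closure_of_ray {y θ : Rn n} {τ : ℝ} (hτ : 0 < τ)
    (hray : ∀ s ∈ Ioo 0 τ, y - s • θ ∈ Ω) {s : ℝ} (hs : s ∈ Icc 0 τ) : y - s • θ ∈ closure Ω := by
  have hcont : Continuous fun s : ℝ => y - s • θ := by fun_prop
  refine hcont.closure_preimage_subset Ω (closure_mono (s := Ioo 0 τ) hray ?_)
  rwa [closure_Ioo hτ.ne]

lemma continuousOn_sigma_ray (hadm : IsAdmissible Ω σ k) {y θ : Rn n} {τ : ℝ}
    (hτ : 0 < τ) (hray : ∀ s ∈ Ioo 0 τ, y - s • θ ∈ Ω) :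
    ContinuousOn (fun s : ℝ => σ (y - s • θ)) (Icc 0 τ) :=
  hadm.sigma_cont.comp (by fun_prop) fun _ hs => mem_closure_of_ray hτ hray hs

/-- Duhamel's formula along a characteristic. -/
lemma IsRTESolution.duhamel (hΩ : IsOpen Ω) (hadm : IsAdmissible Ω σ k)
    (hu : IsRTESolution Ω σ k f u) {y : Rn n} {θ : Sph n} {τ : ℝ} (hτ : 0 < τ)
    (hray : ∀ s ∈ Ioo 0 τ, y - s • (θ : Rn n) ∈ Ω) (hy : y ∈ Ω ∨ (y, θ) ∈ outflow Ω)
    (hp : (y - τ • (θ : Rn n), θ) ∈ inflow Ω) :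
    u y θ = atten σ y θ τ * f (y - τ • (θ : Rn n)) θ +
      ∫ s in (0 : ℝ)..τ, atten σ y θ s * scatter k u (y - s • (θ : Rn n)) θ := by
  obtain ⟨v, hv, hvu⟩ := hu.exists_bddMeas hΩ
  obtain ⟨g, hg, hgs⟩ := IsRTESolution.exists_bddMeas_scatter hΩ hadm hv hvu
  -- `σ` is continuous only on `closure Ω`, so its restriction to the segment is continued by
  -- constants to a function continuous on the line.
  set S : ℝ → ℝ := IccExtend hτ.le ((Icc 0 τ).domRestrict fun s : ℝ => σ (y - s • (θ : Rn n)))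
    with hS
  have hScont : Continuous S := (continuousOn_sigma_ray hadm hτ hray).domRestrict.Icc_extend'
  have hSeq : ∀ s ∈ Icc 0 τ, S s = σ (y - s • (θ : Rn n)) := fun s hs => by
    rw [hS, IccExtend_of_mem _ _ hs]; rfl
  set w : ℝ → ℝ := fun s => u (y - s • (θ : Rn n)) θ with hw
  set G : ℝ → ℝ := fun s => scatter k u (y - s • (θ : Rn n)) θ with hG
  have hae : ∀ t ∈ Icc 0 τ, ∀ᵐ s : ℝ, s ∈ uIoc 0 t → s ∈ Ioo 0 τ := by
    intro t ht
    have : ∀ᵐ s : ℝ, s ≠ τ := by simp [ae_iff]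
    filter_upwards [this] with s hs hst
    rw [uIoc_of_le ht.1] at hst
    exact ⟨hst.1, (hst.2.trans ht.2).lt_of_ne hs⟩
  have hint : IntervalIntegrable (fun s => S s * w s - G s) volume 0 τ := by
    have h1 : IntervalIntegrable (fun s : ℝ => S s * v (y - s • (θ : Rn n), θ) -
        g (y - s • (θ : Rn n), θ)) volume 0 τ := by
      have h2 : IntervalIntegrable (fun s : ℝ => v (y - s • (θ : Rn n), θ)) volume 0 τ := by
        rw [intervalIntegrable_iff_integrableOn_Ioc_of_le hτ.le]
        exact (hv.comp (f := fun s : ℝ => (y - s • (θ : Rn n), θ)) (by fun_prop)).integrable _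
      have h3 : IntervalIntegrable (fun s : ℝ => g (y - s • (θ : Rn n), θ)) volume 0 τ := by
        rw [intervalIntegrable_iff_integrableOn_Ioc_of_le hτ.le]
        exact (hg.comp (f := fun s : ℝ => (y - s • (θ : Rn n), θ)) (by fun_prop)).integrable _
      exact (h2.continuousOn_mul hScont.continuousOn).sub h3
    refine h1.congr_ae ?_
    rw [EventuallyEq, ae_restrict_iff' measurableSet_uIoc]
    filter_upwards [hae τ ⟨hτ.le, le_rfl⟩] with s hs hsτ
    have h4 := hray s (hs hsτ)
    rw [hvu _ h4, hgs _ h4]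
  have hw' : ∀ t ∈ Icc 0 τ, w t = w 0 + ∫ s in (0 : ℝ)..t, (S s * w s - G s) := by
    intro t ht
    rcases ht.1.eq_or_lt with h0 | h0
    · rw [← h0]; simp
    have e1 : y - t • (θ : Rn n) + t • (θ : Rn n) = y := sub_add_cancel _ _
    -- The equation is used forwards from `y - tθ` to `y`, then reparametrized backwards from `y`.
    have htr := hu.transport (y - t • (θ : Rn n)) θ t h0 (fun r hr => ?_) ?_ (by rwa [e1])
    · rw [e1] at htr
      have e2 : ∀ r : ℝ, y - t • (θ : Rn n) + r • (θ : Rn n) = y - (t - r) • (θ : Rn n) := by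
        intro r; module
      simp only [e2] at htr
      rw [intervalIntegral.integral_comp_sub_left
        (fun r => rteRHS σ k u (y - r • (θ : Rn n)) θ) t, sub_self, sub_zero] at htr
      have e3 : ∫ s in (0 : ℝ)..t, (S s * w s - G s) =
          -∫ r in (0 : ℝ)..t, rteRHS σ k u (y - r • (θ : Rn n)) θ := by
        rw [← intervalIntegral.integral_neg]
        refine intervalIntegral.integral_congr fun s hs => ?_
        rw [uIcc_of_le h0.le] at hs
        simp only [rteRHS_eq, hSeq s ⟨hs.1, hs.2.trans ht.2⟩, hw, hG]
        ring
      rw [e3, ← htr]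
      simp [hw]
    · have := hray (t - r) ⟨by linarith [hr.2], by linarith [hr.1, ht.2]⟩
      convert this using 1
      module
    · rcases ht.2.eq_or_lt with h1 | h1
      · right; rw [h1]; exact hp
      · left; exact hray t ⟨h0, h1⟩
  have key := variation_of_constants hScont hint hτ.le hw'
  have hat : ∀ s ∈ Icc 0 τ, Real.exp (-∫ r in (0 : ℝ)..s, S r) = atten σ y θ s := by
    intro s hs
    rw [atten]
    congr 2
    refine intervalIntegral.integral_congr fun r hr => ?_
    rw [uIcc_of_le hs.1] at hr
    exact hSeq r ⟨hr.1, hr.2.trans hs.2⟩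
  rw [hat τ ⟨hτ.le, le_rfl⟩] at key
  have e4 : w 0 = u y θ := by simp [hw]
  have e5 : w τ = f (y - τ • (θ : Rn n)) θ := hu.boundary _ _ hp
  rw [e4, e5] at key
  rw [key]
  congr 1
  refine intervalIntegral.integral_congr fun s hs => ?_
  rw [uIcc_of_le hτ.le] at hs
  simp only [hat s hs, hG]

end Solutions

/-! ### Comparison with supersolutions. -/

/-- A bounded `C¹` domain of diameter at most `D` with admissible coefficients `k ≤ M`, `σ ≤ B`. -/
structure TransportSetting {n : ℕ} (Ω : Set (Rn n)) (σ : Rn n → ℝ) (k : Rn n → Sph n → Sph n → ℝ)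
    (D M B : ℝ) : Prop where
  domain : IsBoundedC1Domain Ω
  admissible : IsAdmissible Ω σ k
  dist_le : ∀ y ∈ Ω, ∀ z ∈ Ω, dist y z ≤ D
  D_nonneg : 0 ≤ D
  k_le : ∀ y ∈ Ω, ∀ θ θ', k y θ θ' ≤ M
  M_nonneg : 0 ≤ M
  sigma_le : ∀ y ∈ closure Ω, σ y ≤ B
  B_nonneg : 0 ≤ B

section Bounds

variable {n : ℕ} {Ω : Set (Rn n)} {σ : Rn n → ℝ} {k : Rn n → Sph n → Sph n → ℝ}
  {f u : Rn n → Sph n → ℝ} {D M B : ℝ}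

lemma exists_transportSetting (hΩ : IsBoundedC1Domain Ω) (h : IsAdmissible Ω σ k) :
    ∃ D M B : ℝ, TransportSetting Ω σ k D M B := by
  obtain ⟨D, hD⟩ := Metric.isBounded_iff.1 hΩ.isBounded
  obtain ⟨M, hM⟩ := h.k_bdd
  obtain ⟨B, hB⟩ := (hΩ.isBounded.isCompact_closure).exists_bound_of_continuousOn h.sigma_cont
  refine ⟨max D 0, max M 0, max B 0, hΩ, h, fun y hy z hz => (hD hy hz).trans (le_max_left _ _),
    le_max_right _ _, fun y hy θ θ' => (hM y hy θ θ').trans (le_max_left _ _), le_max_right _ _,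
    fun y hy => ((le_abs_self _).trans (hB y hy)).trans (le_max_left _ _), le_max_right _ _⟩

lemma atten_pos (σ : Rn n → ℝ) (y θ : Rn n) (s : ℝ) : 0 < atten σ y θ s := Real.exp_pos _

lemma TransportSetting.atten_le_one (h : TransportSetting Ω σ k D M B) {y θ : Rn n} {τ : ℝ}
    (hτ : 0 < τ) (hray : ∀ s ∈ Ioo 0 τ, y - s • θ ∈ Ω) {s : ℝ} (hs : s ∈ Icc 0 τ) :
    atten σ y θ s ≤ 1 := by
  rw [atten, Real.exp_le_one_iff, neg_nonpos]
  exact intervalIntegral.integral_nonneg hs.1 fun r hr =>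
    (h.admissible.sigma_pos _ (mem_closure_of_ray hτ hray ⟨hr.1, hr.2.trans hs.2⟩)).le

lemma TransportSetting.le_atten (h : TransportSetting Ω σ k D M B) {y θ : Rn n} {τ : ℝ}
    (hτ : 0 < τ) (hτD : τ ≤ D) (hray : ∀ s ∈ Ioo 0 τ, y - s • θ ∈ Ω) :
    Real.exp (-(B * D)) ≤ atten σ y θ τ := by
  rw [atten, Real.exp_le_exp, neg_le_neg_iff]
  have h1 : ∫ r in (0 : ℝ)..τ, σ (y - r • θ) ≤ ∫ _ in (0 : ℝ)..τ, B := by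
    refine intervalIntegral.integral_mono_on hτ.le ?_ (by simp) fun r hr =>
      h.sigma_le _ (mem_closure_of_ray hτ hray hr)
    refine ContinuousOn.intervalIntegrable ?_
    rw [uIcc_of_le hτ.le]
    exact continuousOn_sigma_ray h.admissible hτ hray
  refine h1.trans ?_
  rw [intervalIntegral.integral_const, sub_zero, smul_eq_mul, mul_comm]
  exact mul_le_mul_of_nonneg_left hτD h.B_nonneg

lemma continuousOn_atten (hadm : IsAdmissible Ω σ k) {y θ : Rn n} {τ : ℝ} (hτ : 0 < τ)
    (hray : ∀ s ∈ Ioo 0 τ, y - s • θ ∈ Ω) : ContinuousOn (atten σ y θ) (Icc 0 τ) := by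
  have h1 : IntegrableOn (fun r : ℝ => σ (y - r • θ)) (uIcc 0 τ) := by
    rw [uIcc_of_le hτ.le]
    exact (continuousOn_sigma_ray hadm hτ hray).integrableOn_Icc
  have h2 := intervalIntegral.continuousOn_primitive_interval h1
  rw [uIcc_of_le hτ.le] at h2
  exact Real.continuous_exp.comp_continuousOn h2.neg

/-- Variation of constants for the constant function 1: the fraction absorbed along the ray. It
turns `∫ k ≤ σ` into the contraction factor `1 - exp(-BD)` of the comparison principle. -/
lemma integral_atten_mul_sigma (hadm : IsAdmissible Ω σ k) {y θ : Rn n} {τ : ℝ} (hτ : 0 < τ)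
    (hray : ∀ s ∈ Ioo 0 τ, y - s • θ ∈ Ω) :
    ∫ s in (0 : ℝ)..τ, atten σ y θ s * σ (y - s • θ) = 1 - atten σ y θ τ := by
  set S : ℝ → ℝ := IccExtend hτ.le ((Icc 0 τ).domRestrict fun s : ℝ => σ (y - s • θ)) with hS
  have hScont : Continuous S := (continuousOn_sigma_ray hadm hτ hray).domRestrict.Icc_extend'
  have hSeq : ∀ s ∈ Icc 0 τ, S s = σ (y - s • θ) := fun s hs => by
    rw [hS, IccExtend_of_mem _ _ hs]; rfl
  have key := variation_of_constants (T := τ) (g := S) (w := fun _ => 1) hScont (by simp) hτ.le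
    (fun t _ => by simp)
  have hat : ∀ s ∈ Icc 0 τ, Real.exp (-∫ r in (0 : ℝ)..s, S r) = atten σ y θ s := by
    intro s hs
    rw [atten]
    congr 2
    refine intervalIntegral.integral_congr fun r hr => ?_
    rw [uIcc_of_le hs.1] at hr
    exact hSeq r ⟨hr.1, hr.2.trans hs.2⟩
  rw [hat τ ⟨hτ.le, le_rfl⟩, mul_one] at key
  have h2 : ∫ s in (0 : ℝ)..τ, Real.exp (-∫ r in (0 : ℝ)..s, S r) * S s =
      ∫ s in (0 : ℝ)..τ, atten σ y θ s * σ (y - s • θ) := by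
    refine intervalIntegral.integral_congr fun s hs => ?_
    rw [uIcc_of_le hτ.le] at hs
    simp only [hat s hs, hSeq s hs]
  rw [← h2]
  linarith

/-- The scattering operator applied to a function bounded by `W + m`. -/
lemma TransportSetting.abs_scatter_le (h : TransportSetting Ω σ k D M B) {z : Rn n} (hz : z ∈ Ω)
    (θ : Sph n) {W : Sph n → ℝ} (hW : BddMeas W) (hW0 : ∀ θ, 0 ≤ W θ) {m : ℝ} (hm : 0 ≤ m)
    (hu : ∀ᵐ θ' ∂surfaceMeasure n, |u z θ'| ≤ W θ' + m) :
    |scatter k u z θ| ≤ M * ∫ θ', W θ' ∂surfaceMeasure n + m * σ z := by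
  obtain ⟨K, hK, hKk⟩ := h.admissible.exists_bddMeas_kernel h.domain.isOpen
  have hk : BddMeas fun θ' => k z θ θ' := by
    have := hK.comp (f := fun θ' : Sph n => (z, θ, θ')) (by fun_prop)
    simpa only [hKk z hz] using this
  have h1 : |scatter k u z θ| ≤ ∫ θ', (M * W θ' + m * k z θ θ') ∂surfaceMeasure n := by
    rw [← Real.norm_eq_abs, scatter]
    refine norm_integral_le_of_norm_le (((hW.const_mul M).add (hk.const_mul m)).integrable _) ?_
    filter_upwards [hu] with θ' hθ'
    have hkp := h.admissible.k_pos z hz θ θ'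
    rw [Real.norm_eq_abs, abs_mul, abs_of_pos hkp]
    calc k z θ θ' * |u z θ'| ≤ k z θ θ' * (W θ' + m) := mul_le_mul_of_nonneg_left hθ' hkp.le
      _ = k z θ θ' * W θ' + m * k z θ θ' := by ring
      _ ≤ M * W θ' + m * k z θ θ' := by
        have := mul_le_mul_of_nonneg_right (h.k_le z hz θ θ') (hW0 θ')
        linarith
  refine h1.trans ?_
  rw [integral_add ((hW.const_mul M).integrable _) ((hk.const_mul m).integrable _),
    integral_const_mul, integral_const_mul]
  have h2 : ∫ θ', k z θ θ' ∂surfaceMeasure n ≤ σ z := by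
    -- The hypothesis bounds the integral of `k` over its first direction, while scattering
    -- integrates over the second; symmetry exchanges them.
    simp only [h.admissible.k_symm z hz θ]
    exact h.admissible.nongeneration z hz θ
  have := mul_le_mul_of_nonneg_left h2 hm
  linarith

/-- Bound of the scattered part of a solution along a characteristic. -/
lemma TransportSetting.abs_sub_ballistic_le (h : TransportSetting Ω σ k D M B)
    (hu : IsRTESolution Ω σ k f u) {G : Rn n → ℝ} (hG : BddMeas G) (hG0 : ∀ z, 0 ≤ G z)
    {c m : ℝ} (hc : 0 ≤ c) (hm : 0 ≤ m)
    (hscat : ∀ z ∈ Ω, ∀ θ, |scatter k u z θ| ≤ G z + c + m * σ z)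
    {y : Rn n} {θ : Sph n} {τ : ℝ} (hτ : 0 < τ) (hτD : τ ≤ D)
    (hray : ∀ s ∈ Ioo 0 τ, y - s • (θ : Rn n) ∈ Ω) (hy : y ∈ Ω ∨ (y, θ) ∈ outflow Ω)
    (hp : (y - τ • (θ : Rn n), θ) ∈ inflow Ω) :
    |u y θ - atten σ y θ τ * f (y - τ • (θ : Rn n)) θ| ≤
      lineInt D G y θ + D * c + m * (1 - Real.exp (-(B * D))) := by
  have hadm := h.admissible
  rw [hu.duhamel h.domain.isOpen hadm hτ hray hy hp, add_sub_cancel_left]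
  have hi1 : IntervalIntegrable (fun s : ℝ => G (y - s • (θ : Rn n))) volume 0 τ := by
    rw [intervalIntegrable_iff_integrableOn_Ioc_of_le hτ.le]
    exact (hG.comp (by fun_prop)).integrable _
  have hi2 : IntervalIntegrable (fun s : ℝ => atten σ y θ s * σ (y - s • (θ : Rn n)))
      volume 0 τ := by
    refine ContinuousOn.intervalIntegrable ?_
    rw [uIcc_of_le hτ.le]
    exact (continuousOn_atten hadm hτ hray).mul (continuousOn_sigma_ray hadm hτ hray)
  have hi3 : IntervalIntegrable (fun _ : ℝ => c) volume 0 τ := by simp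
  have h1 : |∫ s in (0 : ℝ)..τ, atten σ y θ s * scatter k u (y - s • (θ : Rn n)) θ| ≤
      ∫ s in (0 : ℝ)..τ, ((G (y - s • (θ : Rn n)) + c) +
        m * (atten σ y θ s * σ (y - s • (θ : Rn n)))) := by
    rw [← Real.norm_eq_abs]
    refine intervalIntegral.norm_integral_le_of_norm_le hτ.le ?_
      ((hi1.add hi3).add (hi2.const_mul m))
    have hne : ∀ᵐ s : ℝ, s ≠ τ := by simp [ae_iff]
    filter_upwards [hne] with s hsτ hs
    have hz := hray s ⟨hs.1, hs.2.lt_of_ne hsτ⟩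
    have ha1 := h.atten_le_one hτ hray (s := s) ⟨hs.1.le, hs.2⟩
    have ha0 := atten_pos σ y θ s
    rw [Real.norm_eq_abs, abs_mul, abs_of_pos ha0]
    have h2 := mul_le_mul_of_nonneg_left (hscat _ hz θ) ha0.le
    have h3 := mul_le_mul_of_nonneg_right ha1 (add_nonneg (hG0 (y - s • (θ : Rn n))) hc)
    nlinarith
  refine h1.trans ?_
  rw [intervalIntegral.integral_add (hi1.add hi3) (hi2.const_mul m),
    intervalIntegral.integral_add hi1 hi3, intervalIntegral.integral_const,
    intervalIntegral.integral_const_mul, integral_atten_mul_sigma hadm hτ hray, sub_zero,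
    smul_eq_mul]
  have h4 : ∫ s in (0 : ℝ)..τ, G (y - s • (θ : Rn n)) ≤ lineInt D G y θ := by
    rw [intervalIntegral.integral_of_le hτ.le, lineInt]
    exact setIntegral_mono_set (integrable_line D hG y θ) (Eventually.of_forall fun s => hG0 _)
      (Ioc_subset_Ioc_right hτD).eventuallyLE
  have h5 := mul_le_mul_of_nonneg_right hτD hc
  have h6 := mul_le_mul_of_nonneg_left (h.le_atten hτ hτD hray) hm
  nlinarith

lemma TransportSetting.ae_transversal (h : TransportSetting Ω σ k D M B) (hn : 1 ≤ n) {z : Rn n}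
    (hz : z ∈ Ω) :
    ∀ᵐ θ : Sph n ∂surfaceMeasure n, ⟪outwardNormal Ω (entryPoint Ω z θ), (θ : Rn n)⟫ ≠ 0 :=
  ae_entryPoint_transversal hn h.domain h.dist_le hz

/-- Hypotheses making `F(y, θ) + ∫ G` a supersolution up to an error controlled by `c`. -/
structure TransportSetting.IsSuper (_ : TransportSetting Ω σ k D M B) (f : Rn n → Sph n → ℝ)
    (F : Rn n × Sph n → ℝ) (G : Rn n → ℝ) (c : ℝ) : Prop where
  bddF : BddMeas F
  bddG : BddMeas G
  F_nonneg : ∀ q, 0 ≤ F q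
  G_nonneg : ∀ z, 0 ≤ G z
  c_nonneg : 0 ≤ c
  data_le : ∀ y ∈ Ω, ∀ θ : Sph n, |f (entryPoint Ω y θ) θ| ≤ F (y, θ)
  scatter_le : ∀ z ∈ Ω,
    M * ∫ θ : Sph n, (F (z, θ) + lineInt D G z θ) ∂surfaceMeasure n ≤ G z + c

variable {F : Rn n × Sph n → ℝ} {G : Rn n → ℝ} {c : ℝ}

/-- The bound on `u` is available only in transversal directions. That is enough inside the angular
integral, because the other directions form a null set. -/
lemma TransportSetting.IsSuper.scatter_bound {h : TransportSetting Ω σ k D M B}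
    (hs : h.IsSuper f F G c) (hn : 1 ≤ n) {m : ℝ} (hm : 0 ≤ m)
    (hP : ∀ y ∈ Ω, ∀ θ : Sph n, ⟪outwardNormal Ω (entryPoint Ω y θ), (θ : Rn n)⟫ ≠ 0 →
      |u y θ| ≤ F (y, θ) + lineInt D G y θ + m) :
    ∀ z ∈ Ω, ∀ θ, |scatter k u z θ| ≤ G z + c + m * σ z := by
  intro z hz θ
  have hF : BddMeas fun θ : Sph n => F (z, θ) := hs.bddF.comp (by fun_prop)
  refine (h.abs_scatter_le hz θ (hF.add (bddMeas_lineInt_left D hs.bddG z))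
    (fun θ' => add_nonneg (hs.F_nonneg _) (lineInt_nonneg hs.G_nonneg _ _)) hm ?_).trans
    (add_le_add_left (hs.scatter_le z hz) _)
  filter_upwards [h.ae_transversal hn hz] with θ' hθ'
  exact hP z hz θ' hθ'

/-- Comparison principle. -/
lemma TransportSetting.IsSuper.abs_le {h : TransportSetting Ω σ k D M B}
    (hs : h.IsSuper f F G c) (hn : 1 ≤ n) (hu : IsRTESolution Ω σ k f u) :
    ∀ y ∈ Ω, ∀ θ : Sph n, ⟪outwardNormal Ω (entryPoint Ω y θ), (θ : Rn n)⟫ ≠ 0 →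
      |u y θ| ≤ F (y, θ) + lineInt D G y θ + D * c / Real.exp (-(B * D)) := by
  set κ := Real.exp (-(B * D)) with hκ
  have hκ0 : 0 < κ := Real.exp_pos _
  have hκ1 : κ ≤ 1 := by
    rw [hκ, Real.exp_le_one_iff, neg_nonpos]
    exact mul_nonneg h.B_nonneg h.D_nonneg
  obtain ⟨C, hC⟩ := hu.bounded
  have hm0 : 0 ≤ D * c / κ := div_nonneg (mul_nonneg h.D_nonneg hs.c_nonneg) hκ0.le
  -- The induction starts from the crude bound `|C|`. Each pass through Duhamel's formula replaces
  -- the additive constant `m` by `D * c + (1 - κ) * m`, whose fixed point is `D * c / κ`.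
  have key : ∀ j : ℕ, ∀ y ∈ Ω, ∀ θ : Sph n,
      ⟪outwardNormal Ω (entryPoint Ω y θ), (θ : Rn n)⟫ ≠ 0 →
      |u y θ| ≤ F (y, θ) + lineInt D G y θ + (D * c / κ + (1 - κ) ^ j * |C|) := by
    intro j
    induction j with
    | zero =>
      intro y hy θ _
      have h1 := hC y hy θ
      have h2 := hs.F_nonneg (y, θ)
      have h3 := lineInt_nonneg (D := D) hs.G_nonneg y θ
      have h4 := le_abs_self C
      rw [pow_zero, one_mul]
      linarith
    | succ j ih =>
      intro y hy θ hθ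
      have hmj : 0 ≤ D * c / κ + (1 - κ) ^ j * |C| := by
        have : 0 ≤ 1 - κ := by linarith
        positivity
      have hθ1 := norm_eq_of_mem_sphere θ
      have hτ := backExit_pos h.domain.isOpen h.dist_le hθ1 hy
      have h1 := h.abs_sub_ballistic_le hu hs.bddG hs.G_nonneg hs.c_nonneg hmj
        (hs.scatter_bound hn hmj ih) hτ (backExit_le h.dist_le hθ1 h.D_nonneg)
        (fun s hs => mem_of_lt_backExit hs.1.le hs.2) (Or.inl hy)
        (entryPoint_mem_inflow h.domain h.dist_le hy hθ)
      have h2 : |atten σ y θ (backExit Ω y θ) * f (y - backExit Ω y θ • (θ : Rn n)) θ| ≤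
          F (y, θ) := by
        rw [abs_mul, abs_of_pos (atten_pos _ _ _ _)]
        have h3 := h.atten_le_one hτ (fun s hs => mem_of_lt_backExit hs.1.le hs.2)
          (s := backExit Ω y θ) ⟨hτ.le, le_rfl⟩
        exact (mul_le_of_le_one_left (abs_nonneg _) h3).trans (hs.data_le y hy θ)
      have h4 := abs_sub_abs_le_abs_sub (u y θ)
        (atten σ y θ (backExit Ω y θ) * f (y - backExit Ω y θ • (θ : Rn n)) θ)
      have h5 : D * c + (D * c / κ + (1 - κ) ^ j * |C|) * (1 - κ) =
          D * c / κ + (1 - κ) ^ (j + 1) * |C| := by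
        field_simp
        ring
      linarith
  intro y hy θ hθ
  have hlim : Tendsto (fun j : ℕ => F (y, θ) + lineInt D G y θ + (D * c / κ + (1 - κ) ^ j * |C|))
      atTop (𝓝 (F (y, θ) + lineInt D G y θ + (D * c / κ + 0 * |C|))) :=
    ((((tendsto_pow_atTop_nhds_zero_of_lt_one (by linarith) (by linarith)).mul_const _).const_add
      _).const_add _)
  rw [zero_mul, add_zero] at hlim
  exact ge_of_tendsto' hlim fun j => key j y hy θ hθ

/-- The scattered part of a solution is bounded by the scattered part of a supersolution. -/
lemma TransportSetting.IsSuper.abs_sub_ballistic_le {h : TransportSetting Ω σ k D M B}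
    (hs : h.IsSuper f F G c) (hn : 1 ≤ n) (hu : IsRTESolution Ω σ k f u)
    {y : Rn n} {θ : Sph n} {τ : ℝ} (hτ : 0 < τ) (hτD : τ ≤ D)
    (hray : ∀ s ∈ Ioo 0 τ, y - s • (θ : Rn n) ∈ Ω) (hy : y ∈ Ω ∨ (y, θ) ∈ outflow Ω)
    (hp : (y - τ • (θ : Rn n), θ) ∈ inflow Ω) :
    |u y θ - atten σ y θ τ * f (y - τ • (θ : Rn n)) θ| ≤
      lineInt D G y θ + D * c / Real.exp (-(B * D)) := by
  have hκ0 : 0 < Real.exp (-(B * D)) := Real.exp_pos _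
  have hm0 : 0 ≤ D * c / Real.exp (-(B * D)) :=
    div_nonneg (mul_nonneg h.D_nonneg hs.c_nonneg) hκ0.le
  refine (h.abs_sub_ballistic_le hu hs.bddG hs.G_nonneg hs.c_nonneg hm0
    (hs.scatter_bound hn hm0 (hs.abs_le hn hu)) hτ hτD hray hy hp).trans (le_of_eq ?_)
  field_simp
  ring

end Bounds

/-! ### The unscattered part and the reduction to single scattering. -/

section Ballistic

variable {n : ℕ} {Ω : Set (Rn n)} {σ : Rn n → ℝ} {k : Rn n → Sph n → Sph n → ℝ}
  {f u : Rn n → Sph n → ℝ} {D M B : ℝ} {F : Rn n × Sph n → ℝ} {G : Rn n → ℝ} {c : ℝ}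

/-- The unscattered part of a solution with boundary data `f`. -/
def ballistic (Ω : Set (Rn n)) (σ : Rn n → ℝ) (f : Rn n → Sph n → ℝ) (y : Rn n) (θ : Sph n) : ℝ :=
  atten σ y θ (backExit Ω y θ) * f (entryPoint Ω y θ) θ

/-- The optical depth of the boundary, for an absorption coefficient defined everywhere. -/
def depth (Ω : Set (Rn n)) (D : ℝ) (s : Rn n → ℝ) (q : Rn n × Sph n) : ℝ :=
  ∫ r in Ioc 0 D, {w : (Rn n × Sph n) × ℝ | w.2 ≤ backExit Ω w.1.1 w.1.2}.indicator
    (fun _ => (1 : ℝ)) (q, r) * s (q.1 - r • (q.2 : Rn n))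

/-- Integrating over a fixed interval with an indicator, rather than up to the exit time, makes
joint measurability in position and direction a case of Fubini. -/
lemma TransportSetting.bddMeas_depth (h : TransportSetting Ω σ k D M B) {s : Rn n → ℝ}
    (hs : BddMeas s) : BddMeas (depth Ω D s) := by
  have hm : MeasurableSet {w : (Rn n × Sph n) × ℝ | w.2 ≤ backExit Ω w.1.1 w.1.2} :=
    measurableSet_le measurable_snd
      ((measurable_backExit h.domain.isOpen h.dist_le).comp measurable_fst)
  exact BddMeas.integral (f := fun w : (Rn n × Sph n) × ℝ =>
    {w : (Rn n × Sph n) × ℝ | w.2 ≤ backExit Ω w.1.1 w.1.2}.indicator (fun _ => (1 : ℝ)) w *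
      s (w.1.1 - w.2 • (w.1.2 : Rn n)))
    ((BddMeas.indicator_one hm).mul (hs.comp (by fun_prop))) _

lemma depth_nonneg {s : Rn n → ℝ} (hs : ∀ y, 0 ≤ s y) (q : Rn n × Sph n) :
    0 ≤ depth Ω D s q :=
  integral_nonneg fun _ => mul_nonneg (indicator_nonneg (fun _ _ => zero_le_one) _) (hs _)

lemma TransportSetting.exp_neg_depth (h : TransportSetting Ω σ k D M B) {s : Rn n → ℝ}
    (hsσ : ∀ y ∈ closure Ω, s y = σ y) {y : Rn n} (hy : y ∈ Ω) (θ : Sph n) :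
    Real.exp (-depth Ω D s (y, θ)) = atten σ y θ (backExit Ω y θ) := by
  have hθ1 := norm_eq_of_mem_sphere θ
  have hτ := backExit_pos h.domain.isOpen h.dist_le hθ1 hy
  have hτD := backExit_le (y := y) h.dist_le hθ1 h.D_nonneg
  rw [atten, depth]
  congr 2
  rw [intervalIntegral.integral_of_le hτ.le]
  have h1 : (fun r : ℝ => {w : (Rn n × Sph n) × ℝ | w.2 ≤ backExit Ω w.1.1 w.1.2}.indicator
      (fun _ => (1 : ℝ)) ((y, θ), r) * s (y - r • (θ : Rn n))) =
      (Iic (backExit Ω y θ)).indicator fun r => s (y - r • (θ : Rn n)) := by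
    ext r
    by_cases hr : r ≤ backExit Ω y θ
    · rw [indicator_of_mem (by exact hr), indicator_of_mem (by exact hr), one_mul]
    · rw [indicator_of_notMem (by exact hr), indicator_of_notMem (by exact hr), zero_mul]
  rw [h1, setIntegral_indicator measurableSet_Iic, Ioc_inter_Iic, min_eq_right hτD]
  refine setIntegral_congr_fun measurableSet_Ioc fun r hr => ?_
  exact hsσ _ (mem_closure_of_ray hτ (fun s hs => mem_of_lt_backExit hs.1.le hs.2)
    ⟨hr.1.le, hr.2⟩)

/-- The ballistic part agrees in `Ω` with a bounded measurable function. -/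
lemma TransportSetting.bddMeas_ballistic (h : TransportSetting Ω σ k D M B) {s : Rn n → ℝ}
    (hs : BddMeas s) (hs0 : ∀ y, 0 ≤ s y) (hf : BddMeas fun q : Rn n × Sph n => f q.1 q.2) :
    BddMeas fun q : Rn n × Sph n =>
      Real.exp (-depth Ω D s q) * f (entryPoint Ω q.1 q.2) q.2 := by
  have h1 : BddMeas fun q : Rn n × Sph n => Real.exp (-depth Ω D s q) := by
    refine ⟨Real.measurable_exp.comp (h.bddMeas_depth hs).1.neg, 1, fun q => ?_⟩
    rw [abs_of_pos (Real.exp_pos _), Real.exp_le_one_iff, neg_nonpos]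
    exact depth_nonneg hs0 q
  exact h1.mul (hf.comp (f := fun q : Rn n × Sph n => (entryPoint Ω q.1 q.2, q.2))
    ((measurable_entryPoint h.domain.isOpen h.dist_le).prodMk measurable_snd))

lemma TransportSetting.exists_bddMeas_ballistic (h : TransportSetting Ω σ k D M B)
    (hf : BddMeas fun q : Rn n × Sph n => f q.1 q.2) :
    ∃ v : Rn n × Sph n → ℝ, BddMeas v ∧ ∀ y ∈ Ω, ∀ θ, v (y, θ) = ballistic Ω σ f y θ := by
  obtain ⟨s, hs, hs0, hsσ⟩ := h.admissible.exists_bddMeas_sigma h.domain.isBounded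
  refine ⟨_, h.bddMeas_ballistic hs hs0 hf, fun y hy θ => ?_⟩
  simp only [ballistic, h.exp_neg_depth hsσ hy θ]

/-- Only single scattering has to be taken into account, up to multiple scattering of a
supersolution. -/
lemma TransportSetting.IsSuper.abs_sub_single_le {h : TransportSetting Ω σ k D M B}
    (hs : h.IsSuper f F G c) (hn : 1 ≤ n) (hu : IsRTESolution Ω σ k f u)
    (hf : BddMeas fun q : Rn n × Sph n => f q.1 q.2)
    {y : Rn n} {θ : Sph n} {τ : ℝ} (hτ : 0 < τ) (hτD : τ ≤ D)
    (hray : ∀ s ∈ Ioo 0 τ, y - s • (θ : Rn n) ∈ Ω) (hy : y ∈ Ω ∨ (y, θ) ∈ outflow Ω)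
    (hp : (y - τ • (θ : Rn n), θ) ∈ inflow Ω) :
    |u y θ - atten σ y θ τ * f (y - τ • (θ : Rn n)) θ -
      ∫ s in (0 : ℝ)..τ, atten σ y θ s * scatter k (ballistic Ω σ f) (y - s • (θ : Rn n)) θ| ≤
      M * (lineInt D (sphLineInt D G) y θ +
        D * ((surfaceMeasure n).real univ * (D * c / Real.exp (-(B * D))))) := by
  have hadm := h.admissible
  have hΩ := h.domain.isOpen
  obtain ⟨K, hK, hKk⟩ := hadm.exists_bddMeas_kernel hΩ
  obtain ⟨v, hv, hvu⟩ := hu.exists_bddMeas hΩ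
  obtain ⟨g, hg, hgs⟩ := IsRTESolution.exists_bddMeas_scatter hΩ hadm hv hvu
  obtain ⟨v', hv', hvu'⟩ := h.exists_bddMeas_ballistic hf
  obtain ⟨g', hg', hgs'⟩ := IsRTESolution.exists_bddMeas_scatter hΩ hadm hv' hvu'
  set c' := D * c / Real.exp (-(B * D)) with hc'
  have hc'0 : 0 ≤ c' := div_nonneg (mul_nonneg h.D_nonneg hs.c_nonneg) (Real.exp_pos _).le
  have hdiff : ∀ z ∈ Ω, |scatter k u z θ - scatter k (ballistic Ω σ f) z θ| ≤
      M * (sphLineInt D G z + (surfaceMeasure n).real univ * c') := by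
    intro z hz
    have hkb : BddMeas fun θ' => k z θ θ' := by
      have := hK.comp (f := fun θ' : Sph n => (z, θ, θ')) (by fun_prop)
      simpa only [hKk z hz] using this
    have hub : BddMeas fun θ' => u z θ' := by
      have := hv.comp (f := fun θ' : Sph n => (z, θ')) (by fun_prop)
      simpa only [hvu z hz] using this
    have hbb : BddMeas fun θ' => ballistic Ω σ f z θ' := by
      have := hv'.comp (f := fun θ' : Sph n => (z, θ')) (by fun_prop)
      simpa only [hvu' z hz] using this
    have hlb := bddMeas_lineInt_left D hs.bddG z
    have hcb : BddMeas fun _ : Sph n => c' := BddMeas.const c'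
    have e1 : scatter k u z θ - scatter k (ballistic Ω σ f) z θ =
        ∫ θ', (k z θ θ' * u z θ' - k z θ θ' * ballistic Ω σ f z θ') ∂surfaceMeasure n :=
      (integral_sub ((hkb.mul hub).integrable _) ((hkb.mul hbb).integrable _)).symm
    have e2 : M * (sphLineInt D G z + (surfaceMeasure n).real univ * c') =
        ∫ θ' : Sph n, M * (lineInt D G z θ' + c') ∂surfaceMeasure n := by
      rw [integral_const_mul, integral_add (hlb.integrable _) (hcb.integrable _), integral_const,
        smul_eq_mul]
      rfl
    rw [e1, e2, ← Real.norm_eq_abs]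
    refine norm_integral_le_of_norm_le (((hlb.add hcb).const_mul M).integrable _) ?_
    filter_upwards [h.ae_transversal hn hz] with θ' hθ'
    have hθ1 := norm_eq_of_mem_sphere θ'
    have h1 := hs.abs_sub_ballistic_le hn hu (backExit_pos hΩ h.dist_le hθ1 hz)
      (backExit_le h.dist_le hθ1 h.D_nonneg)
      (fun s hs => mem_of_lt_backExit hs.1.le hs.2) (Or.inl hz)
      (entryPoint_mem_inflow h.domain h.dist_le hz hθ')
    rw [← mul_sub, Real.norm_eq_abs, abs_mul, abs_of_pos (hadm.k_pos z hz θ θ')]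
    exact mul_le_mul (h.k_le z hz θ θ') h1 (abs_nonneg _) h.M_nonneg
  have hint : ∀ {w : Rn n → Sph n → ℝ} {g : Rn n × Sph n → ℝ}, BddMeas g →
      (∀ y ∈ Ω, ∀ θ, g (y, θ) = scatter k w y θ) → IntervalIntegrable
        (fun s : ℝ => atten σ y θ s * scatter k w (y - s • (θ : Rn n)) θ) volume 0 τ := by
    intro w g hg hgw
    have h1 : IntervalIntegrable (fun s : ℝ => g (y - s • (θ : Rn n), θ)) volume 0 τ := by
      rw [intervalIntegrable_iff_integrableOn_Ioc_of_le hτ.le]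
      exact (hg.comp (f := fun s : ℝ => (y - s • (θ : Rn n), θ)) (by fun_prop)).integrable _
    have h2 := h1.continuousOn_mul
      (by rw [uIcc_of_le hτ.le]; exact continuousOn_atten hadm hτ hray)
    refine h2.congr_ae ?_
    rw [EventuallyEq, ae_restrict_iff' measurableSet_uIoc]
    have hne : ∀ᵐ s : ℝ, s ≠ τ := by simp [ae_iff]
    filter_upwards [hne] with s hsτ hs
    rw [uIoc_of_le hτ.le] at hs
    rw [hgw _ (hray s ⟨hs.1, hs.2.lt_of_ne hsτ⟩)]
  have hi1 := hint hg hgs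
  have hi2 := hint hg' hgs'
  have hGb := bddMeas_sphLineInt D hs.bddG
  rw [hu.duhamel hΩ hadm hτ hray hy hp, add_sub_cancel_left,
    ← intervalIntegral.integral_sub hi1 hi2, ← Real.norm_eq_abs]
  have hb : BddMeas fun z => M * (sphLineInt D G z + (surfaceMeasure n).real univ * c') :=
    (hGb.add (BddMeas.const _)).const_mul M
  have hb0 : ∀ z, 0 ≤ M * (sphLineInt D G z + (surfaceMeasure n).real univ * c') := fun z =>
    mul_nonneg h.M_nonneg (add_nonneg (sphLineInt_nonneg hs.G_nonneg z)
      (mul_nonneg measureReal_nonneg hc'0))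
  have hi3 : IntervalIntegrable (fun s : ℝ => M * (sphLineInt D G (y - s • (θ : Rn n)) +
      (surfaceMeasure n).real univ * c')) volume 0 τ := by
    rw [intervalIntegrable_iff_integrableOn_Ioc_of_le hτ.le]
    exact (hb.comp (f := fun s : ℝ => y - s • (θ : Rn n)) (by fun_prop)).integrable _
  have e3 : M * (lineInt D (sphLineInt D G) y θ + D * ((surfaceMeasure n).real univ * c')) =
      lineInt D (fun z => M * (sphLineInt D G z + (surfaceMeasure n).real univ * c')) y θ := by
    rw [lineInt_const_mul, lineInt_add hGb (BddMeas.const _), lineInt_const h.D_nonneg]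
  rw [e3]
  have h4 : ∫ s in (0 : ℝ)..τ, M * (sphLineInt D G (y - s • (θ : Rn n)) +
      (surfaceMeasure n).real univ * c') ≤
      lineInt D (fun z => M * (sphLineInt D G z + (surfaceMeasure n).real univ * c')) y θ := by
    rw [intervalIntegral.integral_of_le hτ.le, lineInt]
    exact setIntegral_mono_set (integrable_line D hb y θ) (Eventually.of_forall fun s => hb0 _)
      (Ioc_subset_Ioc_right hτD).eventuallyLE
  refine (intervalIntegral.norm_integral_le_of_norm_le hτ.le ?_ hi3).trans h4
  have hne : ∀ᵐ s : ℝ, s ≠ τ := by simp [ae_iff]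
  filter_upwards [hne] with s hsτ hs
  have hz := hray s ⟨hs.1, hs.2.lt_of_ne hsτ⟩
  rw [← mul_sub, Real.norm_eq_abs, abs_mul, abs_of_pos (atten_pos _ _ _ _)]
  exact (mul_le_of_le_one_left (abs_nonneg _)
    (h.atten_le_one hτ hray ⟨hs.1.le, hs.2⟩)).trans (hdiff _ hz)

end Ballistic

/-! ### Focused sources: bounds on the scattered part. -/

section Source

variable {n : ℕ} {Ω : Set (Rn n)} {σ : Rn n → ℝ} {k : Rn n → Sph n → Sph n → ℝ}
  {u : Rn n → Sph n → ℝ} {D M B : ℝ} {ψ : Rn n → ℝ}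

lemma IsProfile.exists_radius (hψ : IsProfile ψ) : ∃ ρ : ℝ, 0 < ρ ∧ ∀ v, ψ v ≠ 0 → ‖v‖ ≤ ρ := by
  obtain ⟨ρ, hρ, h⟩ := hψ.compactSupport.isBounded.exists_pos_norm_le
  exact ⟨ρ, hρ, fun v hv => h v (subset_tsupport _ hv)⟩

lemma IsProfile.continuous (hψ : IsProfile ψ) : Continuous ψ := hψ.smooth.continuous

lemma bddMeas_source (hψ : IsProfile ψ) (a : Rn n) (ζ : Sph n) (ε : ℝ) :
    BddMeas fun q : Rn n × Sph n => source ψ a ζ ε q.1 q.2 := by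
  have hc := hψ.continuous
  have h1 : BddMeas ψ := ⟨hc.measurable, 1, fun v => by
    rw [abs_of_nonneg (hψ.nonneg v)]; exact hψ.le_one v⟩
  exact (h1.comp (f := fun q : Rn n × Sph n => ε⁻¹ • (q.1 - a)) (by fun_prop)).mul
    (h1.comp (f := fun q : Rn n × Sph n => ε⁻¹ • ((q.2 : Rn n) - ζ)) (by fun_prop))

lemma source_nonneg (hψ : IsProfile ψ) (a : Rn n) (ζ : Sph n) (ε : ℝ) (y : Rn n) (θ : Sph n) :
    0 ≤ source ψ a ζ ε y θ := mul_nonneg (hψ.nonneg _) (hψ.nonneg _)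

lemma source_le_one (hψ : IsProfile ψ) (a : Rn n) (ζ : Sph n) (ε : ℝ) (y : Rn n) (θ : Sph n) :
    source ψ a ζ ε y θ ≤ 1 := mul_le_one₀ (hψ.le_one _) (hψ.nonneg _) (hψ.le_one _)

lemma norm_le_of_source_ne_zero {ρ ε : ℝ} (hρ : ∀ v, ψ v ≠ 0 → ‖v‖ ≤ ρ) (hε : 0 < ε) {a : Rn n}
    {ζ : Sph n} {y : Rn n} {θ : Sph n} (h : source ψ a ζ ε y θ ≠ 0) :
    ‖y - a‖ ≤ ρ * ε ∧ ‖(θ : Rn n) - ζ‖ ≤ ρ * ε := by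
  have h1 := hρ _ (left_ne_zero_of_mul h)
  have h2 := hρ _ (right_ne_zero_of_mul h)
  rw [norm_smul, norm_inv, Real.norm_eq_abs, abs_of_pos hε, inv_mul_le_iff₀ hε] at h1 h2
  constructor <;> linarith

/-- Rays from the support of the source stay in a tube. -/
lemma norm_perp_le_of_source_ne_zero {ρ ε : ℝ} (hρ : ∀ v, ψ v ≠ 0 → ‖v‖ ≤ ρ) (hε : 0 < ε)
    {x : Rn n} {ζ : Sph n} {t : ℝ} {y : Rn n} {θ : Sph n} {τ : ℝ} (hτ : 0 ≤ τ) (hτD : τ ≤ D)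
    (h : source ψ (x - t • (ζ : Rn n)) ζ ε (y - τ • (θ : Rn n)) θ ≠ 0) :
    ‖perp (ζ : Rn n) (y - x)‖ ≤ ρ * (1 + D) * ε := by
  obtain ⟨h1, h2⟩ := norm_le_of_source_ne_zero hρ hε h
  have hζ := norm_eq_of_mem_sphere ζ
  have e1 : perp (ζ : Rn n) (y - x) = perp (ζ : Rn n)
      ((y - τ • (θ : Rn n) - (x - t • (ζ : Rn n))) + τ • ((θ : Rn n) - ζ)) := by
    have : y - x = ((y - τ • (θ : Rn n) - (x - t • (ζ : Rn n))) + τ • ((θ : Rn n) - ζ)) +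
      (τ - t) • (ζ : Rn n) := by module
    rw [this, perp_add, perp_smul, perp_self hζ, smul_zero, add_zero]
  rw [e1]
  refine (norm_perp_le hζ _).trans ((norm_add_le _ _).trans ?_)
  rw [norm_smul, Real.norm_eq_abs, abs_of_nonneg hτ]
  have h3 : τ * ‖(θ : Rn n) - ζ‖ ≤ D * (ρ * ε) :=
    mul_le_mul hτD h2 (norm_nonneg _) (hτ.trans hτD)
  nlinarith

lemma measurableSet_cap (ζ : Sph n) (r : ℝ) : MeasurableSet {θ : Sph n | ‖(θ : Rn n) - ζ‖ ≤ r} :=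
  measurableSet_le (Continuous.measurable (by fun_prop)) measurable_const

/-- `F` is the indicator of a set of positions and directions that contains the beam. In `G` the
term `M A χ` bounds what the beam scatters once, and `M² A` times the ray average of `χ` what is
scattered twice. The next order, `M³ A` times the second ray average, goes into the error, where it
is later `o(εⁿ)`. -/
lemma TransportSetting.isSuper_source (h : TransportSetting Ω σ k D M B) (hψ : IsProfile ψ)
    {ρ ε A b : ℝ} (hρ : ∀ v, ψ v ≠ 0 → ‖v‖ ≤ ρ) (hε : 0 < ε) (x : Rn n) (ζ : Sph n) (t : ℝ)
    (hA : 0 ≤ A) (hcap : (surfaceMeasure n).real {θ : Sph n | ‖(θ : Rn n) - ζ‖ ≤ ρ * ε} ≤ A)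
    (hb : ∀ z, sphLineInt D (sphLineInt D (tubeInd (ζ : Rn n) x (ρ * (1 + D) * ε))) z ≤ b) :
    h.IsSuper (source ψ (x - t • (ζ : Rn n)) ζ ε)
      (fun q => tubeInd (ζ : Rn n) x (ρ * (1 + D) * ε) q.1 *
        {θ : Sph n | ‖(θ : Rn n) - ζ‖ ≤ ρ * ε}.indicator (fun _ => 1) q.2)
      (fun z => M * A * (tubeInd (ζ : Rn n) x (ρ * (1 + D) * ε) z +
        M * sphLineInt D (tubeInd (ζ : Rn n) x (ρ * (1 + D) * ε)) z)) (M ^ 3 * A * b) := by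
  set R := ρ * (1 + D) * ε with hR
  set χ := tubeInd (ζ : Rn n) x R with hχ
  set cap : Sph n → ℝ := {θ : Sph n | ‖(θ : Rn n) - ζ‖ ≤ ρ * ε}.indicator (fun _ => 1) with hcapdef
  have hχb : BddMeas χ := bddMeas_tubeInd _ _ _
  have hχ0 : ∀ z, 0 ≤ χ z := tubeInd_nonneg R
  have hcb : BddMeas cap := BddMeas.indicator_one (measurableSet_cap ζ _)
  have hc0 : ∀ θ, 0 ≤ cap θ := indicator_nonneg fun _ _ => zero_le_one
  have hLb : BddMeas (sphLineInt D χ) := bddMeas_sphLineInt D hχb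
  have hL0 : ∀ z, 0 ≤ sphLineInt D χ z := sphLineInt_nonneg hχ0
  have hM := h.M_nonneg
  have hGb : BddMeas fun z => M * A * (χ z + M * sphLineInt D χ z) :=
    (hχb.add (hLb.const_mul M)).const_mul (M * A)
  have hG0 : ∀ z, 0 ≤ M * A * (χ z + M * sphLineInt D χ z) := fun z => by
    have := hχ0 z
    have := hL0 z
    positivity
  have hb0 : 0 ≤ b := (sphLineInt_nonneg hL0 0).trans (hb 0)
  refine ⟨(hχb.comp measurable_fst).mul (hcb.comp measurable_snd), hGb,
    fun q => mul_nonneg (hχ0 _) (hc0 _), hG0, by positivity, fun y hy θ => ?_, fun z hz => ?_⟩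
  · by_cases h0 : source ψ (x - t • (ζ : Rn n)) ζ ε (entryPoint Ω y θ) θ = 0
    · rw [h0, abs_zero]; exact mul_nonneg (hχ0 _) (hc0 _)
    · have h1 := norm_perp_le_of_source_ne_zero hρ hε backExit_nonneg
        (backExit_le h.dist_le (norm_eq_of_mem_sphere θ) h.D_nonneg) h0
      have h2 := (norm_le_of_source_ne_zero hρ hε h0).2
      have e1 : χ y = 1 := tubeInd_of_le h1
      have e2 : cap θ = 1 :=
        indicator_of_mem (s := {θ : Sph n | ‖(θ : Rn n) - ζ‖ ≤ ρ * ε}) h2 _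
      simp only [e1, e2, mul_one]
      rw [abs_of_nonneg (source_nonneg hψ _ _ _ _ _)]
      exact source_le_one hψ _ _ _ _ _
  · have h1 : ∫ θ, cap θ ∂surfaceMeasure n ≤ A := by
      refine le_trans (le_of_eq ?_) hcap
      exact integral_indicator_one (measurableSet_cap ζ (ρ * ε))
    have e1 : ∫ θ : Sph n, (χ z * cap θ + lineInt D
        (fun z => M * A * (χ z + M * sphLineInt D χ z)) z θ) ∂surfaceMeasure n =
        χ z * ∫ θ, cap θ ∂surfaceMeasure n + M * A * (sphLineInt D χ z +
          M * sphLineInt D (sphLineInt D χ) z) := by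
      rw [integral_add ((hcb.const_mul _).integrable _)
        ((bddMeas_lineInt_left D hGb z).integrable _), integral_const_mul]
      congr 1
      have e2 := sphLineInt_const_mul (D := D) (g := fun z => χ z + M * sphLineInt D χ z) (M * A) z
      rw [sphLineInt_add hχb (hLb.const_mul M), sphLineInt_const_mul (g := sphLineInt D χ) M] at e2
      exact e2
    simp only [e1]
    have h2 := mul_le_mul_of_nonneg_left h1 (hχ0 z)
    have h3 := mul_le_mul_of_nonneg_left (hb z) (show 0 ≤ M ^ 3 * A by positivity)
    nlinarith [mul_le_mul_of_nonneg_left h2 hM]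

/-- Asymptotic estimates for the solution generated by a focused source, along a fixed
characteristic: the scattered part is small. -/
lemma TransportSetting.tendsto_ballistic (h : TransportSetting Ω σ k D M B) (hn : 3 ≤ n)
    (hψ : IsProfile ψ) (x : Rn n) (ζ : Sph n) (t : ℝ) {u : ℝ → Rn n → Sph n → ℝ}
    (hu : ∀ ε : ℝ, 0 < ε → IsRTESolution Ω σ k (source ψ (x - t • (ζ : Rn n)) ζ ε) (u ε))
    {y : Rn n} {θ : Sph n} {τ : ℝ} (hτ : 0 < τ) (hτD : τ ≤ D)
    (hray : ∀ s ∈ Ioo 0 τ, y - s • (θ : Rn n) ∈ Ω) (hy : y ∈ Ω ∨ (y, θ) ∈ outflow Ω)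
    (hp : (y - τ • (θ : Rn n), θ) ∈ inflow Ω) :
    Tendsto (fun ε : ℝ => u ε y θ - atten σ y θ τ *
      source ψ (x - t • (ζ : Rn n)) ζ ε (y - τ • (θ : Rn n)) θ) (𝓝[>] 0) (𝓝 0) := by
  obtain ⟨ρ, hρ0, hρ⟩ := hψ.exists_radius
  obtain ⟨C, hC, hcap⟩ := exists_surfaceMeasure_cap_le (by omega) ζ
  have hζ := norm_eq_of_mem_sphere ζ
  have hD := h.D_nonneg
  have hM := h.M_nonneg
  set S := (surfaceMeasure n).real univ with hS
  have hS0 : 0 ≤ S := measureReal_nonneg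
  have htube : ∀ R : ℝ, ∀ z, tubeInd (ζ : Rn n) x R z ≤ 1 := fun R z =>
    indicator_le_self' (f := fun _ => (1 : ℝ)) (fun _ _ => zero_le_one) z
  -- Crude bounds independent of `R` suffice here: the area `A` of the cap, of order `ε^(n-1)`,
  -- already tends to zero.
  have hb1 : ∀ R : ℝ, ∀ z, sphLineInt D (tubeInd (ζ : Rn n) x R) z ≤ S * (D * 1) := by
    intro R z
    rw [← sphLineInt_const hD]
    exact sphLineInt_mono (bddMeas_tubeInd _ _ _) (BddMeas.const _) (htube R) z
  have hb2 : ∀ R : ℝ, ∀ z, sphLineInt D (sphLineInt D (tubeInd (ζ : Rn n) x R)) z ≤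
      S * (D * (S * (D * 1))) := by
    intro R z
    rw [← sphLineInt_const hD]
    exact sphLineInt_mono (bddMeas_sphLineInt D (bddMeas_tubeInd _ _ _)) (BddMeas.const _) (hb1 R) z
  set L : ℝ := M * (D * (1 + M * (S * (D * 1)))) +
    D * (M ^ 3 * (S * (D * (S * (D * 1))))) / Real.exp (-(B * D)) with hL
  have hbound : ∀ᶠ ε : ℝ in 𝓝[>] 0, ‖u ε y θ - atten σ y θ τ *
      source ψ (x - t • (ζ : Rn n)) ζ ε (y - τ • (θ : Rn n)) θ‖ ≤ L * (C * (ρ * ε) ^ (n - 1)) := by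
    filter_upwards [self_mem_nhdsWithin] with ε hε
    have hε0 : 0 < ε := hε
    set A := C * (ρ * ε) ^ (n - 1) with hA
    have hA0 : 0 ≤ A := by positivity
    have hsup := h.isSuper_source hψ hρ hε0 x ζ t hA0 (hcap _ (by positivity))
      (hb2 (ρ * (1 + D) * ε))
    have h1 := hsup.abs_sub_ballistic_le (by omega) (hu ε hε0) hτ hτD hray hy hp
    rw [Real.norm_eq_abs]
    refine h1.trans ?_
    set χ := tubeInd (ζ : Rn n) x (ρ * (1 + D) * ε)
    have h2 : lineInt D (fun z => M * A * (χ z + M * sphLineInt D χ z)) y θ ≤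
        D * (M * A * (1 + M * (S * (D * 1)))) := by
      rw [← lineInt_const hD _ y θ]
      refine lineInt_mono hsup.bddG (BddMeas.const _) (fun z => ?_) y θ
      have := hb1 (ρ * (1 + D) * ε) z
      have := htube (ρ * (1 + D) * ε) z
      gcongr
    refine (add_le_add_left h2 _).trans (le_of_eq ?_)
    rw [hL]
    ring
  refine squeeze_zero_norm' hbound ?_
  have hc : Continuous fun ε : ℝ => L * (C * (ρ * ε) ^ (n - 1)) := by fun_prop
  have h3 := (hc.tendsto 0).mono_left (nhdsWithin_le_nhds (s := Ioi (0 : ℝ)))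
  have e : L * (C * (ρ * 0) ^ (n - 1)) = 0 := by
    rw [mul_zero, zero_pow (by omega), mul_zero, mul_zero]
  rwa [e] at h3

/-- Only single scattering contributes to the leading order in a transversal direction. -/
lemma TransportSetting.tendsto_single_scattering (h : TransportSetting Ω σ k D M B) (hn : 3 ≤ n)
    (hψ : IsProfile ψ) (x : Rn n) (ζ : Sph n) (t : ℝ) {u : ℝ → Rn n → Sph n → ℝ}
    (hu : ∀ ε : ℝ, 0 < ε → IsRTESolution Ω σ k (source ψ (x - t • (ζ : Rn n)) ζ ε) (u ε))
    {y : Rn n} {θ : Sph n} {τ : ℝ} (hτ : 0 < τ) (hτD : τ ≤ D)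
    (hray : ∀ s ∈ Ioo 0 τ, y - s • (θ : Rn n) ∈ Ω) (hy : y ∈ Ω ∨ (y, θ) ∈ outflow Ω)
    (hp : (y - τ • (θ : Rn n), θ) ∈ inflow Ω) (hθ : perp (ζ : Rn n) θ ≠ 0) :
    Tendsto (fun ε : ℝ => (ε ^ n)⁻¹ * (u ε y θ - ∫ s in (0 : ℝ)..τ, atten σ y θ s *
      scatter k (ballistic Ω σ (source ψ (x - t • (ζ : Rn n)) ζ ε)) (y - s • (θ : Rn n)) θ))
      (𝓝[>] 0) (𝓝 0) := by
  obtain ⟨ρ, hρ0, hρ⟩ := hψ.exists_radius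
  obtain ⟨C, hC, hcap⟩ := exists_surfaceMeasure_cap_le (by omega) ζ
  have hζ := norm_eq_of_mem_sphere ζ
  have hD := h.D_nonneg
  have hM := h.M_nonneg
  set S := (surfaceMeasure n).real univ with hS
  have hS0 : 0 ≤ S := measureReal_nonneg
  set e0 := Real.exp (-(B * D)) with he0
  have he0' : 0 < e0 := Real.exp_pos _
  -- `L` collects the constants so that the final bound reads `L * κ * ε ^ n`: the cap contributes
  -- `ε^(n-1)`, the tube radius `ε`, and `κ` is the arbitrarily small factor of the iterated tube
  -- integrals.
  set L : ℝ := M * (M * (1 + M * D) + D * (S * (D * M ^ 3 / e0))) * (C * ρ ^ (n - 1)) *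
    (ρ * (1 + D)) with hL
  have hL0 : 0 ≤ L := by positivity
  rw [Metric.tendsto_nhds]
  intro κ' hκ'
  set κ := κ' / (L + 1) with hκdef
  have hκ : 0 < κ := by positivity
  have hLκ : L * κ < κ' := by
    rw [hκdef, mul_div_assoc', div_lt_iff₀ (by positivity)]
    nlinarith
  obtain ⟨R1, hR1, hb⟩ := exists_sphLineInt_sphLineInt_tubeInd_le hn hζ hD x hκ
  obtain ⟨R2, hR2, hl⟩ := exists_lineInt_sphLineInt_tubeInd_le hn hζ hD x hθ hκ
  have hdist : 0 < ‖(θ : Rn n) - ζ‖ := by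
    rw [norm_pos_iff, sub_ne_zero]
    intro heq
    rw [heq, perp_self hζ] at hθ
    exact hθ rfl
  have hsm : ∀ {c d : ℝ}, 0 < d → ∀ᶠ ε : ℝ in 𝓝[>] 0, c * ε < d := by
    intro c d hd
    have hc : Continuous fun ε : ℝ => c * ε := by fun_prop
    have h3 := (hc.tendsto 0).mono_left (nhdsWithin_le_nhds (s := Ioi (0 : ℝ)))
    rw [mul_zero] at h3
    exact h3.eventually (gt_mem_nhds hd)
  filter_upwards [self_mem_nhdsWithin, hsm (c := ρ * (1 + D)) hR1, hsm (c := ρ * (1 + D)) hR2,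
    hsm (c := ρ) hdist] with ε hε hε1 hε2 hε3
  have hε0 : 0 < ε := hε
  set R := ρ * (1 + D) * ε with hR
  have hR0 : 0 < R := by positivity
  set A := C * (ρ * ε) ^ (n - 1) with hA
  have hA0 : 0 ≤ A := by positivity
  have hsup := h.isSuper_source hψ hρ hε0 x ζ t hA0 (hcap _ (by positivity)) (hb R hR0 hε1.le)
  have h1 := hsup.abs_sub_single_le (by omega) (hu ε hε0) (bddMeas_source hψ _ _ _) hτ hτD hray hy hp
  have hzero : source ψ (x - t • (ζ : Rn n)) ζ ε (y - τ • (θ : Rn n)) θ = 0 := by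
    by_contra hne
    exact absurd (norm_le_of_source_ne_zero hρ hε0 hne).2 (not_le.2 hε3)
  rw [hzero, mul_zero, sub_zero] at h1
  set χ := tubeInd (ζ : Rn n) x R with hχ
  have hχb : BddMeas χ := bddMeas_tubeInd _ _ _
  have hLb : BddMeas (sphLineInt D χ) := bddMeas_sphLineInt D hχb
  have hLLb : BddMeas (sphLineInt D (sphLineInt D χ)) := bddMeas_sphLineInt D hLb
  have e1 : sphLineInt D (fun z => M * A * (χ z + M * sphLineInt D χ z)) =
      fun z => M * A * (sphLineInt D χ z + M * sphLineInt D (sphLineInt D χ) z) := by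
    funext z
    rw [sphLineInt_const_mul, sphLineInt_add hχb (hLb.const_mul M), sphLineInt_const_mul]
  have h2 : lineInt D (sphLineInt D (fun z => M * A * (χ z + M * sphLineInt D χ z))) y θ ≤
      M * A * (κ * R + M * (D * (κ * R))) := by
    rw [e1, lineInt_const_mul, lineInt_add hLb (hLLb.const_mul M), lineInt_const_mul]
    have h3 : lineInt D (sphLineInt D (sphLineInt D χ)) y θ ≤ D * (κ * R) := by
      rw [← lineInt_const hD _ y θ]
      exact lineInt_mono hLLb (BddMeas.const _) (hb R hR0 hε1.le) y θ
    have h4 := hl R hR0 hε2.le y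
    gcongr
  rw [dist_zero_right, norm_mul, norm_inv, Real.norm_eq_abs, Real.norm_eq_abs,
    abs_of_pos (by positivity : 0 < ε ^ n), inv_mul_lt_iff₀ (by positivity)]
  refine h1.trans_lt ?_
  have h5 : M * (lineInt D (sphLineInt D (fun z => M * A * (χ z + M * sphLineInt D χ z))) y θ +
      D * (S * (D * (M ^ 3 * A * (κ * R)) / e0))) ≤
      M * (M * A * (κ * R + M * (D * (κ * R))) + D * (S * (D * (M ^ 3 * A * (κ * R)) / e0))) := by
    gcongr
  refine h5.trans_lt ?_
  have hpow : ε ^ n = ε ^ (n - 1) * ε := by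
    rw [← pow_succ, Nat.sub_add_cancel (by omega)]
  have e2 : M * (M * A * (κ * R + M * (D * (κ * R))) + D * (S * (D * (M ^ 3 * A * (κ * R)) / e0))) =
      L * κ * ε ^ n := by
    rw [hL, hA, hR, hpow, mul_pow]
    ring
  rw [e2, mul_comm]
  exact mul_lt_mul_of_pos_left hLκ (by positivity)

end Source

/-! ### Gnomonic coordinates and optical depth near the reference ray. -/

section MainTerm

variable {n : ℕ} {Ω : Set (Rn n)} {σ : Rn n → ℝ} {k : Rn n → Sph n → Sph n → ℝ}
  {D M B : ℝ} {ψ : Rn n → ℝ}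

lemma perp_add_ne_zero (ζ : Sph n) (ω : (ℝ ∙ (ζ : Rn n))ᗮ) : (ω : Rn n) + ζ ≠ 0 := by
  intro h
  have h1 := inner_perp_add_smul (norm_eq_of_mem_sphere ζ) ω 1
  rw [one_smul, h, inner_zero_right] at h1
  exact zero_ne_one h1

lemma inner_sphDir_pos (ζ : Sph n) (ω : (ℝ ∙ (ζ : Rn n))ᗮ) :
    0 < ⟪(ζ : Rn n), (sphDir ζ ((ω : Rn n) + ζ) : Rn n)⟫ := by
  have h1 := inner_perp_add_smul (norm_eq_of_mem_sphere ζ) ω 1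
  rw [one_smul] at h1
  rw [coe_sphDir ζ (perp_add_ne_zero ζ ω), inner_smul_right, h1, mul_one]
  exact inv_pos.2 (norm_pos_iff.2 (perp_add_ne_zero ζ ω))

lemma inner_sphDir_le_one (ζ θ : Sph n) : ⟪(ζ : Rn n), (θ : Rn n)⟫ ≤ 1 := by
  have := real_inner_le_norm (ζ : Rn n) (θ : Rn n)
  rwa [norm_eq_of_mem_sphere, norm_eq_of_mem_sphere, one_mul] at this

/-- Integration over a cap of the sphere in scaled gnomonic coordinates. -/
lemma integral_surfaceMeasure_eq (hn : 1 ≤ n) (ζ : Sph n) {f : Sph n → ℝ} (hf : Measurable f)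
    (h0 : ∀ θ, f θ ≠ 0 → 0 < ⟪(ζ : Rn n), (θ : Rn n)⟫) {ε : ℝ} (hε : 0 < ε) :
    ∫ θ, f θ ∂surfaceMeasure n = ε ^ (n - 1) * ∫ ω : (ℝ ∙ (ζ : Rn n))ᗮ,
      ⟪(ζ : Rn n), (sphDir ζ (ε • (ω : Rn n) + ζ) : Rn n)⟫ ^ n *
        f (sphDir ζ (ε • (ω : Rn n) + ζ)) ∂perpVol (ζ : Rn n) := by
  have h1 : ∫ θ in {θ : Sph n | 0 < ⟪(ζ : Rn n), (θ : Rn n)⟫}, f θ ∂surfaceMeasure n =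
      ∫ θ, f θ ∂surfaceMeasure n := by
    refine setIntegral_eq_integral_of_forall_compl_eq_zero fun θ hθ => ?_
    by_contra h
    exact hθ (h0 θ h)
  have hm : Measurable fun ω : (ℝ ∙ (ζ : Rn n))ᗮ => sphDir ζ ((ω : Rn n) + ζ) := by fun_prop
  rw [← h1, surfaceMeasure_restrict_eq_map hn ζ,
    integral_map hm.aemeasurable hf.aestronglyMeasurable,
    integral_withDensity_eq_integral_toReal_smul (by fun_prop)
      (Eventually.of_forall fun _ => ENNReal.ofReal_lt_top)]
  have h2 := Measure.integral_comp_smul (perpVol (ζ : Rn n)) (fun ω : (ℝ ∙ (ζ : Rn n))ᗮ =>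
    ⟪(ζ : Rn n), (sphDir ζ ((ω : Rn n) + ζ) : Rn n)⟫ ^ n * f (sphDir ζ ((ω : Rn n) + ζ))) ε
  rw [finrank_perpSpace hn (norm_eq_of_mem_sphere ζ), abs_of_pos (by positivity), smul_eq_mul] at h2
  simp only [Submodule.coe_smul] at h2
  rw [h2, mul_inv_cancel_left₀ (by positivity)]
  refine integral_congr_ae (Eventually.of_forall fun ω => ?_)
  simp only [smul_eq_mul]
  rw [ENNReal.toReal_ofReal (pow_nonneg (inner_sphDir_pos ζ ω).le _)]

lemma abs_norm_perp_add_sub_one_le (ζ : Sph n) (ω : (ℝ ∙ (ζ : Rn n))ᗮ) :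
    |‖(ω : Rn n) + ζ‖ - 1| ≤ ‖(ω : Rn n)‖ ^ 2 := by
  have h1 : ‖(ω : Rn n) + ζ‖ ^ 2 = ‖(ω : Rn n)‖ ^ 2 + 1 := by
    rw [norm_add_sq_real, real_inner_comm, inner_perpSpace, norm_eq_of_mem_sphere]
    ring
  have h2 : 1 ≤ ‖(ω : Rn n) + ζ‖ := by nlinarith [norm_nonneg ((ω : Rn n) + ζ), sq_nonneg ‖(ω : Rn n)‖]
  rw [abs_of_nonneg (by linarith)]
  nlinarith

/-- The gnomonic parametrization is tangent to the identity. -/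
lemma tendsto_sphDir (ζ : Sph n) (ω : (ℝ ∙ (ζ : Rn n))ᗮ) :
    Tendsto (fun ε : ℝ => ε⁻¹ • ((sphDir ζ (ε • (ω : Rn n) + ζ) : Rn n) - ζ)) (𝓝[>] 0)
      (𝓝 (ω : Rn n)) := by
  rw [tendsto_iff_norm_sub_tendsto_zero]
  have hb : Tendsto (fun ε : ℝ => ε * ‖(ω : Rn n)‖ ^ 2) (𝓝[>] 0) (𝓝 0) := by
    have hc : Continuous fun ε : ℝ => ε * ‖(ω : Rn n)‖ ^ 2 := by fun_prop
    have := (hc.tendsto 0).mono_left (nhdsWithin_le_nhds (s := Ioi (0 : ℝ)))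
    rwa [zero_mul] at this
  refine squeeze_zero' (Eventually.of_forall fun _ => norm_nonneg _) ?_ hb
  filter_upwards [self_mem_nhdsWithin] with ε hε
  have hε0 : 0 < ε := hε
  have hne := perp_add_ne_zero ζ (ε • ω)
  have h1 := abs_norm_perp_add_sub_one_le ζ (ε • ω)
  rw [Submodule.coe_smul] at hne h1
  have hpos := norm_pos_iff.2 hne
  rw [coe_sphDir ζ hne]
  set v := ε • (ω : Rn n) + ζ with hv
  have e1 : ε⁻¹ • (‖v‖⁻¹ • v - (ζ : Rn n)) - (ω : Rn n) = (ε⁻¹ * (‖v‖⁻¹ - 1)) • v := by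
    have : (ω : Rn n) = ε⁻¹ • (v - ζ) := by
      rw [hv, add_sub_cancel_right, inv_smul_smul₀ hε0.ne']
    rw [this]
    module
  rw [e1, norm_smul, norm_mul, norm_inv, Real.norm_eq_abs, abs_of_pos hε0, Real.norm_eq_abs,
    mul_assoc, inv_mul_le_iff₀ hε0]
  have e2 : |‖v‖⁻¹ - 1| * ‖v‖ = |‖v‖ - 1| := by
    nth_rewrite 2 [← abs_of_pos hpos]
    rw [← abs_mul, sub_mul, inv_mul_cancel₀ hpos.ne', one_mul, abs_sub_comm]
  rw [e2]
  refine h1.trans (le_of_eq ?_)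
  rw [norm_smul, Real.norm_eq_abs, abs_of_pos hε0]
  ring

/-- Confines the rescaled direction to a ball independent of `ε`, for dominated convergence. The
smallness of `ρ * ε` absorbs the stretching of the gnomonic map, through `‖ω‖ ≤ ρ(ε‖ω‖ + 1)`. -/
lemma norm_le_of_norm_sphDir_sub_le (ζ : Sph n) (ω : (ℝ ∙ (ζ : Rn n))ᗮ) {ρ ε : ℝ} (hρ : 0 < ρ)
    (hε : 0 < ε) (hρε : ρ * ε ≤ 1 / 2)
    (h : ‖(sphDir ζ (ε • (ω : Rn n) + ζ) : Rn n) - ζ‖ ≤ ρ * ε) : ‖ω‖ ≤ 2 * ρ := by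
  have hζ := norm_eq_of_mem_sphere ζ
  have hne := perp_add_ne_zero ζ (ε • ω)
  rw [Submodule.coe_smul] at hne
  have hpos := norm_pos_iff.2 hne
  have h1 := (norm_perp_le hζ _).trans h
  have h2 : perp (ζ : Rn n) (ε • (ω : Rn n) + ζ) = ε • (ω : Rn n) := by
    have := perp_perp_add_smul hζ (ε • ω) 1
    rwa [one_smul, Submodule.coe_smul] at this
  rw [perp_sub, perp_self hζ, sub_zero, coe_sphDir ζ hne, perp_smul, h2, norm_smul, norm_smul,
    norm_inv, norm_norm, inv_mul_le_iff₀ hpos, Real.norm_eq_abs, abs_of_pos hε] at h1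
  have h3 := norm_add_le (ε • (ω : Rn n)) (ζ : Rn n)
  rw [norm_smul, Real.norm_eq_abs, abs_of_pos hε, hζ] at h3
  have h4 : ‖ω‖ = ‖(ω : Rn n)‖ := rfl
  rw [h4]
  have h5 := norm_nonneg (ω : Rn n)
  have h6 : ‖(ω : Rn n)‖ ≤ ρ * ‖ε • (ω : Rn n) + ζ‖ := by
    refine le_of_mul_le_mul_left ?_ hε
    linarith
  nlinarith [mul_le_mul_of_nonneg_left h3 hρ.le]

/-- Dominated convergence: as the exit time is continuous at a transversal ray, the integrand
converges for every `r` other than the exit time itself. -/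
lemma TransportSetting.continuousAt_depth (h : TransportSetting Ω σ k D M B) {s : Rn n → ℝ}
    (hs : BddMeas s) (hsσ : ∀ y ∈ closure Ω, s y = σ y) {x : Rn n} {ζ : Sph n} (hx : x ∈ Ω)
    (htr : ⟪outwardNormal Ω (entryPoint Ω x ζ), (ζ : Rn n)⟫ ≠ 0) :
    ContinuousAt (depth Ω D s) (x, ζ) := by
  obtain ⟨C, hC⟩ := hs.2
  have hτ := continuousAt_backExit h.domain h.dist_le hx htr
  have hmeas : MeasurableSet {w : (Rn n × Sph n) × ℝ | w.2 ≤ backExit Ω w.1.1 w.1.2} :=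
    measurableSet_le measurable_snd
      ((measurable_backExit h.domain.isOpen h.dist_le).comp measurable_fst)
  refine tendsto_integral_filter_of_dominated_convergence (fun _ => C)
    (Eventually.of_forall fun q => ?_) (Eventually.of_forall fun q => Eventually.of_forall fun r => ?_)
    ?_ ?_
  · refine Measurable.aestronglyMeasurable (Measurable.mul ?_ (hs.1.comp (by fun_prop)))
    exact (measurable_const.indicator hmeas).comp measurable_prodMk_left
  · rw [norm_mul, Real.norm_eq_abs, Real.norm_eq_abs]
    refine (mul_le_of_le_one_left (abs_nonneg _) ?_).trans (hC _)
    rw [abs_of_nonneg (indicator_nonneg (fun _ _ => zero_le_one) _)]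
    exact indicator_le_self' (f := fun _ => (1 : ℝ)) (fun _ _ => zero_le_one) _
  · exact integrable_const _
  · have hne : ∀ᵐ r : ℝ ∂(volume.restrict (Ioc 0 D)), r ≠ backExit Ω x ζ :=
      ae_restrict_of_ae (by simp [ae_iff])
    filter_upwards [hne, ae_restrict_mem measurableSet_Ioc] with r hr hr0
    rcases lt_or_gt_of_ne hr with hlt | hgt
    · have hz : x - r • (ζ : Rn n) ∈ Ω := mem_of_lt_backExit hr0.1.le hlt
      have hpos : Tendsto (fun q : Rn n × Sph n => q.1 - r • (q.2 : Rn n)) (𝓝 (x, ζ))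
          (𝓝 (x - r • (ζ : Rn n))) := by
        have : Continuous fun q : Rn n × Sph n => q.1 - r • (q.2 : Rn n) := by fun_prop
        exact this.tendsto (x, ζ)
      have hσc : ContinuousAt σ (x - r • (ζ : Rn n)) :=
        (h.admissible.sigma_cont.mono subset_closure).continuousAt (h.domain.isOpen.mem_nhds hz)
      rw [indicator_of_mem (by exact hlt.le), one_mul, hsσ _ (subset_closure hz)]
      refine (hσc.tendsto.comp hpos).congr' ?_
      filter_upwards [hτ.eventually (lt_mem_nhds hlt),
        hpos.eventually (h.domain.isOpen.mem_nhds hz)] with q hq hqz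
      rw [indicator_of_mem (by exact le_of_lt hq), one_mul, hsσ _ (subset_closure hqz)]
      rfl
    · rw [indicator_of_notMem (by exact not_le.2 hgt), zero_mul]
      refine tendsto_const_nhds.congr' ?_
      filter_upwards [hτ.eventually (gt_mem_nhds hgt)] with q hq
      rw [indicator_of_notMem (by exact not_le.2 hq), zero_mul]

end MainTerm

/-! ### The leading term of single scattering. -/

section MainTerm

variable {n : ℕ} {Ω : Set (Rn n)} {σ : Rn n → ℝ} {k : Rn n → Sph n → Sph n → ℝ}
  {D M B : ℝ} {ψ : Rn n → ℝ}

lemma continuous_atten {s : Rn n → ℝ} (hs : BddMeas s) (y θ : Rn n) : Continuous (atten s y θ) := by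
  obtain ⟨C, hC⟩ := hs.2
  have h1 : ∀ a b : ℝ, IntervalIntegrable (fun r : ℝ => s (y - r • θ)) volume a b := fun a b => by
    rw [intervalIntegrable_iff, uIoc]
    exact (hs.comp (f := fun r : ℝ => y - r • θ) (by fun_prop)).integrable _
  exact Real.continuous_exp.comp (intervalIntegral.continuous_primitive h1 0).neg

lemma atten_le_one_of_nonneg {s : Rn n → ℝ} (hs : ∀ y, 0 ≤ s y) (y θ : Rn n) {t : ℝ} (ht : 0 ≤ t) :
    atten s y θ t ≤ 1 := by
  rw [atten, Real.exp_le_one_iff, neg_nonpos]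
  exact intervalIntegral.integral_nonneg ht fun _ _ => hs _

lemma atten_congr {s : Rn n → ℝ} {y θ : Rn n} {τ : ℝ} (hτ : 0 < τ)
    (hray : ∀ r ∈ Ioo 0 τ, y - r • θ ∈ Ω) (hsσ : ∀ y ∈ closure Ω, s y = σ y) {t : ℝ}
    (ht : t ∈ Icc 0 τ) : atten s y θ t = atten σ y θ t := by
  rw [atten, atten]
  congr 2
  refine intervalIntegral.integral_congr fun r hr => ?_
  rw [uIcc_of_le ht.1] at hr
  exact hsσ _ (mem_closure_of_ray hτ hray ⟨hr.1, hr.2.trans ht.2⟩)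

/-- The single scattering of a focused source, rescaled: the integrand. -/
def singleScatteringDensity (Ω : Set (Rn n)) (D : ℝ) (s : Rn n → ℝ) (K : Rn n × Sph n × Sph n → ℝ)
    (ψ : Rn n → ℝ) (x : Rn n) (ζ η : Sph n) (p q ε : ℝ) (w : (ℝ ∙ (ζ : Rn n))ᗮ × ℝ) : ℝ :=
  {w : (ℝ ∙ (ζ : Rn n))ᗮ × ℝ | w.2 ∈ Ioc (-q / ε) (p / ε)}.indicator
      (fun w => atten s (x + p • (η : Rn n)) η (p - ε * w.2)) w *
    (⟪(ζ : Rn n), (sphDir ζ (ε • (w.1 : Rn n) + ζ) : Rn n)⟫ ^ n *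
      (K (x + (ε * w.2) • (η : Rn n), η, sphDir ζ (ε • (w.1 : Rn n) + ζ)) *
        (Real.exp (-depth Ω D s (x + (ε * w.2) • (η : Rn n), sphDir ζ (ε • (w.1 : Rn n) + ζ))) *
          source ψ (entryPoint Ω x ζ) ζ ε
            (entryPoint Ω (x + (ε * w.2) • (η : Rn n)) (sphDir ζ (ε • (w.1 : Rn n) + ζ)))
            (sphDir ζ (ε • (w.1 : Rn n) + ζ)))))

lemma TransportSetting.measurable_singleScatteringDensity (h : TransportSetting Ω σ k D M B)
    (hψ : IsProfile ψ) {s : Rn n → ℝ} (hs : BddMeas s) (hs0 : ∀ y, 0 ≤ s y)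
    {K : Rn n × Sph n × Sph n → ℝ} (hK : BddMeas K) (x : Rn n) (ζ η : Sph n) (p q ε : ℝ) :
    Measurable (singleScatteringDensity Ω D s K ψ x ζ η p q ε) := by
  have hN : Measurable fun w : (ℝ ∙ (ζ : Rn n))ᗮ × ℝ => sphDir ζ (ε • (w.1 : Rn n) + ζ) := by
    fun_prop
  have hz : Measurable fun w : (ℝ ∙ (ζ : Rn n))ᗮ × ℝ => x + (ε * w.2) • (η : Rn n) := by fun_prop
  have hV := (h.bddMeas_ballistic hs hs0 (bddMeas_source hψ (entryPoint Ω x ζ) ζ ε)).1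
  have hat := (continuous_atten hs (x + p • (η : Rn n)) η).measurable
  refine Measurable.mul (Measurable.indicator (hat.comp (by fun_prop))
    (measurable_snd measurableSet_Ioc)) (Measurable.mul (by fun_prop) (Measurable.mul ?_ ?_))
  · exact hK.1.comp (hz.prodMk (measurable_const.prodMk hN))
  · exact hV.comp (hz.prodMk hN)

/-- A majorant independent of `ε`. The angular factor of the source bounds `ω`; the tube bounds
`ε|s|‖perp ζ η‖` by `ρ(1 + D)ε`, hence `s`. All factors other than `K` are at most 1. -/
lemma TransportSetting.abs_singleScatteringDensity_le (h : TransportSetting Ω σ k D M B)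
    (hψ : IsProfile ψ) {s : Rn n → ℝ} (hs0 : ∀ y, 0 ≤ s y)
    {K : Rn n × Sph n × Sph n → ℝ} {C : ℝ} (hK : ∀ z, |K z| ≤ C) (x : Rn n) (ζ η : Sph n)
    (p q : ℝ) {ρ ε : ℝ} (hρ0 : 0 < ρ) (hρ : ∀ v, ψ v ≠ 0 → ‖v‖ ≤ ρ) (hε : 0 < ε)
    (hρε : ρ * ε ≤ 1 / 2) (hη : perp (ζ : Rn n) η ≠ 0) (w : (ℝ ∙ (ζ : Rn n))ᗮ × ℝ) :
    |singleScatteringDensity Ω D s K ψ x ζ η p q ε w| ≤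
      (Metric.closedBall (0 : (ℝ ∙ (ζ : Rn n))ᗮ) (2 * ρ) ×ˢ
        Metric.closedBall (0 : ℝ) (ρ * (1 + D) / ‖perp (ζ : Rn n) η‖)).indicator (fun _ => C) w := by
  have hζ := norm_eq_of_mem_sphere ζ
  have hC : 0 ≤ C := (abs_nonneg _).trans (hK (0, ζ, ζ))
  by_cases h0 : source ψ (entryPoint Ω x ζ) ζ ε
      (entryPoint Ω (x + (ε * w.2) • (η : Rn n)) (sphDir ζ (ε • (w.1 : Rn n) + ζ)))
      (sphDir ζ (ε • (w.1 : Rn n) + ζ)) = 0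
  · rw [singleScatteringDensity, h0, mul_zero, mul_zero, mul_zero, mul_zero, abs_zero]
    exact indicator_nonneg (fun _ _ => hC) _
  have hmem : w ∈ Metric.closedBall (0 : (ℝ ∙ (ζ : Rn n))ᗮ) (2 * ρ) ×ˢ
      Metric.closedBall (0 : ℝ) (ρ * (1 + D) / ‖perp (ζ : Rn n) η‖) := by
    refine ⟨?_, ?_⟩
    · rw [mem_closedBall_zero_iff]
      exact norm_le_of_norm_sphDir_sub_le ζ w.1 hρ0 hε hρε (norm_le_of_source_ne_zero hρ hε h0).2
    · rw [mem_closedBall_zero_iff, le_div_iff₀ (norm_pos_iff.2 hη)]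
      have h1 := norm_perp_le_of_source_ne_zero hρ hε backExit_nonneg
        (backExit_le h.dist_le (norm_eq_of_mem_sphere _) h.D_nonneg) h0
      rw [add_sub_cancel_left, perp_smul, norm_smul, norm_mul, Real.norm_eq_abs ε,
        abs_of_pos hε] at h1
      refine le_of_mul_le_mul_left ?_ hε
      linarith
  rw [indicator_of_mem hmem, singleScatteringDensity]
  set J := ⟪(ζ : Rn n), (sphDir ζ (ε • (w.1 : Rn n) + ζ) : Rn n)⟫ with hJ
  have hJ0 : 0 < J := by
    have := inner_sphDir_pos ζ (ε • w.1)
    rwa [Submodule.coe_smul] at this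
  have hJ1 : J ^ n ≤ 1 := pow_le_one₀ hJ0.le (inner_sphDir_le_one _ _)
  have hE := Real.exp_pos (-depth Ω D s
    (x + (ε * w.2) • (η : Rn n), sphDir ζ (ε • (w.1 : Rn n) + ζ)))
  have hE1 : Real.exp (-depth Ω D s
      (x + (ε * w.2) • (η : Rn n), sphDir ζ (ε • (w.1 : Rn n) + ζ))) ≤ 1 := by
    rw [Real.exp_le_one_iff, neg_nonpos]
    exact depth_nonneg hs0 _
  have hS := source_nonneg hψ (entryPoint Ω x ζ) ζ ε
    (entryPoint Ω (x + (ε * w.2) • (η : Rn n)) (sphDir ζ (ε • (w.1 : Rn n) + ζ)))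
    (sphDir ζ (ε • (w.1 : Rn n) + ζ))
  have hS1 := source_le_one hψ (entryPoint Ω x ζ) ζ ε
    (entryPoint Ω (x + (ε * w.2) • (η : Rn n)) (sphDir ζ (ε • (w.1 : Rn n) + ζ)))
    (sphDir ζ (ε • (w.1 : Rn n) + ζ))
  have hA : |{w : (ℝ ∙ (ζ : Rn n))ᗮ × ℝ | w.2 ∈ Ioc (-q / ε) (p / ε)}.indicator
      (fun w => atten s (x + p • (η : Rn n)) η (p - ε * w.2)) w| ≤ 1 := by
    by_cases hw : w ∈ {w : (ℝ ∙ (ζ : Rn n))ᗮ × ℝ | w.2 ∈ Ioc (-q / ε) (p / ε)}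
    · rw [indicator_of_mem hw, abs_of_pos (atten_pos _ _ _ _)]
      refine atten_le_one_of_nonneg hs0 _ _ ?_
      have := (le_div_iff₀ hε).1 hw.2
      linarith
    · rw [indicator_of_notMem hw, abs_zero]
      exact zero_le_one
  rw [abs_mul, abs_mul, abs_mul, abs_of_pos (pow_pos hJ0 n), abs_of_nonneg (mul_nonneg hE.le hS)]
  have h2 := mul_le_one₀ hE1 hS hS1
  have h3 : |K (x + (ε * w.2) • (η : Rn n), η, sphDir ζ (ε • (w.1 : Rn n) + ζ))| * (Real.exp
      (-depth Ω D s (x + (ε * w.2) • (η : Rn n), sphDir ζ (ε • (w.1 : Rn n) + ζ))) *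
      source ψ (entryPoint Ω x ζ) ζ ε
        (entryPoint Ω (x + (ε * w.2) • (η : Rn n)) (sphDir ζ (ε • (w.1 : Rn n) + ζ)))
        (sphDir ζ (ε • (w.1 : Rn n) + ζ))) ≤ C :=
    (mul_le_of_le_one_right (abs_nonneg _) h2).trans (hK _)
  refine (mul_le_of_le_one_left (by positivity) hA).trans ?_
  exact (mul_le_of_le_one_left (by positivity) hJ1).trans h3

lemma integrable_indicator_prod_ball (ζ : Sph n) (r r' C : ℝ) :
    Integrable ((Metric.closedBall (0 : (ℝ ∙ (ζ : Rn n))ᗮ) r ×ˢ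
      Metric.closedBall (0 : ℝ) r').indicator fun _ => C)
      ((perpVol (ζ : Rn n)).prod volume) := by
  refine (integrable_indicator_iff
    (Metric.isClosed_closedBall.measurableSet.prod Metric.isClosed_closedBall.measurableSet)).2 ?_
  refine integrableOn_const ?_
  rw [Measure.prod_prod]
  exact ENNReal.mul_ne_top measure_closedBall_lt_top.ne measure_closedBall_lt_top.ne

/-- The substitution `r = p - εs` on the chord gives one factor `ε` and scaled gnomonic coordinates
on the sphere give `ε^(n-1)`, which together use up the normalization. -/
lemma TransportSetting.single_scattering_eq_integral (h : TransportSetting Ω σ k D M B) (hn : 3 ≤ n)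
    (hψ : IsProfile ψ) {s : Rn n → ℝ} (hs : BddMeas s) (hs0 : ∀ y, 0 ≤ s y)
    (hsσ : ∀ y ∈ closure Ω, s y = σ y) {K : Rn n × Sph n × Sph n → ℝ} (hK : BddMeas K)
    (hKk : ∀ y ∈ Ω, ∀ θ θ', K (y, θ, θ') = k y θ θ') {x : Rn n} {ζ η : Sph n}
    (hη : perp (ζ : Rn n) η ≠ 0) {p q : ℝ} (hp : 0 < p) (hq : 0 < q)
    (hray : ∀ r ∈ Ioo 0 (p + q), x + p • (η : Rn n) - r • (η : Rn n) ∈ Ω) {ρ ε : ℝ} (hρ0 : 0 < ρ)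
    (hρ : ∀ v, ψ v ≠ 0 → ‖v‖ ≤ ρ) (hε : 0 < ε) (hρε : ρ * ε ≤ 1 / 2) :
    (ε ^ n)⁻¹ * ∫ r in (0 : ℝ)..(p + q), atten σ (x + p • (η : Rn n)) η r *
      scatter k (ballistic Ω σ (source ψ (entryPoint Ω x ζ) ζ ε))
        (x + p • (η : Rn n) - r • (η : Rn n)) η =
      ∫ w, singleScatteringDensity Ω D s K ψ x ζ η p q ε w ∂((perpVol (ζ : Rn n)).prod volume) := by
  set f := source ψ (entryPoint Ω x ζ) ζ ε with hf
  set V : Rn n × Sph n → ℝ := fun q => Real.exp (-depth Ω D s q) * f (entryPoint Ω q.1 q.2) q.2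
    with hV
  have hVb : BddMeas V := h.bddMeas_ballistic hs hs0 (bddMeas_source hψ _ _ _)
  obtain ⟨C, hC⟩ := hK.2
  have hint : Integrable (singleScatteringDensity Ω D s K ψ x ζ η p q ε)
      ((perpVol (ζ : Rn n)).prod volume) :=
    (integrable_indicator_prod_ball ζ _ _ C).mono'
      (h.measurable_singleScatteringDensity hψ hs hs0 hK x ζ η p q ε).aestronglyMeasurable
      (Eventually.of_forall
        (h.abs_singleScatteringDensity_le hψ hs0 hC x ζ η p q hρ0 hρ hε hρε hη))
  have hsc : ∀ z ∈ Ω, scatter k (ballistic Ω σ f) z η = ε ^ (n - 1) *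
      ∫ ω : (ℝ ∙ (ζ : Rn n))ᗮ, ⟪(ζ : Rn n), (sphDir ζ (ε • (ω : Rn n) + ζ) : Rn n)⟫ ^ n *
        (K (z, η, sphDir ζ (ε • (ω : Rn n) + ζ)) * V (z, sphDir ζ (ε • (ω : Rn n) + ζ)))
        ∂perpVol (ζ : Rn n) := by
    intro z hz
    have hm : Measurable fun θ : Sph n => K (z, η, θ) * V (z, θ) :=
      (hK.1.comp (by fun_prop : Measurable fun θ : Sph n => (z, η, θ))).mul
        (hVb.1.comp (by fun_prop : Measurable fun θ : Sph n => (z, θ)))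
    rw [← integral_surfaceMeasure_eq (by omega) ζ hm _ hε]
    · refine integral_congr_ae (Eventually.of_forall fun θ => ?_)
      simp only [hKk z hz, hV, ballistic, h.exp_neg_depth hsσ hz θ]
    · intro θ hθ
      have h1 := right_ne_zero_of_mul (right_ne_zero_of_mul hθ)
      have h2 := (norm_le_of_source_ne_zero hρ hε h1).2.trans hρε
      have h3 := norm_sub_sq_real (θ : Rn n) (ζ : Rn n)
      rw [norm_eq_of_mem_sphere, norm_eq_of_mem_sphere, real_inner_comm] at h3
      nlinarith [norm_nonneg ((θ : Rn n) - ζ)]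
  rw [integral_prod_symm _ hint]
  -- The endpoint `r = p / ε` corresponds to the far end of the chord, possibly outside `Ω`, where
  -- `K` need not represent `k`. It is left out as a null set.
  have e1 : ∀ r : ℝ, ∫ ω, singleScatteringDensity Ω D s K ψ x ζ η p q ε (ω, r)
      ∂perpVol (ζ : Rn n) = (Ioc (-q / ε) (p / ε)).indicator
        (fun r => (ε ^ (n - 1))⁻¹ * (atten σ (x + p • (η : Rn n)) η (p - ε * r) *
          scatter k (ballistic Ω σ f) (x + p • (η : Rn n) - (p - ε * r) • (η : Rn n)) η)) r ∨
          r = p / ε := by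
    intro r
    refine or_iff_not_imp_right.2 fun hrp => ?_
    by_cases hr : r ∈ Ioc (-q / ε) (p / ε)
    · rw [indicator_of_mem hr]
      have hr1 : -q < r * ε := (div_lt_iff₀ hε).1 hr.1
      have hr2 : r * ε < p := (lt_div_iff₀ hε).1 (hr.2.lt_of_ne hrp)
      have hz : x + p • (η : Rn n) - (p - ε * r) • (η : Rn n) ∈ Ω :=
        hray _ ⟨by linarith, by linarith⟩
      have hze : x + p • (η : Rn n) - (p - ε * r) • (η : Rn n) = x + (ε * r) • (η : Rn n) := by
        module
      rw [hsc _ hz, hze, mul_left_comm, inv_mul_cancel_left₀ (by positivity),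
        ← integral_const_mul]
      refine integral_congr_ae (Eventually.of_forall fun ω => ?_)
      simp only [singleScatteringDensity]
      rw [indicator_of_mem (by exact hr), atten_congr (by linarith) hray hsσ
        ⟨by linarith, by linarith⟩]
    · rw [indicator_of_notMem hr]
      refine (integral_congr_ae (Eventually.of_forall fun ω => ?_)).trans (integral_zero _ _)
      simp only [singleScatteringDensity]
      rw [indicator_of_notMem (by exact hr), zero_mul]
  have e2 : ∫ r : ℝ, ∫ ω, singleScatteringDensity Ω D s K ψ x ζ η p q ε (ω, r)
      ∂perpVol (ζ : Rn n) = ∫ r in Ioc (-q / ε) (p / ε),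
        (ε ^ (n - 1))⁻¹ * (atten σ (x + p • (η : Rn n)) η (p - ε * r) *
          scatter k (ballistic Ω σ f) (x + p • (η : Rn n) - (p - ε * r) • (η : Rn n)) η) := by
    rw [← integral_indicator measurableSet_Ioc]
    refine integral_congr_ae ?_
    have hne : ∀ᵐ r : ℝ, r ≠ p / ε := by simp [ae_iff]
    filter_upwards [hne] with r hr
    exact (e1 r).resolve_right hr
  have hle : -q / ε ≤ p / ε := by gcongr; linarith
  have e3 := intervalIntegral.integral_comp_sub_mul (a := -q / ε) (b := p / ε)
    (fun r => atten σ (x + p • (η : Rn n)) η r *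
      scatter k (ballistic Ω σ f) (x + p • (η : Rn n) - r • (η : Rn n)) η) hε.ne' p
  rw [mul_div_cancel₀ _ hε.ne', mul_div_cancel₀ _ hε.ne', sub_self, sub_neg_eq_add,
    smul_eq_mul] at e3
  rw [e2, integral_const_mul, ← intervalIntegral.integral_of_le hle, e3, ← mul_assoc, ← mul_inv,
    ← pow_succ, Nat.sub_add_cancel (by omega)]

/-- The leading order of the single scattering of a focused source. -/
lemma TransportSetting.tendsto_beamMass (h : TransportSetting Ω σ k D M B) (hn : 3 ≤ n)
    (hψ : IsProfile ψ) {x : Rn n} (hx : x ∈ Ω) {ζ η : Sph n}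
    (htr : ⟪outwardNormal Ω (entryPoint Ω x ζ), (ζ : Rn n)⟫ ≠ 0)
    (hη : perp (ζ : Rn n) η ≠ 0) {p q : ℝ} (hp : 0 < p) (hq : 0 < q)
    (hray : ∀ r ∈ Ioo 0 (p + q), x + p • (η : Rn n) - r • (η : Rn n) ∈ Ω) :
    Tendsto (fun ε : ℝ => (ε ^ n)⁻¹ * ∫ r in (0 : ℝ)..(p + q), atten σ (x + p • (η : Rn n)) η r *
      scatter k (ballistic Ω σ (source ψ (entryPoint Ω x ζ) ζ ε))
        (x + p • (η : Rn n) - r • (η : Rn n)) η) (𝓝[>] 0)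
      (𝓝 (atten σ (x + p • (η : Rn n)) η p * (k x η ζ * atten σ x ζ (backExit Ω x ζ)) *
        beamMass Ω ψ x (entryPoint Ω x ζ) ζ η)) := by
  obtain ⟨ρ, hρ0, hρ⟩ := hψ.exists_radius
  obtain ⟨s, hs, hs0, hsσ⟩ := h.admissible.exists_bddMeas_sigma h.domain.isBounded
  obtain ⟨K, hK, hKk⟩ := h.admissible.exists_bddMeas_kernel h.domain.isOpen
  obtain ⟨C, hC⟩ := hK.2
  have hζ := norm_eq_of_mem_sphere ζ
  have hlin : ∀ c : ℝ, Tendsto (fun ε : ℝ => c * ε) (𝓝[>] 0) (𝓝 0) := by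
    intro c
    have hc : Continuous fun ε : ℝ => c * ε := by fun_prop
    have := (hc.tendsto 0).mono_left (nhdsWithin_le_nhds (s := Ioi (0 : ℝ)))
    rwa [mul_zero] at this
  have hsmall : ∀ᶠ ε : ℝ in 𝓝[>] 0, ρ * ε ≤ 1 / 2 :=
    (hlin ρ).eventually (Iic_mem_nhds (by norm_num))
  set ν := outwardNormal Ω (entryPoint Ω x ζ) with hν
  set A := atten σ (x + p • (η : Rn n)) η p * (k x η ζ * atten σ x ζ (backExit Ω x ζ)) with hA
  set Φ : (ℝ ∙ (ζ : Rn n))ᗮ × ℝ → ℝ := fun w =>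
    ψ (obliqueProj ν ζ (w.2 • (η : Rn n) - backExit Ω x ζ • (w.1 : Rn n))) * ψ (w.1 : Rn n) with hΦ
  have hlim : ∀ w : (ℝ ∙ (ζ : Rn n))ᗮ × ℝ,
      Tendsto (fun ε => singleScatteringDensity Ω D s K ψ x ζ η p q ε w) (𝓝[>] 0)
        (𝓝 (A * Φ w)) := by
    intro w
    have hN := tendsto_sphDir ζ w.1
    have hN1 : Tendsto (fun ε : ℝ => (sphDir ζ (ε • (w.1 : Rn n) + ζ) : Rn n)) (𝓝[>] 0) (𝓝 ζ) :=
      tendsto_of_tendsto_inv_smul_sub hN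
    have hN2 : Tendsto (fun ε : ℝ => sphDir ζ (ε • (w.1 : Rn n) + ζ)) (𝓝[>] 0) (𝓝 ζ) :=
      tendsto_subtype_rng.2 hN1
    have hY : Tendsto (fun ε : ℝ => ε⁻¹ • (x + (ε * w.2) • (η : Rn n) - x)) (𝓝[>] 0)
        (𝓝 (w.2 • (η : Rn n))) := by
      refine tendsto_const_nhds.congr' ?_
      filter_upwards [self_mem_nhdsWithin] with ε hε
      rw [add_sub_cancel_left, mul_smul, inv_smul_smul₀ (ne_of_gt hε)]
    have hY1 : Tendsto (fun ε : ℝ => x + (ε * w.2) • (η : Rn n)) (𝓝[>] 0) (𝓝 x) :=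
      tendsto_of_tendsto_inv_smul_sub hY
    have hYΩ : ∀ᶠ ε : ℝ in 𝓝[>] 0, x + (ε * w.2) • (η : Rn n) ∈ Ω :=
      hY1.eventually (h.domain.isOpen.mem_nhds hx)
    -- With position displaced by `sη` and direction by `ω`, the limiting displacement is precisely
    -- the argument of the first `ψ` in `beamMass`.
    have hent := tendsto_entryPoint_displacement h.domain h.dist_le hx htr hY hN
    have hS : Tendsto (fun ε : ℝ => source ψ (entryPoint Ω x ζ) ζ ε
        (entryPoint Ω (x + (ε * w.2) • (η : Rn n)) (sphDir ζ (ε • (w.1 : Rn n) + ζ)))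
        (sphDir ζ (ε • (w.1 : Rn n) + ζ))) (𝓝[>] 0) (𝓝 (Φ w)) :=
      ((hψ.continuous.tendsto _).comp hent).mul ((hψ.continuous.tendsto _).comp hN)
    have hE : Tendsto (fun ε : ℝ => Real.exp (-depth Ω D s
        (x + (ε * w.2) • (η : Rn n), sphDir ζ (ε • (w.1 : Rn n) + ζ)))) (𝓝[>] 0)
        (𝓝 (atten σ x ζ (backExit Ω x ζ))) := by
      rw [← h.exp_neg_depth hsσ hx ζ]
      exact (Real.continuous_exp.tendsto _).comp
        (((h.continuousAt_depth hs hsσ hx htr).tendsto.comp (hY1.prodMk_nhds hN2)).neg)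
    have hKl : Tendsto (fun ε : ℝ => K (x + (ε * w.2) • (η : Rn n), η,
        sphDir ζ (ε • (w.1 : Rn n) + ζ))) (𝓝[>] 0) (𝓝 (k x η ζ)) := by
      have hc : ContinuousAt (fun q : Rn n × Sph n × Sph n => k q.1 q.2.1 q.2.2) (x, η, ζ) :=
        h.admissible.k_cont.continuousAt
          ((h.domain.isOpen.prod isOpen_univ).mem_nhds ⟨hx, mem_univ _⟩)
      refine (hc.tendsto.comp (hY1.prodMk_nhds
        ((tendsto_const_nhds (x := η)).prodMk_nhds hN2))).congr' ?_
      filter_upwards [hYΩ] with ε hε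
      exact (hKk _ hε _ _).symm
    have hJ : Tendsto (fun ε : ℝ =>
        ⟪(ζ : Rn n), (sphDir ζ (ε • (w.1 : Rn n) + ζ) : Rn n)⟫ ^ n) (𝓝[>] 0) (𝓝 1) := by
      have h1 := ((tendsto_const_nhds (x := (ζ : Rn n))).inner (𝕜 := ℝ) hN1).pow n
      rwa [real_inner_self_eq_norm_sq, hζ, one_pow, one_pow] at h1
    have hAt : Tendsto (fun ε : ℝ => {w : (ℝ ∙ (ζ : Rn n))ᗮ × ℝ | w.2 ∈ Ioc (-q / ε) (p / ε)}.indicator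
        (fun w => atten s (x + p • (η : Rn n)) η (p - ε * w.2)) w) (𝓝[>] 0)
        (𝓝 (atten σ (x + p • (η : Rn n)) η p)) := by
      rw [← atten_congr (add_pos hp hq) hray hsσ ⟨hp.le, by linarith⟩]
      have hc : Continuous fun ε : ℝ => atten s (x + p • (η : Rn n)) η (p - ε * w.2) :=
        (continuous_atten hs _ _).comp (by fun_prop)
      have h1 := (hc.tendsto 0).mono_left (nhdsWithin_le_nhds (s := Ioi (0 : ℝ)))
      rw [zero_mul, sub_zero] at h1
      refine h1.congr' ?_
      filter_upwards [self_mem_nhdsWithin, (hlin w.2).eventually (lt_mem_nhds (neg_lt_zero.2 hq)),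
        (hlin w.2).eventually (gt_mem_nhds hp)] with ε hε h2 h3
      rw [indicator_of_mem (by exact ⟨(div_lt_iff₀ hε).2 h2, ((lt_div_iff₀ hε).2 h3).le⟩)]
    have e : A * Φ w = atten σ (x + p • (η : Rn n)) η p *
        (1 * (k x η ζ * (atten σ x ζ (backExit Ω x ζ) * Φ w))) := by
      rw [hA]
      ring
    rw [e]
    exact hAt.mul (hJ.mul (hKl.mul (hE.mul hS)))
  have hbound : ∀ᶠ ε : ℝ in 𝓝[>] 0, ∀ w, ‖singleScatteringDensity Ω D s K ψ x ζ η p q ε w‖ ≤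
      (Metric.closedBall (0 : (ℝ ∙ (ζ : Rn n))ᗮ) (2 * ρ) ×ˢ
        Metric.closedBall (0 : ℝ) (ρ * (1 + D) / ‖perp (ζ : Rn n) η‖)).indicator (fun _ => C) w := by
    filter_upwards [self_mem_nhdsWithin, hsmall] with ε hε hρε
    exact h.abs_singleScatteringDensity_le hψ hs0 hC x ζ η p q hρ0 hρ hε hρε hη
  have hball := integrable_indicator_prod_ball ζ (2 * ρ) (ρ * (1 + D) / ‖perp (ζ : Rn n) η‖) C
  have hΦc : Continuous Φ := by
    have h1 := hψ.continuous
    have h2 := continuous_obliqueProj ν (ζ : Rn n)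
    fun_prop
  have hΦi : Integrable (fun w => A * Φ w) ((perpVol (ζ : Rn n)).prod volume) :=
    hball.mono' (by fun_prop) (Eventually.of_forall fun w =>
      le_of_tendsto (hlim w).norm (hbound.mono fun ε hε => hε w))
  have hmain : Tendsto (fun ε => ∫ w, singleScatteringDensity Ω D s K ψ x ζ η p q ε w
      ∂((perpVol (ζ : Rn n)).prod volume)) (𝓝[>] 0)
      (𝓝 (∫ w, A * Φ w ∂((perpVol (ζ : Rn n)).prod volume))) := by
    refine tendsto_integral_filter_of_dominated_convergence _
      (Eventually.of_forall fun ε =>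
        (h.measurable_singleScatteringDensity hψ hs hs0 hK x ζ η p q ε).aestronglyMeasurable)
      (hbound.mono fun ε hε => Eventually.of_forall hε) hball (Eventually.of_forall hlim)
  have hdist : ‖x - entryPoint Ω x ζ‖ = backExit Ω x ζ := by
    rw [entryPoint, sub_sub_cancel, norm_smul, hζ, mul_one, Real.norm_eq_abs,
      abs_of_nonneg backExit_nonneg]
  have e : ∫ w, A * Φ w ∂((perpVol (ζ : Rn n)).prod volume) =
      A * beamMass Ω ψ x (entryPoint Ω x ζ) ζ η := by
    rw [integral_prod _ hΦi, beamMass, hdist]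
    simp only [integral_const_mul, hΦ]
    rfl
  rw [e] at hmain
  refine hmain.congr' ?_
  filter_upwards [self_mem_nhdsWithin, hsmall] with ε hε hρε
  exact (h.single_scattering_eq_integral hn hψ hs hs0 hsσ hK hKk hη hp hq hray hρ0 hρ hε hρε).symm

end MainTerm

/-! ### Normalized profiles. -/

section Profile

variable {n : ℕ} {Ω : Set (Rn n)} {ψ : Rn n → ℝ}

lemma perp_ne_zero {ζ η : Sph n} (h : η ≠ ζ) (h' : η ≠ -ζ) : perp (ζ : Rn n) η ≠ 0 := by
  intro h0
  have h1 : (η : Rn n) = ⟪(ζ : Rn n), (η : Rn n)⟫ • (ζ : Rn n) := sub_eq_zero.1 h0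
  have h2 : |⟪(ζ : Rn n), (η : Rn n)⟫| = 1 := by
    have := congrArg norm h1
    rw [norm_smul, norm_eq_of_mem_sphere, norm_eq_of_mem_sphere, mul_one, Real.norm_eq_abs] at this
    exact this.symm
  rcases abs_eq (zero_le_one) |>.1 h2 with h3 | h3
  · rw [h3, one_smul] at h1
    exact h (Subtype.ext h1)
  · rw [h3, neg_one_smul] at h1
    exact h' (Subtype.ext h1)

lemma obliqueProj_smul (ν ζ : Rn n) (c : ℝ) (v : Rn n) :
    obliqueProj ν ζ (c • v) = c • obliqueProj ν ζ v := by
  rw [obliqueProj, obliqueProj, inner_smul_right, mul_div_assoc]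
  module

lemma perp_obliqueProj {ζ : Rn n} (hζ : ‖ζ‖ = 1) (ν v : Rn n) :
    perp ζ (obliqueProj ν ζ v) = perp ζ v := by
  rw [obliqueProj, perp_sub, perp_smul, perp_self hζ, smul_zero, sub_zero]

/-- Rescaling a profile rescales the beam mass. -/
lemma beamMass_comp_smul (hn : 1 ≤ n) (x a : Rn n) (ζ η : Sph n) {c : ℝ} (hc : 0 < c) :
    beamMass Ω (fun v => ψ (c • v)) x a ζ η = (c ^ n)⁻¹ * beamMass Ω ψ x a ζ η := by
  have h1 : ∀ ω : (ℝ ∙ (ζ : Rn n))ᗮ, (∫ s : ℝ, ψ (c • obliqueProj (outwardNormal Ω a) ζ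
      (s • (η : Rn n) - ‖x - a‖ • (ω : Rn n))) * ψ (c • (ω : Rn n))) =
      c⁻¹ * ∫ s : ℝ, ψ (obliqueProj (outwardNormal Ω a) ζ
        (s • (η : Rn n) - ‖x - a‖ • ((c • ω : (ℝ ∙ (ζ : Rn n))ᗮ) : Rn n))) *
        ψ ((c • ω : (ℝ ∙ (ζ : Rn n))ᗮ) : Rn n) := by
    intro ω
    have h2 := Measure.integral_comp_mul_left (fun s : ℝ => ψ (obliqueProj (outwardNormal Ω a) ζ
      (s • (η : Rn n) - ‖x - a‖ • ((c • ω : (ℝ ∙ (ζ : Rn n))ᗮ) : Rn n))) *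
      ψ ((c • ω : (ℝ ∙ (ζ : Rn n))ᗮ) : Rn n)) c
    rw [abs_of_pos (inv_pos.2 hc), smul_eq_mul] at h2
    rw [← h2]
    refine integral_congr_ae (Eventually.of_forall fun s => ?_)
    simp only [Submodule.coe_smul, ← obliqueProj_smul]
    congr 3
    module
  rw [beamMass, beamMass]
  simp only [h1]
  rw [integral_const_mul]
  have h3 := Measure.integral_comp_smul (perpVol (ζ : Rn n)) (fun ω : (ℝ ∙ (ζ : Rn n))ᗮ =>
    ∫ s : ℝ, ψ (obliqueProj (outwardNormal Ω a) ζ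
      (s • (η : Rn n) - ‖x - a‖ • (ω : Rn n))) * ψ (ω : Rn n)) c
  rw [finrank_perpSpace hn (norm_eq_of_mem_sphere ζ), abs_of_pos (by positivity), smul_eq_mul] at h3
  have h4 : c ^ n = c * c ^ (n - 1) := by rw [← pow_succ', Nat.sub_add_cancel hn]
  rw [h4, mul_inv, mul_assoc]
  exact congrArg _ h3

/-- The integrand is continuous, nonnegative and equal to 1 at the origin. Its support is compact
because `perp ζ` does not see the oblique projection, so bounding the projected vector bounds
`|s|‖perp ζ η‖`. -/
lemma beamMass_pos (hψ : IsProfile ψ) (x a : Rn n) {ζ η : Sph n} (hη : perp (ζ : Rn n) η ≠ 0) :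
    0 < beamMass Ω ψ x a ζ η := by
  obtain ⟨ρ, hρ0, hρ⟩ := hψ.exists_radius
  have hζ := norm_eq_of_mem_sphere ζ
  set ν := outwardNormal Ω a
  set L := ‖x - a‖ with hL
  have hL0 : 0 ≤ L := norm_nonneg _
  set Φ : (ℝ ∙ (ζ : Rn n))ᗮ × ℝ → ℝ := fun w =>
    ψ (obliqueProj ν ζ (w.2 • (η : Rn n) - L • (w.1 : Rn n))) * ψ (w.1 : Rn n) with hΦ
  have hΦc : Continuous Φ := by
    have h1 := hψ.continuous
    have h2 := continuous_obliqueProj ν (ζ : Rn n)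
    fun_prop
  have hcomp : HasCompactSupport Φ := by
    refine HasCompactSupport.intro (K := Metric.closedBall (0 : (ℝ ∙ (ζ : Rn n))ᗮ) ρ ×ˢ
      Metric.closedBall (0 : ℝ) ((ρ + L * ρ) / ‖perp (ζ : Rn n) η‖))
      ((isCompact_closedBall _ _).prod (isCompact_closedBall _ _)) fun w hw => ?_
    by_contra h0
    have h1 := hρ _ (left_ne_zero_of_mul h0)
    have h2 := hρ _ (right_ne_zero_of_mul h0)
    refine hw ⟨mem_closedBall_zero_iff.2 h2, ?_⟩
    rw [mem_closedBall_zero_iff, le_div_iff₀ (norm_pos_iff.2 hη), ← norm_smul, ← perp_smul]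
    have h3 := (norm_perp_le hζ _).trans h1
    rw [perp_obliqueProj hζ, perp_sub] at h3
    have h4 := norm_perp_le hζ (L • (w.1 : Rn n))
    rw [norm_smul, Real.norm_eq_abs, abs_of_nonneg hL0] at h4
    have h5 := norm_le_norm_add_norm_sub' (perp (ζ : Rn n) (w.2 • (η : Rn n)))
      (perp (ζ : Rn n) (L • (w.1 : Rn n)))
    have h6 := mul_le_mul_of_nonneg_left h2 hL0
    linarith
  have hpos : 0 < ∫ w, Φ w ∂((perpVol (ζ : Rn n)).prod volume) := by
    refine hΦc.integral_pos_of_hasCompactSupport_nonneg_nonzero hcomp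
      (fun w => mul_nonneg (hψ.nonneg _) (hψ.nonneg _)) (x := 0) ?_
    have e : obliqueProj ν (ζ : Rn n) 0 = 0 := by
      have := obliqueProj_smul ν (ζ : Rn n) 0 0
      rwa [zero_smul, zero_smul] at this
    simp [hΦ, e, hψ.at_zero]
  rw [integral_prod _ (hΦc.integrable_of_hasCompactSupport hcomp)] at hpos
  exact hpos

lemma exists_isProfile (n : ℕ) : ∃ ψ : Rn n → ℝ, IsProfile ψ := by
  let b : ContDiffBump (0 : Rn n) := ⟨1, 2, one_pos, one_lt_two⟩
  exact ⟨b, b.contDiff, b.hasCompactSupport, fun _ => b.nonneg, fun _ => b.le_one,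
    b.one_of_mem_closedBall (Metric.mem_closedBall_self zero_le_one)⟩

lemma IsProfile.comp_smul (hψ : IsProfile ψ) {c : ℝ} (hc : c ≠ 0) :
    IsProfile fun v => ψ (c • v) where
  smooth := hψ.smooth.comp (contDiff_const_smul c)
  compactSupport := hψ.compactSupport.comp_homeomorph (Homeomorph.smulOfNeZero c hc)
  nonneg _ := hψ.nonneg _
  le_one _ := hψ.le_one _
  at_zero := by rw [smul_zero, hψ.at_zero]

/-- Dilating the argument of a profile by `c` divides the product of the two masses by `c^(2n)`;
take `c` to be the `2n`-th root of that product. -/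
lemma exists_normalized_profile (hn : 1 ≤ n) (x a b : Rn n) {ζ η : Sph n}
    (hζη : perp (ζ : Rn n) η ≠ 0) (hηζ : perp (η : Rn n) ζ ≠ 0) :
    ∃ ψ : Rn n → ℝ, IsProfile ψ ∧ beamMass Ω ψ x a ζ η * beamMass Ω ψ x b η ζ = 1 := by
  obtain ⟨ψ, hψ⟩ := exists_isProfile n
  set m := beamMass Ω ψ x a ζ η * beamMass Ω ψ x b η ζ with hm
  have hm0 : 0 < m := mul_pos (beamMass_pos hψ x a hζη) (beamMass_pos hψ x b hηζ)
  set c : ℝ := m ^ (((2 * n : ℕ) : ℝ)⁻¹) with hc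
  have hc0 : 0 < c := Real.rpow_pos_of_pos hm0 _
  have hcm : c ^ (2 * n) = m := Real.rpow_inv_natCast_pow hm0.le (by omega)
  refine ⟨_, hψ.comp_smul hc0.ne', ?_⟩
  rw [beamMass_comp_smul hn _ _ _ _ hc0, beamMass_comp_smul hn _ _ _ _ hc0]
  calc _ = (c ^ (2 * n))⁻¹ * m := by rw [hm]; ring
    _ = 1 := by rw [hcm, inv_mul_cancel₀ hm0.ne']

end Profile

/-! ### Chords through the crossing point and the two limits. -/

section Rays

variable {n : ℕ} {Ω : Set (Rn n)} {σ : Rn n → ℝ} {k : Rn n → Sph n → Sph n → ℝ}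
  {f u : Rn n → Sph n → ℝ} {D M B : ℝ} {ψ : Rn n → ℝ} {x : Rn n} {ζ η : Sph n}

lemma IsRTESolution.const_mul (hu : IsRTESolution Ω σ k f u) (c : ℝ) :
    IsRTESolution Ω σ k (fun y θ => c * f y θ) fun y θ => c * u y θ where
  measurable := hu.measurable.const_mul c
  bounded := by
    obtain ⟨C, hC⟩ := hu.bounded
    refine ⟨|c| * C, fun y hy θ => ?_⟩
    rw [abs_mul]
    exact mul_le_mul_of_nonneg_left (hC y hy θ) (abs_nonneg c)
  transport y θ t ht hray h1 h2 := by
    rw [← mul_sub, hu.transport y θ t ht hray h1 h2, ← intervalIntegral.integral_const_mul]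
    congr 1
    funext r
    simp only [rteRHS, mul_left_comm _ c, integral_const_mul]
    ring
  boundary y θ h := by rw [hu.boundary y θ h]

lemma isFirstBoundaryPoint_entryPoint (hΩ : IsOpen Ω) (hD : ∀ y ∈ Ω, ∀ z ∈ Ω, dist y z ≤ D)
    (hx : x ∈ Ω) (ζ : Sph n) : IsFirstBoundaryPoint Ω x (-ζ) (entryPoint Ω x ζ) := by
  have hζ := norm_eq_of_mem_sphere ζ
  refine ⟨backExit Ω x ζ, backExit_pos hΩ hD hζ hx, ?_, entryPoint_mem_frontier hΩ hD hζ hx,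
    fun s hs h => ?_⟩
  · rw [coe_neg_sphere, smul_neg, ← sub_eq_add_neg]
    rfl
  · rw [coe_neg_sphere, smul_neg, ← sub_eq_add_neg] at h
    exact (hΩ.frontier_eq ▸ h).2 (mem_of_lt_backExit hs.1.le hs.2)

lemma chord_mem (ζ : Sph n) {r : ℝ} (hr : r ∈ Ioo 0 (backExit Ω x (-ζ : Sph n) + backExit Ω x ζ)) :
    x + backExit Ω x (-ζ : Sph n) • (ζ : Rn n) - r • (ζ : Rn n) ∈ Ω := by
  rcases lt_or_ge r (backExit Ω x (-ζ : Sph n)) with h | h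
  · have h1 : x - (backExit Ω x (-ζ : Sph n) - r) • ((-ζ : Sph n) : Rn n) ∈ Ω :=
      mem_of_lt_backExit (by linarith) (by linarith [hr.1])
    rw [coe_neg_sphere] at h1 ⊢
    convert h1 using 1
    module
  · have h1 : x - (r - backExit Ω x (-ζ : Sph n)) • (ζ : Rn n) ∈ Ω :=
      mem_of_lt_backExit (by linarith) (by linarith [hr.2])
    convert h1 using 1
    module

lemma entryPoint_neg (ζ : Sph n) :
    entryPoint Ω x (-ζ : Sph n) = x + backExit Ω x (-ζ : Sph n) • (ζ : Rn n) := by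
  rw [entryPoint, coe_neg_sphere]
  module

/-- The ends of the chord are not in `Ω`, so the diameter bound is applied to points `δ` inside
them, at distance `T - 2δ`; the choice of `δ` keeps this above `D` if `T > D`. -/
lemma chord_le (hD : ∀ y ∈ Ω, ∀ z ∈ Ω, dist y z ≤ D) (ζ : Sph n)
    (h1 : 0 < backExit Ω x (-ζ : Sph n)) (h2 : 0 < backExit Ω x ζ) :
    backExit Ω x (-ζ : Sph n) + backExit Ω x ζ ≤ D := by
  set T := backExit Ω x (-ζ : Sph n) + backExit Ω x ζ with hT
  by_contra! hlt
  have hδ : 0 < min (T / 4) ((T - D) / 4) := by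
    refine lt_min (by positivity) (by linarith)
  set δ := min (T / 4) ((T - D) / 4)
  have h3 : δ ≤ T / 4 := min_le_left _ _
  have h4 : δ ≤ (T - D) / 4 := min_le_right _ _
  have h5 := hD _ (chord_mem (x := x) ζ (r := δ) ⟨hδ, by linarith⟩) _
    (chord_mem (x := x) ζ (r := T - δ) ⟨by linarith, by linarith⟩)
  rw [dist_sub_left, dist_eq_norm, ← sub_smul, norm_smul, norm_eq_of_mem_sphere, mul_one,
    Real.norm_eq_abs, abs_sub_comm] at h5
  have := (le_abs_self _).trans h5
  linarith

/-- Splitting the chord at `x` exhibits the two factors that cancel in the final quotient against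
those of the scattered paths. -/
lemma atten_chord (hadm : IsAdmissible Ω σ k) (ζ : Sph n) (h1 : 0 < backExit Ω x (-ζ : Sph n))
    (h2 : 0 < backExit Ω x ζ) :
    atten σ (entryPoint Ω x (-ζ : Sph n)) ζ (backExit Ω x (-ζ : Sph n) + backExit Ω x ζ) =
      atten σ (entryPoint Ω x (-ζ : Sph n)) ζ (backExit Ω x (-ζ : Sph n)) *
        atten σ x ζ (backExit Ω x ζ) := by
  rw [entryPoint_neg]
  have hτ := add_pos h1 h2
  have hc := continuousOn_sigma_ray hadm hτ fun r hr => chord_mem (x := x) ζ hr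
  have hi1 : IntervalIntegrable (fun r : ℝ => σ (x + backExit Ω x (-ζ : Sph n) • (ζ : Rn n) -
      r • (ζ : Rn n))) volume 0 (backExit Ω x (-ζ : Sph n)) :=
    (hc.mono (Icc_subset_Icc_right (by linarith))).intervalIntegrable_of_Icc h1.le
  have hi2 : IntervalIntegrable (fun r : ℝ => σ (x + backExit Ω x (-ζ : Sph n) • (ζ : Rn n) -
      r • (ζ : Rn n))) volume (backExit Ω x (-ζ : Sph n))
      (backExit Ω x (-ζ : Sph n) + backExit Ω x ζ) :=
    (hc.mono (Icc_subset_Icc_left h1.le)).intervalIntegrable_of_Icc (by linarith)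
  rw [atten, atten, atten, ← Real.exp_add, ← intervalIntegral.integral_add_adjacent_intervals hi1 hi2,
    neg_add]
  congr 3
  have h3 := intervalIntegral.integral_comp_add_left (a := 0) (b := backExit Ω x ζ)
    (fun r : ℝ => σ (x + backExit Ω x (-ζ : Sph n) • (ζ : Rn n) - r • (ζ : Rn n)))
    (backExit Ω x (-ζ : Sph n))
  rw [add_zero] at h3
  rw [← h3]
  refine intervalIntegral.integral_congr fun r _ => ?_
  refine congrArg σ ?_
  module

lemma entryPoint_neg_mem_outflow (hΩ : IsBoundedC1Domain Ω) (hD : ∀ y ∈ Ω, ∀ z ∈ Ω, dist y z ≤ D)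
    (hx : x ∈ Ω) (h : ⟪outwardNormal Ω (entryPoint Ω x (-ζ : Sph n)), ((-ζ : Sph n) : Rn n)⟫ ≠ 0) :
    (entryPoint Ω x (-ζ : Sph n), ζ) ∈ outflow Ω := by
  have h1 := entryPoint_mem_inflow hΩ hD hx h
  refine ⟨h1.1, ?_⟩
  have h2 : ⟪outwardNormal Ω (entryPoint Ω x (-ζ : Sph n)), ((-ζ : Sph n) : Rn n)⟫ < 0 := h1.2
  rw [coe_neg_sphere ζ, inner_neg_right] at h2
  rw [coe_neg_sphere ζ]
  exact neg_lt_zero.1 h2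

/-- In the direction of the source only the unscattered part survives in the limit. -/
lemma TransportSetting.tendsto_unscattered (h : TransportSetting Ω σ k D M B) (hn : 3 ≤ n)
    (hψ : IsProfile ψ) (hx : x ∈ Ω) (hin : (entryPoint Ω x ζ, ζ) ∈ inflow Ω)
    (hout : (entryPoint Ω x (-ζ : Sph n), ζ) ∈ outflow Ω) {u : ℝ → Rn n → Sph n → ℝ}
    (hu : ∀ ε : ℝ, 0 < ε → IsRTESolution Ω σ k (source ψ (entryPoint Ω x ζ) ζ ε) (u ε)) :
    Tendsto (fun ε : ℝ => u ε (entryPoint Ω x (-ζ : Sph n)) ζ) (𝓝[>] 0)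
      (𝓝 (atten σ (entryPoint Ω x (-ζ : Sph n)) ζ (backExit Ω x (-ζ : Sph n)) *
        atten σ x ζ (backExit Ω x ζ))) := by
  have h1 := backExit_pos h.domain.isOpen h.dist_le (norm_eq_of_mem_sphere (-ζ)) hx
  have h2 := backExit_pos h.domain.isOpen h.dist_le (norm_eq_of_mem_sphere ζ) hx
  have e : entryPoint Ω x (-ζ : Sph n) - (backExit Ω x (-ζ : Sph n) + backExit Ω x ζ) • (ζ : Rn n) =
      entryPoint Ω x ζ := by
    rw [entryPoint_neg, entryPoint]
    module
  have h3 := h.tendsto_ballistic hn hψ x ζ (backExit Ω x ζ) hu (add_pos h1 h2)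
    (chord_le h.dist_le ζ h1 h2)
    (fun r hr => by rw [entryPoint_neg]; exact chord_mem ζ hr) (Or.inr hout) (by rw [e]; exact hin)
  rw [← atten_chord h.admissible ζ h1 h2, ← tendsto_sub_nhds_zero_iff]
  refine h3.congr fun ε => ?_
  have e1 : source ψ (entryPoint Ω x ζ) ζ ε (entryPoint Ω x ζ) ζ = 1 := by
    rw [source, sub_self, sub_self, smul_zero, hψ.at_zero, one_mul]
  rw [e]
  exact congrArg _ ((congrArg _ e1).trans (mul_one _))

/-- In a transversal direction the single scattering at the crossing point dominates. -/
lemma TransportSetting.tendsto_scattered (h : TransportSetting Ω σ k D M B) (hn : 3 ≤ n)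
    (hψ : IsProfile ψ) (hx : x ∈ Ω)
    (htr : ⟪outwardNormal Ω (entryPoint Ω x ζ), (ζ : Rn n)⟫ ≠ 0)
    (hin : (entryPoint Ω x η, η) ∈ inflow Ω) (hout : (entryPoint Ω x (-η : Sph n), η) ∈ outflow Ω)
    (hζη : perp (ζ : Rn n) η ≠ 0) {U : ℝ → Rn n → Sph n → ℝ}
    (hU : ∀ ε : ℝ, 0 < ε → IsRTESolution Ω σ k
      (fun y θ => (ε ^ n)⁻¹ * source ψ (entryPoint Ω x ζ) ζ ε y θ) (U ε)) :
    Tendsto (fun ε : ℝ => U ε (entryPoint Ω x (-η : Sph n)) η) (𝓝[>] 0)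
      (𝓝 (atten σ (entryPoint Ω x (-η : Sph n)) η (backExit Ω x (-η : Sph n)) *
        (k x η ζ * atten σ x ζ (backExit Ω x ζ)) * beamMass Ω ψ x (entryPoint Ω x ζ) ζ η)) := by
  have h1 := backExit_pos h.domain.isOpen h.dist_le (norm_eq_of_mem_sphere (-η)) hx
  have h2 := backExit_pos h.domain.isOpen h.dist_le (norm_eq_of_mem_sphere η) hx
  have e : entryPoint Ω x (-η : Sph n) - (backExit Ω x (-η : Sph n) + backExit Ω x η) • (η : Rn n) =
      entryPoint Ω x η := by
    rw [entryPoint_neg, entryPoint]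
    module
  -- By linearity `ε ^ n * U ε` is itself a solution for the unscaled source, so the estimates apply
  -- to it directly and uniqueness of solutions is not required.
  have hu : ∀ ε : ℝ, 0 < ε → IsRTESolution Ω σ k (source ψ (entryPoint Ω x ζ) ζ ε)
      (fun y θ => ε ^ n * U ε y θ) := by
    intro ε hε
    have := (hU ε hε).const_mul (ε ^ n)
    simpa only [mul_inv_cancel_left₀ (pow_pos hε n).ne'] using this
  have h3 := h.tendsto_single_scattering hn hψ x ζ (backExit Ω x ζ) hu (add_pos h1 h2)
    (chord_le h.dist_le η h1 h2)
    (fun r hr => by rw [entryPoint_neg]; exact chord_mem η hr) (Or.inr hout) (by rw [e]; exact hin)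
    hζη
  have h4 := h.tendsto_beamMass hn hψ hx htr hζη h1 h2 fun r hr => chord_mem η hr
  rw [← entryPoint_neg] at h4
  have h5 := h3.add h4
  rw [zero_add] at h5
  refine h5.congr' ?_
  filter_upwards [self_mem_nhdsWithin] with ε hε
  rw [mul_sub, inv_mul_cancel_left₀ (pow_pos hε n).ne']
  exact sub_add_cancel _ _

end Rays

end

theorem theorem1p2 (n : ℕ) (hn : 3 ≤ n) (Ω : Set (Rn n)) (hΩ : IsBoundedC1Domain Ω)
    (x : Rn n) (hx : x ∈ Ω) (ζ η : Sph n) (hne : η ≠ ζ) (hne' : η ≠ -ζ)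
    (htrans : ∀ ω : Sph n, (ω = ζ ∨ ω = -ζ ∨ ω = η ∨ ω = -η) →
      ∀ p : Rn n, IsFirstBoundaryPoint Ω x ω p → ⟪outwardNormal Ω p, (ω : Rn n)⟫ ≠ 0) :
    ∃ a b c d : Rn n,
      IsFirstBoundaryPoint Ω x (-ζ) a ∧ IsFirstBoundaryPoint Ω x (-η) b ∧
      IsFirstBoundaryPoint Ω x ζ c ∧ IsFirstBoundaryPoint Ω x η d ∧
      (a, ζ) ∈ inflow Ω ∧ (b, η) ∈ inflow Ω ∧ (c, ζ) ∈ outflow Ω ∧ (d, η) ∈ outflow Ω ∧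
      (∃ ψ : Rn n → ℝ, IsProfile ψ ∧ beamMass Ω ψ x a ζ η * beamMass Ω ψ x b η ζ = 1) ∧
      ∀ ψ : Rn n → ℝ, IsProfile ψ → beamMass Ω ψ x a ζ η * beamMass Ω ψ x b η ζ = 1 →
        ∀ (σ : Rn n → ℝ) (k : Rn n → Sph n → Sph n → ℝ), IsAdmissible Ω σ k →
          ∀ ua ub Ua Ub : ℝ → Rn n → Sph n → ℝ,
            (∀ ε : ℝ, 0 < ε → IsRTESolution Ω σ k (source ψ a ζ ε) (ua ε)) →
            (∀ ε : ℝ, 0 < ε → IsRTESolution Ω σ k (source ψ b η ε) (ub ε)) →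
            (∀ ε : ℝ, 0 < ε → IsRTESolution Ω σ k
              (fun y θ => (ε ^ n)⁻¹ * source ψ a ζ ε y θ) (Ua ε)) →
            (∀ ε : ℝ, 0 < ε → IsRTESolution Ω σ k
              (fun y θ => (ε ^ n)⁻¹ * source ψ b η ε y θ) (Ub ε)) →
            Tendsto (fun ε : ℝ => (Ua ε d η * Ub ε c ζ) / (ua ε c ζ * ub ε d η))
              (𝓝[>] 0) (𝓝 ((k x ζ η) ^ 2)) := by
  obtain ⟨D, hD⟩ := Metric.isBounded_iff.1 hΩ.isBounded
  have hD' : ∀ y ∈ Ω, ∀ z ∈ Ω, dist y z ≤ D := fun y hy z hz => hD hy hz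
  have hfirst : ∀ ω : Sph n, IsFirstBoundaryPoint Ω x (-ω) (entryPoint Ω x ω) :=
    isFirstBoundaryPoint_entryPoint hΩ.isOpen hD' hx
  have htr : ∀ ω : Sph n, (-ω = ζ ∨ -ω = -ζ ∨ -ω = η ∨ -ω = -η) →
      ⟪outwardNormal Ω (entryPoint Ω x ω), (ω : Rn n)⟫ ≠ 0 := by
    intro ω hω h0
    refine htrans (-ω) hω _ (hfirst ω) ?_
    rw [coe_neg_sphere, inner_neg_right, h0, neg_zero]
  have hζ := htr ζ (by simp)
  have hη := htr η (by simp)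
  have hζ' := htr (-ζ) (by simp)
  have hη' := htr (-η) (by simp)
  have ha := entryPoint_mem_inflow hΩ hD' hx hζ
  have hb := entryPoint_mem_inflow hΩ hD' hx hη
  have hc := entryPoint_neg_mem_outflow hΩ hD' hx hζ'
  have hd := entryPoint_neg_mem_outflow hΩ hD' hx hη'
  have hζη := perp_ne_zero hne hne'
  have hηζ := perp_ne_zero hne.symm (fun h => hne' (by rw [h, neg_neg]))
  refine ⟨entryPoint Ω x ζ, entryPoint Ω x η, entryPoint Ω x (-ζ : Sph n),
    entryPoint Ω x (-η : Sph n), hfirst ζ, hfirst η, by simpa using hfirst (-ζ),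
    by simpa using hfirst (-η), ha, hb, hc, hd,
    exists_normalized_profile (by omega) x _ _ hζη hηζ, ?_⟩
  intro ψ hψ hnorm σ k hadm ua ub Ua Ub hua hub hUa hUb
  obtain ⟨D, M, B, h⟩ := exists_transportSetting hΩ hadm
  have l1 := h.tendsto_unscattered hn hψ hx ha hc hua
  have l2 := h.tendsto_unscattered hn hψ hx hb hd hub
  have l3 := h.tendsto_scattered hn hψ hx hζ hb hd hζη hUa
  have l4 := h.tendsto_scattered hn hψ hx hη ha hc hηζ hUb
  have p1 := atten_pos σ (entryPoint Ω x (-ζ : Sph n)) ζ (backExit Ω x (-ζ : Sph n))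
  have p2 := atten_pos σ x ζ (backExit Ω x ζ)
  have p3 := atten_pos σ (entryPoint Ω x (-η : Sph n)) η (backExit Ω x (-η : Sph n))
  have p4 := atten_pos σ x η (backExit Ω x η)
  have l5 := (l3.mul l4).div (l1.mul l2) (by positivity)
  -- One experiment measures `k x η ζ`, the other `k x ζ η`; symmetry makes their product a square.
  rw [hadm.k_symm x hx η ζ] at l5
  refine (l5.congr fun ε => rfl).trans (le_of_eq (congrArg 𝓝 ?_))
  rw [div_eq_iff (by positivity)]
  -- Numerator and denominator contain the same four attenuation factors, so the quotient is the
  -- square of the kernel times the product of the two beam masses, which is 1.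
  linear_combination (k x ζ η ^ 2 *
    (atten σ (entryPoint Ω x (-ζ : Sph n)) ζ (backExit Ω x (-ζ : Sph n)) *
      atten σ x ζ (backExit Ω x ζ) *
      (atten σ (entryPoint Ω x (-η : Sph n)) η (backExit Ω x (-η : Sph n)) *
        atten σ x η (backExit Ω x η)))) * hnorm
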